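/- Let $N\ge 5$ and $n\ge 2$ be integers and let $a_1,\dots,a_n\in\mathbb{R}^N$ be pairwise distinct. For $1\le i<j\le n$ and $1\le k\le n$ put $\nu_{k,i,j}=\frac{N+2n-4}{N}$ if $k=i$ or $k=j$, and $\nu_{k,i,j}=\frac{N-4}{N}$ otherwise, and let $$V_n(x)=\sum_{1\le i<j\le n}\frac{|a_i-a_j|^2}{|x-a_i|^2|x-a_j|^2}\left(\sum_{1\le k<l\le n}\frac{\nu_{k,i,j}\,\nu_{l,i,j}\,|a_k-a_l|^2}{|x-a_k|^2|x-a_l|^2}\right).$$ Let $D^{2,2}(\mathbb{R}^N)$ be the closure of $C_0^\infty(\mathbb{R}^N)$ (real-valued functions) with respect to the norm $\|\Delta u\|_{L^2(\mathbb{R}^N)}$, regarded as a space of functions in $L^{2N/(N-4)}(\mathbb{R}^N)$, with $\Delta u$ understood weakly. Then: 1. For every $u\in C_0^\infty(\mathbb{R}^N)$ the function $V_n|u|^2$ is integrable and $$\int_{\mathbb{R}^N}|\Delta u|^2\,dx\ \ge\ \frac{N^2(N-4)^2}{n^4}\int_{\mathbb{R}^N}V_n(x)|u|^2\,dx .$$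 2. The constant is sharp, that is, $$\frac{N^2(N-4)^2}{n^4}=\inf_{u\in D^{2,2}(\mathbb{R}^N)\setminus\{0\}}\frac{\int_{\mathbb{R}^N}|\Delta u|^2\,dx}{\int_{\mathbb{R}^N}V_n|u|^2\,dx},$$ where $0<\int_{\mathbb{R}^N} V_n|u|^2\,dx<\infty$ for every $u\in D^{2,2}(\mathbb{R}^N)\setminus\{0\}$. 3. If $n\ge 3$, the infimum is attained in $D^{2,2}(\mathbb{R}^N)$ by $$\phi(x)=\prod_{i=1}^n|x-a_i|^{\frac{4-N}{n}},$$ and $\phi$ is the minimizer up to a multiplicative constant: $u\in D^{2,2}(\mathbb{R}^N)\setminus\{0\}$ attains the infimum if and only if $u=c\,\phi$ almost everywhere for some real $c\ne 0$. 4. If $n=2$, the infimum is not attained by any $u\in D^{2,2}(\mathbb{R}^N)\setminus\{0\}$. -/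

import Mathlib

open MeasureTheory Filter Topology
open scoped Laplacian ContDiff ENNReal

noncomputable section

/-- `u ∈ C₀^∞(ℝᴺ)`: real-valued, smooth, with compact support. -/
def IsTestFunction {N : ℕ} (u : EuclideanSpace ℝ (Fin N) → ℝ) : Prop :=
  ContDiff ℝ ∞ u ∧ HasCompactSupport u

/-- The locally integrable function `g` is the weak (distributional) Laplacian of the
locally integrable function `u`. -/
def HasWeakLaplacian {N : ℕ} (u g : EuclideanSpace ℝ (Fin N) → ℝ) : Prop :=
  LocallyIntegrable u ∧ LocallyIntegrable g ∧
    ∀ η : EuclideanSpace ℝ (Fin N) → ℝ, IsTestFunction η →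
      ∫ x, u x * Δ η x = ∫ x, g x * η x

/-- The space `D^{2,2}(ℝᴺ)` (for `N ≥ 5`): the closure of `C₀^∞(ℝᴺ)` for the norm `‖Δu‖_{L²}`,
realized as a space of functions through the Sobolev embedding into `L^{2N/(N-4)}`. -/
def MemD22 {N : ℕ} (u : EuclideanSpace ℝ (Fin N) → ℝ) : Prop :=
  MemLp u (ENNReal.ofReal (2 * N / ((N : ℝ) - 4))) ∧
    ∃ g : EuclideanSpace ℝ (Fin N) → ℝ, HasWeakLaplacian u g ∧ MemLp g 2 ∧
      ∃ w : ℕ → EuclideanSpace ℝ (Fin N) → ℝ, (∀ k, IsTestFunction (w k)) ∧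
        Tendsto (fun k => eLpNorm (fun x => Δ (w k) x - g x) 2 volume) atTop (𝓝 0) ∧
        Tendsto (fun k => eLpNorm (fun x => w k x - u x)
          (ENNReal.ofReal (2 * N / ((N : ℝ) - 4))) volume) atTop (𝓝 0)

/-- The weights `ν_{k,i,j}`. -/
def rellichWeight (N : ℕ) {n : ℕ} (k i j : Fin n) : ℝ :=
  if k = i ∨ k = j then ((N : ℝ) + 2 * n - 4) / N else ((N : ℝ) - 4) / N

/-- The multipolar potential `V_n` with poles `a 0, …, a (n - 1)`. -/
def multipolarPotential {N n : ℕ} (a : Fin n → EuclideanSpace ℝ (Fin N))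
    (x : EuclideanSpace ℝ (Fin N)) : ℝ :=
  ∑ i, ∑ j ∈ Finset.Ioi i, ‖a i - a j‖ ^ 2 / (‖x - a i‖ ^ 2 * ‖x - a j‖ ^ 2) *
    ∑ k, ∑ l ∈ Finset.Ioi k,
      rellichWeight N k i j * rellichWeight N l i j * ‖a k - a l‖ ^ 2 /
        (‖x - a k‖ ^ 2 * ‖x - a l‖ ^ 2)

/-- The constant `N²(N-4)²/n⁴`. -/
def rellichConstant (N n : ℕ) : ℝ := (N : ℝ) ^ 2 * ((N : ℝ) - 4) ^ 2 / (n : ℝ) ^ 4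

/-- The values `∫ |Δu|² / ∫ V_n |u|²` for `u ∈ D^{2,2}(ℝᴺ) \ {0}`. -/
def rellichQuotients {N n : ℕ} (a : Fin n → EuclideanSpace ℝ (Fin N)) : Set ℝ :=
  {q | ∃ u g : EuclideanSpace ℝ (Fin N) → ℝ, MemD22 u ∧ ¬ u =ᵐ[volume] 0 ∧
    HasWeakLaplacian u g ∧ q = (∫ x, g x ^ 2) / ∫ x, multipolarPotential a x * u x ^ 2}

/-- `u ∈ D^{2,2}(ℝᴺ) \ {0}` attains the constant: `∫ |Δu|² = (N²(N-4)²/n⁴) ∫ V_n |u|²`, where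
both integrals are finite. -/
def AttainsRellich {N n : ℕ} (a : Fin n → EuclideanSpace ℝ (Fin N))
    (u : EuclideanSpace ℝ (Fin N) → ℝ) : Prop :=
  MemD22 u ∧ ¬ u =ᵐ[volume] 0 ∧
    ∃ g : EuclideanSpace ℝ (Fin N) → ℝ, HasWeakLaplacian u g ∧
      Integrable (fun x => g x ^ 2) ∧ Integrable (fun x => multipolarPotential a x * u x ^ 2) ∧
      ∫ x, g x ^ 2 = rellichConstant N n * ∫ x, multipolarPotential a x * u x ^ 2

/-- The function `φ(x) = ∏ |x - a_i|^{(4-N)/n}`. -/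
def rellichMinimizer {N n : ℕ} (a : Fin n → EuclideanSpace ℝ (Fin N))
    (x : EuclideanSpace ℝ (Fin N)) : ℝ :=
  ∏ i, ‖x - a i‖ ^ ((4 - (N : ℝ)) / n)

end

noncomputable section

/-! Put `β = (N - 4) / n` and `T = ∑ |x - a k|⁻²`, and let `C` be the constant. Away from the poles
`φ = ∏ |x - a k| ^ (-β)` satisfies `-Δφ = φ W` with `W ≥ 2βT > 0`, and `V` is exactly the potential
for which `Δ²φ = C V φ`. Both facts come from one formula, `laplacian_poleProd`, for the Laplacian
of `∏ |x - a k| ^ (2 c k)`: the function `φ W` is again a combination of such products, whose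
exponents are the weights `ν` up to a factor.

For `w = φ v` with `v` supported away from the poles, write `R = φ Δv + 2 ∇φ·∇v`. Then `Δw = R -
φWv`, and integrating `Δ(φv²)` against `φW` gives the ground state identity `rellich_identity`: `∫
|Δw|² = C ∫ V w² + ∫ R² + 2 ∫ φ² W |∇v|²`. It contains the inequality and shows that equality forces
`v` to be constant.

Functions supported away from the poles are dense. The cut-offs are functions of `∑ log |x - a k|²`
on a scale `k + 1`: their gradient and Laplacian are at most `O(1/k)` times `√T` and `T`, and `T` is
locally square integrable because `N ≥ 5`. The inequality then passes to `D^{2,2}` by Fatou. If `u`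
attains the constant, approximants `φ v_k` have `∫ φ² W |∇v_k|² → 0`; as `1 / (φ² W)` is locally
bounded, the weak gradient of `u / φ` vanishes (`TestLimit.exists_eq_mul_phi`).

For sharpness the cut-offs are applied to `φ` itself. The identity bounds the deficit `∫ |Δw|² - C ∫
V w²` by `O(1/k²)` times the integral of `(φT)²` over the support of the cut-off. Near a pole
`(φT)²` behaves like `r ^ (-2β - 4)`. For `n ≥ 3` this is integrable, `φ` lies in `D^{2,2}`, and
equality holds for it. For `n = 2` it is the borderline `r ^ (-N)`; the integral grows like `k`, so
the deficit is still `O(1/k)`, but `φ ^ (2N/(N-4))` also behaves like `r ^ (-N)`, so no multiple of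
`φ` is admissible and the constant is not attained. -/

abbrev Eucl (N : ℕ) := EuclideanSpace ℝ (Fin N)

theorem two_le_infty : (2 : WithTop ℕ∞) ≤ ((⊤ : ℕ∞) : WithTop ℕ∞) := by
  exact WithTop.coe_le_coe.2 le_top

/-! ### Pointwise vector calculus and Green's identity -/

section Calculus

variable {N : ℕ} {f g : Eucl N → ℝ} {x : Eucl N}

/-- The `i`-th partial derivative. -/
def pd (i : Fin N) (f : Eucl N → ℝ) (x : Eucl N) : ℝ :=
  fderiv ℝ f x (EuclideanSpace.single i 1)

/-- The inner product of the gradients of `f` and `g`. -/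
def gdot (f g : Eucl N → ℝ) (x : Eucl N) : ℝ := ∑ i, pd i f x * pd i g x

theorem ContDiffAt.pd_contDiffAt {m n : WithTop ℕ∞} (i : Fin N) (hf : ContDiffAt ℝ n f x)
    (hmn : m + 1 ≤ n) : ContDiffAt ℝ m (pd i f) x :=
  (hf.fderiv_right hmn).clm_apply contDiffAt_const

theorem laplacian_eq_sum_pd (hf : ContDiffAt ℝ 2 f x) : Δ f x = ∑ i, pd i (pd i f) x := by
  rw [InnerProductSpace.laplacian_eq_iteratedFDeriv_orthonormalBasis f
    (EuclideanSpace.basisFun (Fin N) ℝ)]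
  refine Finset.sum_congr rfl fun i _ => ?_
  have h1 : DifferentiableAt ℝ (fderiv ℝ f) x :=
    (hf.fderiv_right (m := 1) (by norm_num)).differentiableAt (by norm_num)
  simp only [iteratedFDeriv_two_apply, EuclideanSpace.basisFun_apply, Matrix.cons_val_zero,
    Matrix.cons_val_one]
  unfold pd
  rw [fderiv_clm_apply h1 (differentiableAt_const _)]
  simp

theorem pd_congr {i : Fin N} (h : f =ᶠ[𝓝 x] g) : pd i f x = pd i g x := by
  unfold pd; rw [h.fderiv_eq]

theorem gdot_congr {f' g' : Eucl N → ℝ} (h : f =ᶠ[𝓝 x] f') (h' : g =ᶠ[𝓝 x] g') :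
    gdot f g x = gdot f' g' x := by
  unfold gdot; simp only [pd_congr h, pd_congr h']

theorem pd_mul (i : Fin N) (hf : DifferentiableAt ℝ f x) (hg : DifferentiableAt ℝ g x) :
    pd i (fun y => f y * g y) x = f x * pd i g x + g x * pd i f x := by
  unfold pd; rw [fderiv_fun_mul hf hg]; simp

theorem pd_add (i : Fin N) (hf : DifferentiableAt ℝ f x) (hg : DifferentiableAt ℝ g x) :
    pd i (fun y => f y + g y) x = pd i f x + pd i g x := by
  unfold pd; rw [fderiv_fun_add hf hg]; simp

theorem pd_comp (i : Fin N) {h : ℝ → ℝ} (hh : DifferentiableAt ℝ h (f x))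
    (hf : DifferentiableAt ℝ f x) :
    pd i (fun y => h (f y)) x = deriv h (f x) * pd i f x := by
  unfold pd
  have := (hh.hasDerivAt.comp_hasFDerivAt x hf.hasFDerivAt).fderiv
  simp only [Function.comp_def] at this
  rw [this]; simp

theorem pd_sum {ι : Type*} (s : Finset ι) {F : ι → Eucl N → ℝ} (i : Fin N)
    (hF : ∀ k ∈ s, DifferentiableAt ℝ (F k) x) :
    pd i (fun y => ∑ k ∈ s, F k y) x = ∑ k ∈ s, pd i (F k) x := by
  unfold pd; rw [fderiv_fun_sum hF]; simp

theorem pd_const_mul (i : Fin N) (c : ℝ) (hf : DifferentiableAt ℝ f x) :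
    pd i (fun y => c * f y) x = c * pd i f x := by
  unfold pd; rw [fderiv_const_mul hf]; simp

theorem eventually_differentiableAt (hf : ContDiffAt ℝ 2 f x) :
    ∀ᶠ y in 𝓝 x, DifferentiableAt ℝ f y :=
  (hf.eventually (by simp)).mono fun _ hy => hy.differentiableAt (by norm_num)

theorem ContDiffAt.differentiableAt_two (hf : ContDiffAt ℝ 2 f x) : DifferentiableAt ℝ f x :=
  hf.differentiableAt (by norm_num)

theorem ContDiffAt.differentiableAt_pd (hf : ContDiffAt ℝ 2 f x) (i : Fin N) :
    DifferentiableAt ℝ (pd i f) x :=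
  (hf.pd_contDiffAt (m := 1) i (by norm_num)).differentiableAt (by norm_num)

theorem gdot_mul_right {h : Eucl N → ℝ} (hf : DifferentiableAt ℝ f x)
    (hg : DifferentiableAt ℝ g x) :
    gdot h (fun y => f y * g y) x = f x * gdot h g x + g x * gdot h f x := by
  simp only [gdot, pd_mul _ hf hg, Finset.mul_sum, ← Finset.sum_add_distrib]
  exact Finset.sum_congr rfl fun i _ => by ring

theorem gdot_comm : gdot f g x = gdot g f x :=
  Finset.sum_congr rfl fun _ _ => mul_comm _ _

theorem gdot_comp_right {h : Eucl N → ℝ} {k : ℝ → ℝ} (hk : DifferentiableAt ℝ k (f x))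
    (hf : DifferentiableAt ℝ f x) :
    gdot h (fun y => k (f y)) x = deriv k (f x) * gdot h f x := by
  simp only [gdot, pd_comp _ hk hf, Finset.mul_sum]
  exact Finset.sum_congr rfl fun i _ => by ring

theorem laplacian_fun_mul (hf : ContDiffAt ℝ 2 f x) (hg : ContDiffAt ℝ 2 g x) :
    Δ (fun y => f y * g y) x = f x * Δ g x + 2 * gdot f g x + g x * Δ f x := by
  rw [laplacian_eq_sum_pd (hf.mul hg), laplacian_eq_sum_pd hf, laplacian_eq_sum_pd hg]
  simp only [gdot, Finset.mul_sum, ← Finset.sum_add_distrib]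
  refine Finset.sum_congr rfl fun i _ => ?_
  have : pd i (fun y => f y * g y) =ᶠ[𝓝 x] fun y => f y * pd i g y + g y * pd i f y := by
    filter_upwards [eventually_differentiableAt hf, eventually_differentiableAt hg] with y h1 h2
    exact pd_mul i h1 h2
  rw [pd_congr this, pd_add (f := fun y => f y * pd i g y) (g := fun y => g y * pd i f y) i
    (hf.differentiableAt_two.mul (hg.differentiableAt_pd i))
    (hg.differentiableAt_two.mul (hf.differentiableAt_pd i)),
    pd_mul i hf.differentiableAt_two (hg.differentiableAt_pd i),
    pd_mul i hg.differentiableAt_two (hf.differentiableAt_pd i)]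
  ring

theorem laplacian_fun_comp {h : ℝ → ℝ} (hh : ContDiffAt ℝ 2 h (f x)) (hf : ContDiffAt ℝ 2 f x) :
    Δ (fun y => h (f y)) x = deriv (deriv h) (f x) * gdot f f x + deriv h (f x) * Δ f x := by
  rw [laplacian_eq_sum_pd (f := fun y => h (f y)) (hh.comp x hf), laplacian_eq_sum_pd hf]
  simp only [gdot, Finset.mul_sum, ← Finset.sum_add_distrib]
  refine Finset.sum_congr rfl fun i _ => ?_
  have hev : ∀ᶠ t in 𝓝 (f x), DifferentiableAt ℝ h t :=
    (hh.eventually (by simp)).mono fun _ hy => hy.differentiableAt (by norm_num)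
  have hdh : DifferentiableAt ℝ (deriv h) (f x) :=
    ((hh.fderiv_right (m := 1) (by norm_num)).clm_apply contDiffAt_const).differentiableAt
      (by norm_num)
  have : pd i (fun y => h (f y)) =ᶠ[𝓝 x] fun y => deriv h (f y) * pd i f y := by
    filter_upwards [eventually_differentiableAt hf, hf.continuousAt.eventually hev] with y h1 h2
    exact pd_comp i h2 h1
  rw [pd_congr this, pd_mul (f := fun y => deriv h (f y)) i (hdh.comp x hf.differentiableAt_two) (hf.differentiableAt_pd i),
    pd_comp i hdh hf.differentiableAt_two]
  ring

theorem laplacian_fun_sum {ι : Type*} (s : Finset ι) {F : ι → Eucl N → ℝ}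
    (hF : ∀ k ∈ s, ContDiffAt ℝ 2 (F k) x) :
    Δ (fun y => ∑ k ∈ s, F k y) x = ∑ k ∈ s, Δ (F k) x := by
  rw [laplacian_eq_sum_pd (ContDiffAt.sum hF)]
  rw [Finset.sum_congr rfl fun k hk => laplacian_eq_sum_pd (hF k hk), Finset.sum_comm]
  refine Finset.sum_congr rfl fun i _ => ?_
  have : pd i (fun y => ∑ k ∈ s, F k y) =ᶠ[𝓝 x] fun y => ∑ k ∈ s, pd i (F k) y := by
    have : ∀ᶠ y in 𝓝 x, ∀ k ∈ s, DifferentiableAt ℝ (F k) y :=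
      (Filter.eventually_all_finset s).2 fun k hk => eventually_differentiableAt (hF k hk)
    filter_upwards [this] with y hy
    exact pd_sum s i hy
  rw [pd_congr this, pd_sum s i fun k hk => (hF k hk).differentiableAt_pd i]

theorem laplacian_const_mul (c : ℝ) (hf : ContDiffAt ℝ 2 f x) :
    Δ (fun y => c * f y) x = c * Δ f x :=
  InnerProductSpace.laplacian_smul c hf

theorem gdot_self_nonneg : 0 ≤ gdot f f x := Finset.sum_nonneg fun _ _ => mul_self_nonneg _

theorem abs_gdot_le : |gdot f g x| ≤ √(gdot f f x) * √(gdot g g x) := by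
  rw [← Real.sqrt_mul gdot_self_nonneg]
  refine Real.abs_le_sqrt ?_
  simp only [gdot, ← pow_two]
  exact Finset.sum_mul_sq_le_sq_mul_sq _ _ _

theorem abs_pd_le_sqrt_gdot (i : Fin N) : |pd i f x| ≤ √(gdot f f x) := by
  refine Real.abs_le_sqrt ?_
  rw [pow_two]
  exact Finset.single_le_sum (f := fun i => pd i f x * pd i f x)
    (fun _ _ => mul_self_nonneg _) (Finset.mem_univ i)

theorem support_pd_subset (i : Fin N) : Function.support (pd i f) ⊆ tsupport f := by
  refine (Function.support_subset_iff'.2 fun y hy => ?_)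
  unfold pd
  rw [notMem_tsupport_iff_eventuallyEq] at hy
  rw [hy.fderiv_eq]; simp

theorem tsupport_pd_subset (i : Fin N) : tsupport (pd i f) ⊆ tsupport f :=
  closure_minimal (support_pd_subset i) (isClosed_tsupport f)

theorem laplacian_eq_zero_of_notMem_tsupport (hx : x ∉ tsupport f) : Δ f x = 0 := by
  rw [notMem_tsupport_iff_eventuallyEq] at hx
  rw [(InnerProductSpace.laplacian_congr_nhds hx).eq_of_nhds,
    show (0 : Eucl N → ℝ) = fun _ => (0 : ℝ) from rfl, InnerProductSpace.laplacian_const]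
  rfl

theorem gdot_eq_zero_of_notMem_tsupport (hx : x ∉ tsupport f) : gdot f g x = 0 := by
  refine Finset.sum_eq_zero fun i _ => ?_
  rw [Function.support_subset_iff'.1 (support_pd_subset (f := f) i) x hx, zero_mul]

theorem ContDiff.pd_contDiff (i : Fin N) (hf : ContDiff ℝ ∞ f) : ContDiff ℝ ∞ (pd i f) :=
  contDiff_iff_contDiffAt.2 fun _ => hf.contDiffAt.pd_contDiffAt i (by simp)

theorem ContDiff.laplacian_contDiff (hf : ContDiff ℝ ∞ f) : ContDiff ℝ ∞ (Δ f) := by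
  have : Δ f = fun x => ∑ i, pd i (pd i f) x :=
    funext fun x => laplacian_eq_sum_pd (hf.contDiffAt.of_le two_le_infty)
  rw [this]
  exact ContDiff.sum fun i _ => (hf.pd_contDiff i).pd_contDiff i

theorem contDiff_gdot (hf : ContDiff ℝ ∞ f) (hg : ContDiff ℝ ∞ g) : ContDiff ℝ ∞ (gdot f g) :=
  ContDiff.sum fun i _ => (hf.pd_contDiff i).mul (hg.pd_contDiff i)

/-- A product is smooth if the first factor is smooth on the support of the second one. -/
theorem contDiff_mul_of_tsupport {n : WithTop ℕ∞} (hg : ContDiff ℝ n g)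
    (hf : ∀ x ∈ tsupport g, ContDiffAt ℝ n f x) : ContDiff ℝ n fun y => f y * g y := by
  refine contDiff_iff_contDiffAt.2 fun x => ?_
  by_cases hx : x ∈ tsupport g
  · exact (hf x hx).mul hg.contDiffAt
  · refine (contDiffAt_const (c := (0 : ℝ))).congr_of_eventuallyEq ?_
    filter_upwards [notMem_tsupport_iff_eventuallyEq.1 hx] with y hy
    simp [hy]

theorem integrable_mul_of_tsupport (hg : Continuous g) (hc : HasCompactSupport g)
    (hf : ∀ x ∈ tsupport g, ContinuousAt f x) : Integrable fun y => f y * g y := by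
  refine Continuous.integrable_of_hasCompactSupport ?_ hc.mul_left
  refine continuous_of_tsupport fun x hx => ?_
  exact (hf x (tsupport_mul_subset_right hx)).mul hg.continuousAt

/-- Regularity of `f` is asked only on the support of `g`, which admits functions singular at the
poles. -/
theorem integral_mul_pd (i : Fin N) (hg : ContDiff ℝ 1 g) (hc : HasCompactSupport g)
    (hf : ∀ x ∈ tsupport g, ContDiffAt ℝ 1 f x) :
    ∫ x, f x * pd i g x = -∫ x, pd i f x * g x := by
  have hpd : Continuous (pd i g) :=
    continuous_iff_continuousAt.2 fun x =>
      (hg.contDiffAt.pd_contDiffAt (m := 0) i (by norm_num)).continuousAt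
  refine integral_mul_fderiv_eq_neg_fderiv_mul_of_integrable ?_ ?_ ?_ ?_ ?_
  · exact integrable_mul_of_tsupport hg.continuous hc fun x hx =>
      ((hf x hx).pd_contDiffAt (m := 0) i (by norm_num)).continuousAt
  · exact integrable_mul_of_tsupport hpd (hc.mono' (support_pd_subset i)) fun x hx =>
      (hf x (tsupport_pd_subset i hx)).continuousAt
  · exact integrable_mul_of_tsupport hg.continuous hc fun x hx => (hf x hx).continuousAt
  · exact fun x hx => (hf x hx).differentiableAt (by norm_num)
  · exact fun x _ => hg.contDiffAt.differentiableAt (by norm_num)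

/-- Green's second identity for a compactly supported function. -/
theorem integral_mul_laplacian (hg : ContDiff ℝ 2 g) (hc : HasCompactSupport g)
    (hf : ∀ x ∈ tsupport g, ContDiffAt ℝ 2 f x) :
    ∫ x, f x * Δ g x = ∫ x, Δ f x * g x := by
  have hpd : ∀ i, ContDiff ℝ 1 (pd i g) := fun i =>
    contDiff_iff_contDiffAt.2 fun x => hg.contDiffAt.pd_contDiffAt i (by norm_num)
  have hpf : ∀ i, ∀ x ∈ tsupport g, ContDiffAt ℝ 1 (pd i f) x := fun i x hx =>
    (hf x hx).pd_contDiffAt i (by norm_num)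
  have hcp : ∀ i, HasCompactSupport (pd i g) := fun i => hc.mono' (support_pd_subset i)
  have e1 : (fun x => f x * Δ g x) = fun x => ∑ i, f x * pd i (pd i g) x := by
    funext x; rw [laplacian_eq_sum_pd hg.contDiffAt, Finset.mul_sum]
  have e2 : (fun x => Δ f x * g x) = fun x => ∑ i, pd i (pd i f) x * g x := by
    funext x
    by_cases hx : x ∈ tsupport g
    · rw [laplacian_eq_sum_pd (hf x hx), Finset.sum_mul]
    · simp [image_eq_zero_of_notMem_tsupport hx]
  rw [e1, e2, integral_finsetSum, integral_finsetSum]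
  · refine Finset.sum_congr rfl fun i _ => ?_
    rw [integral_mul_pd i (hpd i) (hcp i) fun x hx =>
        (hf x (tsupport_pd_subset i hx)).of_le (by norm_num),
      integral_mul_pd i (hg.of_le (by norm_num)) hc (hpf i), neg_neg]
  · intro i _
    exact integrable_mul_of_tsupport hg.continuous hc fun x hx =>
      ((hpf i x hx).pd_contDiffAt (m := 0) i (by norm_num)).continuousAt
  · intro i _
    refine integrable_mul_of_tsupport ?_ ((hcp i).mono' (support_pd_subset i)) fun x hx =>
      (hf x (tsupport_pd_subset i (tsupport_pd_subset i hx))).continuousAt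
    exact continuous_iff_continuousAt.2 fun x =>
      ((hpd i).contDiffAt.pd_contDiffAt (m := 0) i (by norm_num)).continuousAt

end Calculus

end

noncomputable section

/-! ### Products of powers of the distances to the poles -/

section Poles

variable {N n : ℕ} (a : Fin n → Eucl N)

/-- The complement of the set of poles. -/
def poleFree : Set (Eucl N) := {x | ∀ k, x ≠ a k}

/-- `1 / |x - a k| ^ 2`. -/
def invSq (k : Fin n) (x : Eucl N) : ℝ := (‖x - a k‖ ^ 2)⁻¹

/-- `∑ 1 / |x - a k| ^ 2`. -/
def invSqSum (x : Eucl N) : ℝ := ∑ k, invSq a k x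

/-- `∑ c k * log |x - a k| ^ 2`. -/
def logDist (c : Fin n → ℝ) (x : Eucl N) : ℝ := ∑ k, c k * Real.log (‖x - a k‖ ^ 2)

/-- `∏ |x - a k| ^ (2 * c k)` away from the poles. -/
def poleProd (c : Fin n → ℝ) (x : Eucl N) : ℝ := Real.exp (logDist a c x)

/-- `(1 / 2) ∑ c k * c l * |a k - a l| ^ 2 / (|x - a k| ^ 2 * |x - a l| ^ 2)`. -/
def crossSum (c : Fin n → ℝ) (x : Eucl N) : ℝ :=
  1 / 2 * ∑ k, ∑ l, c k * c l * ‖a k - a l‖ ^ 2 * invSq a k x * invSq a l x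

variable {a} {x : Eucl N}

theorem isOpen_poleFree : IsOpen (poleFree a) := by
  have : poleFree a = ⋂ k, {a k}ᶜ := by ext x; simp [poleFree]
  rw [this]
  exact isOpen_iInter_of_finite fun k => isOpen_compl_singleton

theorem norm_sub_pos (hx : x ∈ poleFree a) (k : Fin n) : 0 < ‖x - a k‖ :=
  norm_pos_iff.2 (sub_ne_zero.2 (hx k))

theorem normSq_sub_ne_zero (hx : x ∈ poleFree a) (k : Fin n) : ‖x - a k‖ ^ 2 ≠ 0 :=
  (pow_pos (norm_sub_pos hx k) 2).ne'

theorem invSq_pos (hx : x ∈ poleFree a) (k : Fin n) : 0 < invSq a k x :=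
  inv_pos.2 (pow_pos (norm_sub_pos hx k) 2)

theorem invSq_nonneg (k : Fin n) : 0 ≤ invSq a k x := by unfold invSq; positivity

theorem invSqSum_nonneg : 0 ≤ invSqSum a x := Finset.sum_nonneg fun k _ => invSq_nonneg k

theorem invSq_le_invSqSum (k : Fin n) : invSq a k x ≤ invSqSum a x :=
  Finset.single_le_sum (f := fun k => invSq a k x) (fun k _ => invSq_nonneg k) (Finset.mem_univ k)

theorem contDiff_normSq (b : Eucl N) {m : WithTop ℕ∞} : ContDiff ℝ m fun y : Eucl N => ‖y - b‖ ^ 2 :=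
  (contDiff_id.sub contDiff_const).norm_sq ℝ

theorem pd_normSq (b : Eucl N) (i : Fin N) :
    pd i (fun y : Eucl N => ‖y - b‖ ^ 2) x = 2 * (x - b) i := by
  unfold pd
  have h : HasFDerivAt (fun y : Eucl N => y - b) (ContinuousLinearMap.id ℝ _) x :=
    (hasFDerivAt_id x).sub_const b
  rw [h.norm_sq.fderiv]
  simp [EuclideanSpace.inner_single_right]

theorem laplacian_normSq (b : Eucl N) :
    Δ (fun y : Eucl N => ‖y - b‖ ^ 2) x = 2 * N := by
  rw [laplacian_eq_sum_pd (contDiff_normSq b).contDiffAt]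
  have : ∀ i : Fin N, pd i (pd i fun y : Eucl N => ‖y - b‖ ^ 2) x = 2 := by
    intro i
    rw [show (pd i fun y : Eucl N => ‖y - b‖ ^ 2) = fun y => 2 * (y - b) i from
      funext fun y => pd_normSq b i]
    unfold pd
    have h : HasFDerivAt (fun y : Eucl N => (2 : ℝ) * (y - b) i)
        ((2 : ℝ) • (EuclideanSpace.proj i : Eucl N →L[ℝ] ℝ)) x := by
      have := ((EuclideanSpace.proj i : Eucl N →L[ℝ] ℝ).hasFDerivAt (x := x)).sub_const (b i)
      exact this.const_mul 2
    rw [h.fderiv]; simp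
  simp [this, mul_comm]

/-- The gradients are `2 (x - b)` and `2 (x - b')`, and polarization turns their inner product into
squared distances. This is where the mutual distances of the poles enter. -/
theorem gdot_normSq (b b' : Eucl N) :
    gdot (fun y : Eucl N => ‖y - b‖ ^ 2) (fun y => ‖y - b'‖ ^ 2) x =
      2 * (‖x - b‖ ^ 2 + ‖x - b'‖ ^ 2 - ‖b - b'‖ ^ 2) := by
  have h : ‖b - b'‖ ^ 2 = ‖x - b'‖ ^ 2 - 2 * inner ℝ (x - b') (x - b) + ‖x - b‖ ^ 2 := by
    rw [← norm_sub_sq_real]; congr 2; abel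
  rw [h]
  simp only [gdot, pd_normSq]
  rw [PiLp.inner_apply]
  simp only [RCLike.inner_apply, conj_trivial]
  ring_nf
  rw [Finset.sum_mul]

theorem contDiffAt_logNormSq {m : WithTop ℕ∞} {b : Eucl N} (hb : x ≠ b) :
    ContDiffAt ℝ m (fun y => Real.log (‖y - b‖ ^ 2)) x :=
  (contDiff_normSq b).contDiffAt.log (by simpa [sub_eq_zero] using hb)

theorem pd_logNormSq {b : Eucl N} (hb : x ≠ b) (i : Fin N) :
    pd i (fun y => Real.log (‖y - b‖ ^ 2)) x =
      (‖x - b‖ ^ 2)⁻¹ * pd i (fun y : Eucl N => ‖y - b‖ ^ 2) x := by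
  rw [pd_comp (h := Real.log) (f := fun y => ‖y - b‖ ^ 2) i
    (Real.differentiableAt_log (by simpa [sub_eq_zero] using hb))
    (contDiff_normSq b (m := 2)).contDiffAt.differentiableAt_two, Real.deriv_log]

theorem laplacian_logNormSq {b : Eucl N} (hb : x ≠ b) :
    Δ (fun y => Real.log (‖y - b‖ ^ 2)) x = 2 * ((N : ℝ) - 2) * (‖x - b‖ ^ 2)⁻¹ := by
  have h0 : ‖x - b‖ ^ 2 ≠ 0 := by simpa [sub_eq_zero] using hb
  have h1 : ‖x - b‖ ≠ 0 := by simpa [sub_eq_zero] using hb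
  rw [laplacian_fun_comp (h := Real.log) (f := fun y => ‖y - b‖ ^ 2)
    (Real.contDiffAt_log.2 h0) (contDiff_normSq b).contDiffAt, Real.deriv_log,
    Real.deriv_log', laplacian_normSq, gdot_normSq]
  simp only [deriv_inv, sub_self, norm_zero]
  field_simp
  ring

variable (a)

theorem contDiffAt_logDist {m : WithTop ℕ∞} (c : Fin n → ℝ) (hx : x ∈ poleFree a) :
    ContDiffAt ℝ m (logDist a c) x :=
  ContDiffAt.sum fun k _ => contDiffAt_const.mul (contDiffAt_logNormSq (hx k))

theorem contDiffAt_poleProd {m : WithTop ℕ∞} (c : Fin n → ℝ) (hx : x ∈ poleFree a) :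
    ContDiffAt ℝ m (poleProd a c) x := (contDiffAt_logDist a c hx).exp

theorem contDiffAt_invSq {m : WithTop ℕ∞} (k : Fin n) (hx : x ∈ poleFree a) :
    ContDiffAt ℝ m (invSq a k) x :=
  (contDiff_normSq (a k)).contDiffAt.inv (normSq_sub_ne_zero hx k)

/-- Because `Real.log 0 = 0`, positivity holds at the poles too, and division by `φ` is legitimate
at every point. -/
theorem poleProd_pos (c : Fin n → ℝ) (x : Eucl N) : 0 < poleProd a c x := Real.exp_pos _

/-- The family of products is stable under multiplication by `|x - a i|⁻²`, so one Laplacian formula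
also serves for `Δ²φ`. -/
theorem poleProd_sub_single (c : Fin n → ℝ) (i : Fin n) (hx : x ∈ poleFree a) :
    poleProd a (fun k => c k - if k = i then 1 else 0) x = poleProd a c x * invSq a i x := by
  unfold poleProd logDist invSq
  simp only [sub_mul, Finset.sum_sub_distrib, ite_mul, one_mul, zero_mul, Finset.sum_ite_eq',
    Finset.mem_univ, if_true, Real.exp_sub]
  rw [Real.exp_log (pow_pos (norm_sub_pos hx i) 2), div_eq_mul_inv]

theorem pd_logDist (c : Fin n → ℝ) (hx : x ∈ poleFree a) (i : Fin N) :
    pd i (logDist a c) x = ∑ k, c k * (invSq a k x * pd i (fun y : Eucl N => ‖y - a k‖ ^ 2) x) := by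
  have h : ∀ k, ContDiffAt ℝ 2 (fun y => Real.log (‖y - a k‖ ^ 2)) x := fun k =>
    contDiffAt_logNormSq (hx k)
  unfold logDist
  rw [pd_sum Finset.univ i fun k _ => ((h k).differentiableAt_two.const_mul _)]
  refine Finset.sum_congr rfl fun k _ => ?_
  rw [pd_const_mul i (c k) (h k).differentiableAt_two, pd_logNormSq (hx k)]
  rfl

theorem laplacian_logDist (c : Fin n → ℝ) (hx : x ∈ poleFree a) :
    Δ (logDist a c) x = 2 * ((N : ℝ) - 2) * ∑ k, c k * invSq a k x := by
  have h : ∀ k, ContDiffAt ℝ 2 (fun y => Real.log (‖y - a k‖ ^ 2)) x := fun k =>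
    contDiffAt_logNormSq (hx k)
  unfold logDist
  rw [laplacian_fun_sum Finset.univ fun k _ => contDiffAt_const.mul (h k), Finset.mul_sum]
  refine Finset.sum_congr rfl fun k _ => ?_
  rw [laplacian_const_mul _ (h k), laplacian_logNormSq (hx k)]
  simp only [invSq]; ring

theorem gdot_logDist (c : Fin n → ℝ) (hx : x ∈ poleFree a) :
    gdot (logDist a c) (logDist a c) x =
      4 * ((∑ k, c k) * ∑ k, c k * invSq a k x) - 4 * crossSum a c x := by
  have h1 : gdot (logDist a c) (logDist a c) x =
      ∑ k, ∑ l, c k * c l * invSq a k x * invSq a l x *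
        gdot (fun y : Eucl N => ‖y - a k‖ ^ 2) (fun y => ‖y - a l‖ ^ 2) x := by
    simp only [gdot, pd_logDist a c hx, Finset.mul_sum, Finset.sum_mul]
    rw [Finset.sum_comm]
    refine (Finset.sum_congr rfl fun k _ => Finset.sum_comm).trans ?_
    rw [Finset.sum_comm]
    refine Finset.sum_congr rfl fun k _ => Finset.sum_congr rfl fun l _ =>
      Finset.sum_congr rfl fun i _ => by ring
  have h2 : ∀ k l, c k * c l * invSq a k x * invSq a l x *
        gdot (fun y : Eucl N => ‖y - a k‖ ^ 2) (fun y => ‖y - a l‖ ^ 2) x =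
      2 * (c k * (c l * invSq a l x)) + 2 * (c l * (c k * invSq a k x)) -
        2 * (c k * c l * ‖a k - a l‖ ^ 2 * invSq a k x * invSq a l x) := by
    intro k l
    have hk : invSq a k x * ‖x - a k‖ ^ 2 = 1 := inv_mul_cancel₀ (normSq_sub_ne_zero hx k)
    have hl : invSq a l x * ‖x - a l‖ ^ 2 = 1 := inv_mul_cancel₀ (normSq_sub_ne_zero hx l)
    rw [gdot_normSq]
    linear_combination 2 * c k * c l * invSq a l x * hk + 2 * c k * c l * invSq a k x * hl
  rw [h1]
  simp only [h2, Finset.sum_sub_distrib, Finset.sum_add_distrib]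
  rw [crossSum, Finset.sum_comm (f := fun k l => 2 * (c l * (c k * invSq a k x)))]
  simp only [← Finset.mul_sum, ← Finset.sum_mul]
  ring

/-- From `Δ(exp L) = exp L * (|∇L|² + ΔL)`: the cross terms of `|∇L|²` produce `crossSum`, and the
rest merges with `ΔL`. -/
theorem laplacian_poleProd (c : Fin n → ℝ) (hx : x ∈ poleFree a) :
    Δ (poleProd a c) x = poleProd a c x *
      ((4 * (∑ k, c k) + 2 * ((N : ℝ) - 2)) * (∑ k, c k * invSq a k x) - 4 * crossSum a c x) := by
  unfold poleProd
  rw [laplacian_fun_comp (h := Real.exp) Real.contDiff_exp.contDiffAt (contDiffAt_logDist a c hx),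
    gdot_logDist a c hx, laplacian_logDist a c hx]
  simp only [Real.deriv_exp]
  ring

end Poles

end

noncomputable section

/-! ### The ground state `φ` and the equation `Δ²φ = C V φ` -/

section Potential

/-- The exponent `(N - 4) / n`. -/
def poleExp (N n : ℕ) : ℝ := ((N : ℝ) - 4) / n

variable {N n : ℕ} (a : Fin n → Eucl N) {x : Eucl N}

/-- `∏ |x - a k| ^ (-(N - 4) / n)` away from the poles. -/
def phi (x : Eucl N) : ℝ := poleProd a (fun _ => -(poleExp N n / 2)) x

/-- The function `-Δφ / φ`. -/
def phiPot (x : Eucl N) : ℝ :=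
  2 * poleExp N n * invSqSum a x + poleExp N n ^ 2 * crossSum a (fun _ => 1) x

/-- The coefficients of `φ / (|x - a i| ^ 2 * |x - a j| ^ 2)`. -/
def pairCoeff (N : ℕ) {n : ℕ} (i j k : Fin n) : ℝ :=
  -(poleExp N n / 2) - (if k = i then 1 else 0) - if k = j then 1 else 0

/-- Trades the sums over `i < j` in the potential for full double sums, which are easier to
rearrange. -/
theorem sum_sum_Ioi_eq_half (f : Fin n → Fin n → ℝ) (hs : ∀ i j, f i j = f j i)
    (h0 : ∀ i, f i i = 0) : ∑ i, ∑ j ∈ Finset.Ioi i, f i j = 1 / 2 * ∑ i, ∑ j, f i j := by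
  have h1 : ∀ i, ∑ j, f i j = ∑ j ∈ Finset.Ioi i, f i j + ∑ j ∈ Finset.Iio i, f i j := by
    intro i
    have hd : Disjoint (Finset.Ioi i) (Finset.Iio i) :=
      Finset.disjoint_left.2 fun k h h' =>
        absurd (Finset.mem_Ioi.1 h) (Finset.mem_Iio.1 h').le.not_gt
    rw [← Finset.sum_union hd]
    refine (Finset.sum_subset (Finset.subset_univ _) fun j _ hj => ?_).symm
    have : j = i := by
      simp only [Finset.mem_union, Finset.mem_Ioi, Finset.mem_Iio, not_or, not_lt] at hj
      exact le_antisymm hj.1 hj.2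
    rw [this, h0]
  have h2 : ∑ i, ∑ j ∈ Finset.Iio i, f i j = ∑ i, ∑ j ∈ Finset.Ioi i, f i j := by
    rw [Finset.sum_comm' (t' := Finset.univ) (s' := fun i => Finset.Ioi i) (by simp)]
    exact Finset.sum_congr rfl fun i _ => Finset.sum_congr rfl fun j _ => hs _ _
  simp only [h1, Finset.sum_add_distrib, h2]
  ring

theorem crossSum_const (c : ℝ) : crossSum a (fun _ => c) x = c ^ 2 * crossSum a (fun _ => 1) x := by
  simp only [crossSum, Finset.mul_sum]
  exact Finset.sum_congr rfl fun i _ => Finset.sum_congr rfl fun j _ => by ring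

/-- The weights are thus the exponents of `φ / (|x - a i|² |x - a j|²)` up to a common factor. This
is why the cross sums arising in `Δ²φ` reproduce the potential. -/
theorem rellichWeight_eq (hN : 5 ≤ N) (i j k : Fin n) (hij : i ≠ j) :
    rellichWeight N k i j = (n : ℝ) / N * (-2 * pairCoeff N i j k) := by
  have hN0 : (N : ℝ) ≠ 0 := by positivity
  have hn0 : (n : ℝ) ≠ 0 := by
    have : 0 < n := i.pos
    positivity
  unfold rellichWeight pairCoeff poleExp
  by_cases hi : k = i
  · have : k ≠ j := fun h => hij (hi ▸ h)
    simp only [hi, true_or, if_true, if_neg hij]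
    field_simp; ring
  · by_cases hj : k = j
    · simp only [hj, or_true, if_true, if_neg hij.symm]
      field_simp; ring
    · simp only [hi, hj, or_self, if_false]
      field_simp; ring

theorem multipolarPotential_eq (hN : 5 ≤ N) : multipolarPotential a x =
    1 / 2 * ∑ i, ∑ j, ‖a i - a j‖ ^ 2 * invSq a i x * invSq a j x *
      (4 * ((n : ℝ) / N) ^ 2 * crossSum a (pairCoeff N i j) x) := by
  have hsym : ∀ i j : Fin n, pairCoeff N i j = pairCoeff N j i := fun i j => by
    funext k; unfold pairCoeff; ring
  have key : ∀ i j, ‖a i - a j‖ ^ 2 / (‖x - a i‖ ^ 2 * ‖x - a j‖ ^ 2) *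
      ∑ k, ∑ l ∈ Finset.Ioi k, rellichWeight N k i j * rellichWeight N l i j * ‖a k - a l‖ ^ 2 /
        (‖x - a k‖ ^ 2 * ‖x - a l‖ ^ 2) = ‖a i - a j‖ ^ 2 * invSq a i x * invSq a j x *
      (4 * ((n : ℝ) / N) ^ 2 * crossSum a (pairCoeff N i j) x) := by
    intro i j
    by_cases hij : i = j
    · simp [hij]
    rw [sum_sum_Ioi_eq_half _ (fun k l => by rw [norm_sub_rev (a k), mul_comm (‖x - a k‖ ^ 2)]; ring)
      (fun k => by simp)]
    simp only [rellichWeight_eq hN _ _ _ hij, crossSum, invSq, div_eq_mul_inv, mul_inv,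
      Finset.mul_sum]
    exact Finset.sum_congr rfl fun k _ => Finset.sum_congr rfl fun l _ => by ring
  unfold multipolarPotential
  simp only [key]
  rw [sum_sum_Ioi_eq_half]
  · intro i j; rw [hsym, norm_sub_rev]; ring
  · intro i; simp

theorem rellichConstant_mul_potential (hN : 5 ≤ N) (hn : 2 ≤ n) :
    rellichConstant N n * multipolarPotential a x =
      2 * poleExp N n ^ 2 * ∑ i, ∑ j, ‖a i - a j‖ ^ 2 * invSq a i x * invSq a j x *
        crossSum a (pairCoeff N i j) x := by
  have hN0 : (N : ℝ) ≠ 0 := by positivity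
  have hn0 : (n : ℝ) ≠ 0 := by positivity
  rw [multipolarPotential_eq a hN]
  simp only [Finset.mul_sum]
  refine Finset.sum_congr rfl fun k _ => Finset.sum_congr rfl fun l _ => ?_
  unfold rellichConstant poleExp
  field_simp; ring

theorem rellichMinimizer_eq_phi (hx : x ∈ poleFree a) : rellichMinimizer a x = phi a x := by
  unfold rellichMinimizer phi poleProd logDist poleExp
  rw [Real.exp_sum]
  refine Finset.prod_congr rfl fun k _ => ?_
  rw [Real.rpow_def_of_pos (norm_sub_pos hx k), Real.log_pow]
  congr 1
  push_cast; ring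

theorem phi_pos (x : Eucl N) : 0 < phi a x := poleProd_pos a _ x

theorem contDiffAt_phi {m : WithTop ℕ∞} (hx : x ∈ poleFree a) : ContDiffAt ℝ m (phi a) x :=
  contDiffAt_poleProd a _ hx

/-- The exponents `c k = -β/2` add up to `-(N - 4)/2`, so the factor `4 ∑ c k + 2 (N - 2)` equals
`4`. -/
theorem laplacian_phi (hn : 2 ≤ n) (hx : x ∈ poleFree a) :
    Δ (phi a) x = -(phi a x * phiPot a x) := by
  have hn0 : (n : ℝ) ≠ 0 := by positivity
  have hb : (n : ℝ) * poleExp N n = N - 4 := by unfold poleExp; field_simp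
  unfold phi
  rw [laplacian_poleProd a _ hx, crossSum_const, phiPot, invSqSum]
  simp only [Finset.sum_const, Finset.card_univ, Fintype.card_fin, nsmul_eq_mul, ← Finset.mul_sum]
  linear_combination (poleProd a (fun _ => -(poleExp N n / 2)) x * poleExp N n *
    ∑ k, invSq a k x) * hb

/-- The function `-Δφ` as a combination of products of powers of distances. -/
theorem phi_mul_phiPot (hx : x ∈ poleFree a) : phi a x * phiPot a x =
    2 * poleExp N n * ∑ i, poleProd a (fun k => -(poleExp N n / 2) - if k = i then 1 else 0) x +
    1 / 2 * poleExp N n ^ 2 * ∑ i, ∑ j, ‖a i - a j‖ ^ 2 * poleProd a (pairCoeff N i j) x := by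
  have h2 : ∀ i j, poleProd a (pairCoeff N i j) x = phi a x * invSq a i x * invSq a j x := by
    intro i j
    unfold pairCoeff
    rw [poleProd_sub_single a _ j hx, poleProd_sub_single a _ i hx]
    rfl
  simp only [h2, poleProd_sub_single a _ _ hx, phiPot, crossSum, invSqSum, mul_add, Finset.mul_sum]
  congr 1
  · exact Finset.sum_congr rfl fun i _ => by unfold phi; ring
  · exact Finset.sum_congr rfl fun i _ => Finset.sum_congr rfl fun j _ => by ring

/-- Expand the product of the two shifted coefficients. The term where both shifts occur carries `|a
i - a i|² = 0`; the two mixed terms agree by symmetry. -/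
theorem crossSum_sub_single (c : ℝ) (i : Fin n) :
    crossSum a (fun k => c - if k = i then 1 else 0) x =
      c ^ 2 * crossSum a (fun _ => 1) x -
        c * ∑ l, ‖a i - a l‖ ^ 2 * invSq a i x * invSq a l x := by
  have h1 : ∀ k l, (c - if k = i then 1 else 0) * (c - if l = i then 1 else 0) *
      ‖a k - a l‖ ^ 2 * invSq a k x * invSq a l x =
      c ^ 2 * (‖a k - a l‖ ^ 2 * invSq a k x * invSq a l x) -
      c * (if k = i then ‖a k - a l‖ ^ 2 * invSq a k x * invSq a l x else 0) -
      c * (if l = i then ‖a k - a l‖ ^ 2 * invSq a k x * invSq a l x else 0) := by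
    intro k l
    by_cases hk : k = i
    · by_cases hl : l = i
      · simp [hk, hl]
      · simp only [hk, hl, if_true, if_false]; ring
    · by_cases hl : l = i
      · simp only [hk, hl, if_true, if_false]; ring
      · simp only [hk, hl, if_false]; ring
  unfold crossSum
  simp only [h1, Finset.sum_sub_distrib, ← Finset.mul_sum, Finset.sum_ite_eq', Finset.mem_univ,
    if_true, one_mul]
  have h2 : ∑ k, ∑ l, (if k = i then ‖a k - a l‖ ^ 2 * invSq a k x * invSq a l x else 0) =
      ∑ l, ‖a i - a l‖ ^ 2 * invSq a i x * invSq a l x := by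
    rw [Finset.sum_comm]
    simp
  have h3 : ∑ k, ‖a k - a i‖ ^ 2 * invSq a k x * invSq a i x =
      ∑ l, ‖a i - a l‖ ^ 2 * invSq a i x * invSq a l x :=
    Finset.sum_congr rfl fun k _ => by rw [norm_sub_rev]; ring
  rw [h2, h3]; ring

/-- `Δ² φ = C V φ` away from the poles. -/
theorem laplacian_phi_mul_phiPot (hN : 5 ≤ N) (hn : 2 ≤ n) (hx : x ∈ poleFree a) :
    Δ (fun y => phi a y * phiPot a y) x =
      -(rellichConstant N n * multipolarPotential a x * phi a x) := by
  have hn0 : (n : ℝ) ≠ 0 := by positivity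
  have hb : (n : ℝ) * poleExp N n = N - 4 := by unfold poleExp; field_simp
  set β := poleExp N n with hβ
  have hev : (fun y => phi a y * phiPot a y) =ᶠ[𝓝 x] fun y =>
      2 * β * ∑ i, poleProd a (fun k => -(β / 2) - if k = i then 1 else 0) y +
      1 / 2 * β ^ 2 * ∑ i, ∑ j, ‖a i - a j‖ ^ 2 * poleProd a (pairCoeff N i j) y := by
    filter_upwards [isOpen_poleFree.mem_nhds hx] with y hy
    exact phi_mul_phiPot a hy
  have hE : ∀ c : Fin n → ℝ, ContDiffAt ℝ 2 (poleProd a c) x := fun c => contDiffAt_poleProd a c hx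
  have hE1 : ContDiffAt ℝ 2
      (fun y => ∑ i, poleProd a (fun k => -(β / 2) - if k = i then 1 else 0) y) x :=
    ContDiffAt.sum fun i _ => hE _
  have hE2 : ∀ i, ContDiffAt ℝ 2
      (fun y => ∑ j, ‖a i - a j‖ ^ 2 * poleProd a (pairCoeff N i j) y) x := fun i =>
    ContDiffAt.sum fun j _ => contDiffAt_const.mul (hE _)
  have hE3 : ContDiffAt ℝ 2
      (fun y => ∑ i, ∑ j, ‖a i - a j‖ ^ 2 * poleProd a (pairCoeff N i j) y) x :=
    ContDiffAt.sum fun i _ => hE2 i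
  have hadd := ContDiffAt.laplacian_add (contDiffAt_const (c := 2 * β) |>.mul hE1)
    (contDiffAt_const (c := 1 / 2 * β ^ 2) |>.mul hE3)
  rw [(InnerProductSpace.laplacian_congr_nhds hev).eq_of_nhds]
  refine hadd.trans ?_
  rw [laplacian_const_mul _ hE1, laplacian_const_mul _ hE3,
    laplacian_fun_sum Finset.univ fun i _ => hE _, laplacian_fun_sum Finset.univ fun i _ => hE2 i]
  simp only [laplacian_fun_sum Finset.univ fun j _ => contDiffAt_const.mul (hE _),
    laplacian_const_mul _ (hE _), laplacian_poleProd a _ hx]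
  have h1 : ∀ i, poleProd a (fun k => -(β / 2) - if k = i then 1 else 0) x =
      phi a x * invSq a i x := fun i => poleProd_sub_single a _ i hx
  have h2 : ∀ i j, poleProd a (pairCoeff N i j) x = phi a x * invSq a i x * invSq a j x := by
    intro i j
    unfold pairCoeff
    rw [poleProd_sub_single a _ j hx, poleProd_sub_single a _ i hx]
    rfl
  -- These coefficient sums make `4 ∑ c k + 2 (N - 2)` equal to `0` for the singly shifted products
  -- and to `-4` for the doubly shifted ones.
  have s1 : ∀ i : Fin n, ∑ k, (-(β / 2) - if k = i then 1 else 0 : ℝ) = -((N : ℝ) - 4) / 2 - 1 := by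
    intro i
    simp only [Finset.sum_sub_distrib, Finset.sum_ite_eq', Finset.mem_univ, if_true,
      Finset.sum_const, Finset.card_univ, Fintype.card_fin, nsmul_eq_mul, ← hb]
    ring
  have s2 : ∀ i j : Fin n, ∑ k, pairCoeff N i j k = -((N : ℝ) - 4) / 2 - 2 := by
    intro i j
    simp only [pairCoeff, Finset.sum_sub_distrib, Finset.sum_ite_eq', Finset.mem_univ, if_true,
      Finset.sum_const, Finset.card_univ, Fintype.card_fin, nsmul_eq_mul, ← hb, ← hβ]
    ring
  have s3 : ∀ i j : Fin n, ∑ k, pairCoeff N i j k * invSq a k x =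
      -(β / 2) * invSqSum a x - invSq a i x - invSq a j x := by
    intro i j
    simp only [pairCoeff, sub_mul, Finset.sum_sub_distrib, ite_mul, one_mul, zero_mul,
      Finset.sum_ite_eq', Finset.mem_univ, if_true, ← Finset.mul_sum, invSqSum, ← hβ]
  rw [rellichConstant_mul_potential a hN hn]
  simp only [h1, h2, s1, s2, s3, crossSum_sub_single, ← hβ]
  set P := crossSum a (fun _ => 1) x with hP
  set X := ∑ i, ∑ j, ‖a i - a j‖ ^ 2 * invSq a i x ^ 2 * invSq a j x with hX
  have hX' : ∑ i, ∑ j, ‖a i - a j‖ ^ 2 * invSq a i x * invSq a j x ^ 2 = X := by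
    rw [hX, Finset.sum_comm]
    exact Finset.sum_congr rfl fun i _ => Finset.sum_congr rfl fun j _ => by
      rw [norm_sub_rev]; ring
  have hP' : ∑ i, ∑ j, ‖a i - a j‖ ^ 2 * invSq a i x * invSq a j x = 2 * P := by
    rw [hP, crossSum]; simp
  have e1 : ∑ i, phi a x * invSq a i x * ((4 * (-((N : ℝ) - 4) / 2 - 1) + 2 * ((N : ℝ) - 2)) *
      ∑ k, (-(β / 2) - if k = i then 1 else 0) * invSq a k x - 4 * ((-(β / 2)) ^ 2 * P -
        -(β / 2) * ∑ l, ‖a i - a l‖ ^ 2 * invSq a i x * invSq a l x)) =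
      phi a x * (-(β ^ 2) * P * invSqSum a x - 2 * β * X) := by
    have : 4 * (-((N : ℝ) - 4) / 2 - 1) + 2 * ((N : ℝ) - 2) = 0 := by ring
    simp only [this, zero_mul, zero_sub]
    simp only [hX, invSqSum, mul_sub, Finset.mul_sum, ← Finset.sum_sub_distrib]
    refine Finset.sum_congr rfl fun i _ => ?_
    have : -(4 * ((-(β / 2)) ^ 2 * P)) = -(β ^ 2) * P := by ring
    simp only [← Finset.mul_sum, neg_sub]
    have e : ∑ l, ‖a i - a l‖ ^ 2 * invSq a i x ^ 2 * invSq a l x =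
        invSq a i x * ∑ l, ‖a i - a l‖ ^ 2 * invSq a i x * invSq a l x := by
      rw [Finset.mul_sum]; exact Finset.sum_congr rfl fun l _ => by ring
    rw [e]; ring
  have e2 : ∑ i, ∑ j, ‖a i - a j‖ ^ 2 * (phi a x * invSq a i x * invSq a j x *
      ((4 * (-((N : ℝ) - 4) / 2 - 2) + 2 * ((N : ℝ) - 2)) *
        (-(β / 2) * invSqSum a x - invSq a i x - invSq a j x) -
          4 * crossSum a (pairCoeff N i j) x)) =
      phi a x * (4 * β * P * invSqSum a x + 8 * X - 4 * ∑ i, ∑ j, ‖a i - a j‖ ^ 2 *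
        invSq a i x * invSq a j x * crossSum a (pairCoeff N i j) x) := by
    have : ∀ i j, ‖a i - a j‖ ^ 2 * (phi a x * invSq a i x * invSq a j x *
      ((4 * (-((N : ℝ) - 4) / 2 - 2) + 2 * ((N : ℝ) - 2)) *
        (-(β / 2) * invSqSum a x - invSq a i x - invSq a j x) -
          4 * crossSum a (pairCoeff N i j) x)) =
      phi a x * (2 * β * invSqSum a x * (‖a i - a j‖ ^ 2 * invSq a i x * invSq a j x) +
        4 * (‖a i - a j‖ ^ 2 * invSq a i x ^ 2 * invSq a j x) +
        4 * (‖a i - a j‖ ^ 2 * invSq a i x * invSq a j x ^ 2) -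
        4 * (‖a i - a j‖ ^ 2 *
        invSq a i x * invSq a j x * crossSum a (pairCoeff N i j) x)) := fun i j => by ring
    simp only [this, ← Finset.mul_sum, Finset.sum_add_distrib, Finset.sum_sub_distrib]
    rw [hP', hX', ← hX]; ring
  -- With the prefactors `2β` and `β²/2`, the contributions `P * T` and `X` of the two sums cancel.
  -- Only the cross sums with coefficients `pairCoeff` survive, and they form `C V`.
  rw [e1, e2]; ring

end Potential

end

noncomputable section

/-! ### Positivity, size and measurability of the potentials -/

section Bounds

variable {N n : ℕ} (a : Fin n → Eucl N) {x : Eucl N}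

theorem poleExp_pos (hN : 5 ≤ N) (hn : 2 ≤ n) : 0 < poleExp N n := by
  have : (5 : ℝ) ≤ N := by exact_mod_cast hN
  exact div_pos (by linarith) (by positivity)

theorem rellichConstant_pos (hN : 5 ≤ N) (hn : 2 ≤ n) : 0 < rellichConstant N n := by
  have : (5 : ℝ) ≤ N := by exact_mod_cast hN
  have : (0 : ℝ) < N - 4 := by linarith
  unfold rellichConstant; positivity

theorem crossSum_nonneg {c : Fin n → ℝ} (hc : ∀ k l, 0 ≤ c k * c l) : 0 ≤ crossSum a c x := by
  refine mul_nonneg (by norm_num) (Finset.sum_nonneg fun k _ => Finset.sum_nonneg fun l _ => ?_)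
  exact mul_nonneg (mul_nonneg (mul_nonneg (hc k l) (by positivity)) (invSq_nonneg k))
    (invSq_nonneg l)

/-- This is `|∇L|² ≥ 0` for `L = ∑ log |x - a k|²`, read off from `gdot_logDist`. It makes `W`
comparable to `T`. -/
theorem crossSum_one_le (hx : x ∈ poleFree a) :
    crossSum a (fun _ => 1) x ≤ n * invSqSum a x := by
  have h := gdot_self_nonneg (f := logDist a fun _ => 1) (x := x)
  rw [gdot_logDist a _ hx] at h
  simp only [Finset.sum_const, Finset.card_univ, Fintype.card_fin, nsmul_eq_mul, mul_one,
    one_mul] at h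
  unfold invSqSum
  linarith

theorem gdot_logDist_one_le (hx : x ∈ poleFree a) :
    gdot (logDist a fun _ => 1) (logDist a fun _ => 1) x ≤ 4 * n * invSqSum a x := by
  have h := crossSum_nonneg a (x := x) (c := fun _ => 1) (by simp)
  rw [gdot_logDist a _ hx]
  simp only [Finset.sum_const, Finset.card_univ, Fintype.card_fin, nsmul_eq_mul, mul_one,
    one_mul]
  unfold invSqSum
  linarith

theorem laplacian_logDist_one (hx : x ∈ poleFree a) :
    Δ (logDist a fun _ => 1) x = 2 * ((N : ℝ) - 2) * invSqSum a x := by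
  rw [laplacian_logDist a _ hx]; simp [invSqSum]

theorem invSqSum_pos (hn : 2 ≤ n) (hx : x ∈ poleFree a) : 0 < invSqSum a x :=
  Finset.sum_pos (fun k _ => invSq_pos hx k) ⟨⟨0, by omega⟩, Finset.mem_univ _⟩

theorem phiPot_ge : 2 * poleExp N n * invSqSum a x ≤ phiPot a x :=
  le_add_of_nonneg_right (mul_nonneg (sq_nonneg _) (crossSum_nonneg a (by simp)))

theorem phiPot_pos (hN : 5 ≤ N) (hn : 2 ≤ n) (hx : x ∈ poleFree a) : 0 < phiPot a x :=
  (mul_pos (mul_pos two_pos (poleExp_pos hN hn)) (invSqSum_pos a hn hx)).trans_le (phiPot_ge a)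

theorem phiPot_le (hx : x ∈ poleFree a) :
    phiPot a x ≤ (2 * poleExp N n + poleExp N n ^ 2 * n) * invSqSum a x := by
  have := mul_le_mul_of_nonneg_left (crossSum_one_le a hx) (sq_nonneg (poleExp N n))
  unfold phiPot
  linarith

theorem pairCoeff_mul_pos (hN : 5 ≤ N) (i j k l : Fin n) (hn : 2 ≤ n) :
    0 < pairCoeff N i j k * pairCoeff N i j l := by
  have hb := poleExp_pos hN hn
  refine mul_pos_of_neg_of_neg ?_ ?_ <;> unfold pairCoeff <;> split_ifs <;> linarith

theorem potential_nonneg (hN : 5 ≤ N) : 0 ≤ multipolarPotential a x := by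
  rcases lt_or_ge n 2 with hn | hn
  · rw [multipolarPotential_eq a hN]
    have : Subsingleton (Fin n) := Fin.subsingleton_iff_le_one.2 (by omega)
    have : ∀ i j, a i - a j = 0 := fun i j => by rw [Subsingleton.elim i j, sub_self]
    simp [this]
  rw [multipolarPotential_eq a hN]
  refine mul_nonneg (by norm_num) (Finset.sum_nonneg fun i _ => Finset.sum_nonneg fun j _ => ?_)
  have := crossSum_nonneg a (x := x) fun k l => (pairCoeff_mul_pos hN i j k l hn).le
  have h1 := invSq_nonneg (a := a) (x := x) i
  have h2 := invSq_nonneg (a := a) (x := x) j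
  positivity

theorem potential_pos (hN : 5 ≤ N) (hn : 2 ≤ n) (ha : Function.Injective a)
    (hx : x ∈ poleFree a) : 0 < multipolarPotential a x := by
  let i₀ : Fin n := ⟨0, by omega⟩
  let j₀ : Fin n := ⟨1, by omega⟩
  have hij : a i₀ ≠ a j₀ := fun h => by simpa [i₀, j₀] using ha h
  have hd : 0 < ‖a i₀ - a j₀‖ ^ 2 := pow_pos (norm_pos_iff.2 (sub_ne_zero.2 hij)) 2
  have hq : ∀ k, 0 < invSq a k x := invSq_pos hx
  have hnn : ∀ (c : Fin n → ℝ) (k l), 0 < c k * c l →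
      0 ≤ c k * c l * ‖a k - a l‖ ^ 2 * invSq a k x * invSq a l x := fun c k l h =>
    mul_nonneg (mul_nonneg (mul_nonneg h.le (by positivity)) (hq k).le) (hq l).le
  have hB : 0 < crossSum a (pairCoeff N i₀ j₀) x := by
    refine mul_pos (by norm_num) (Finset.sum_pos' (fun k _ => Finset.sum_nonneg fun l _ =>
      hnn _ k l (pairCoeff_mul_pos hN _ _ k l hn)) ⟨i₀, Finset.mem_univ _, ?_⟩)
    refine Finset.sum_pos' (fun l _ => hnn _ i₀ l (pairCoeff_mul_pos hN _ _ i₀ l hn))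
      ⟨j₀, Finset.mem_univ _, ?_⟩
    exact mul_pos (mul_pos (mul_pos (pairCoeff_mul_pos hN _ _ _ _ hn) hd) (hq _)) (hq _)
  have hN0 : (0 : ℝ) < N := by positivity
  have hn0 : (0 : ℝ) < n := by positivity
  have hB0 : ∀ i j, 0 ≤ ‖a i - a j‖ ^ 2 * invSq a i x * invSq a j x *
      (4 * ((n : ℝ) / N) ^ 2 * crossSum a (pairCoeff N i j) x) := fun i j =>
    mul_nonneg (mul_nonneg (mul_nonneg (by positivity) (hq i).le) (hq j).le)
      (mul_nonneg (by positivity) (crossSum_nonneg a fun k l => (pairCoeff_mul_pos hN i j k l hn).le))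
  rw [multipolarPotential_eq a hN]
  refine mul_pos (by norm_num) (Finset.sum_pos' (fun k _ => Finset.sum_nonneg fun l _ => hB0 k l)
    ⟨i₀, Finset.mem_univ _, Finset.sum_pos' (fun l _ => hB0 i₀ l) ⟨j₀, Finset.mem_univ _, ?_⟩⟩)
  exact mul_pos (mul_pos (mul_pos hd (hq _)) (hq _)) (mul_pos (by positivity) hB)

theorem contDiffAt_invSqSum {m : WithTop ℕ∞} (hx : x ∈ poleFree a) :
    ContDiffAt ℝ m (invSqSum a) x := ContDiffAt.sum fun k _ => contDiffAt_invSq a k hx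

theorem contDiffAt_crossSum {m : WithTop ℕ∞} (c : Fin n → ℝ) (hx : x ∈ poleFree a) :
    ContDiffAt ℝ m (crossSum a c) x :=
  contDiffAt_const.mul (ContDiffAt.sum fun k _ => ContDiffAt.sum fun l _ =>
    (contDiffAt_const.mul (contDiffAt_invSq a k hx)).mul (contDiffAt_invSq a l hx))

theorem contDiffAt_phiPot {m : WithTop ℕ∞} (hx : x ∈ poleFree a) :
    ContDiffAt ℝ m (phiPot a) x :=
  (contDiffAt_const.mul (contDiffAt_invSqSum a hx)).add
    (contDiffAt_const.mul (contDiffAt_crossSum a _ hx))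

theorem continuousAt_potential (hN : 5 ≤ N) (hx : x ∈ poleFree a) :
    ContinuousAt (multipolarPotential a) x := by
  have : multipolarPotential a = fun x => 1 / 2 * ∑ i, ∑ j,
      ‖a i - a j‖ ^ 2 * invSq a i x * invSq a j x *
      (4 * ((n : ℝ) / N) ^ 2 * crossSum a (pairCoeff N i j) x) :=
    funext fun x => multipolarPotential_eq a hN
  rw [this]
  refine ContDiffAt.continuousAt (𝕜 := ℝ) (n := 0) ?_
  exact contDiffAt_const.mul (ContDiffAt.sum fun i _ => ContDiffAt.sum fun j _ =>
    ((contDiffAt_const.mul (contDiffAt_invSq a i hx)).mul (contDiffAt_invSq a j hx)).mul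
      (contDiffAt_const.mul (contDiffAt_crossSum a _ hx)))

theorem measurable_invSq (k : Fin n) : Measurable (invSq a k) := by
  unfold invSq; fun_prop

theorem measurable_invSqSum : Measurable (invSqSum a) :=
  Finset.measurable_sum _ fun k _ => measurable_invSq a k

theorem measurable_potential : Measurable (multipolarPotential a) := by
  unfold multipolarPotential; fun_prop

theorem measurable_phi : Measurable (phi a) := by
  unfold phi poleProd logDist; fun_prop

theorem measurable_phiPot : Measurable (phiPot a) := by
  unfold phiPot crossSum invSqSum invSq; fun_prop

theorem ae_mem_poleFree (hN : 5 ≤ N) : ∀ᵐ x : Eucl N, x ∈ poleFree a := by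
  have : Nonempty (Fin N) := ⟨⟨0, by omega⟩⟩
  have h : ∀ k, ∀ᵐ x : Eucl N, x ≠ a k := fun k => by
    exact compl_mem_ae_iff.2 (measure_singleton (a k))
  exact (ae_all_iff.2 h)

end Bounds

/-! ### The Rellich identity away from the poles -/

section Identity

variable {N n : ℕ} (a : Fin n → Eucl N)

/-- A test function whose support contains no pole. -/
def IsPoleFreeTest (v : Eucl N → ℝ) : Prop := IsTestFunction v ∧ tsupport v ⊆ poleFree a

variable {a} {v : Eucl N → ℝ}

theorem IsPoleFreeTest.mul_left {f : Eucl N → ℝ} (hv : IsPoleFreeTest a v)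
    (hf : ∀ x ∈ poleFree a, ContDiffAt ℝ ∞ f x) : IsPoleFreeTest a fun x => f x * v x :=
  ⟨⟨contDiff_mul_of_tsupport hv.1.1 fun x hx => hf x (hv.2 hx),
    HasCompactSupport.mul_left (f := f) hv.1.2⟩,
    (tsupport_mul_subset_right (f := f) (g := v)).trans hv.2⟩

theorem IsTestFunction.integrable_sq {u : Eucl N → ℝ} (hu : IsTestFunction u) :
    Integrable fun x => u x ^ 2 := by
  have h1 : Continuous fun x => u x ^ 2 := hu.1.continuous.pow 2
  have h2 : HasCompactSupport fun x => u x ^ 2 :=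
    HasCompactSupport.comp_left (g := fun t : ℝ => t ^ 2) hu.2 (by simp)
  exact h1.integrable_of_hasCompactSupport h2

theorem IsTestFunction.laplacian {u : Eucl N → ℝ} (hu : IsTestFunction u) :
    IsTestFunction (Δ u) :=
  ⟨hu.1.laplacian_contDiff, hu.2.mono' fun x hx => by
    by_contra h; exact hx (laplacian_eq_zero_of_notMem_tsupport h)⟩

/-- The first remainder term of the Rellich identity. -/
def remainderOne (a : Fin n → Eucl N) (v : Eucl N → ℝ) (x : Eucl N) : ℝ :=
  phi a x * Δ v x + 2 * gdot (phi a) v x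

/-- In this form the remainder is visibly smooth with compact support. -/
theorem remainderOne_eq (hn : 2 ≤ n) (hv : IsPoleFreeTest a v) : remainderOne a v =
    fun x => Δ (fun y => phi a y * v y) x + phi a x * phiPot a x * v x := by
  funext x
  unfold remainderOne
  by_cases hx : x ∈ tsupport v
  · rw [laplacian_fun_mul (contDiffAt_phi a (hv.2 hx)) (hv.1.1.contDiffAt.of_le two_le_infty),
      laplacian_phi a hn (hv.2 hx)]
    ring
  · have h1 : x ∉ tsupport fun y => phi a y * v y := fun h => hx (tsupport_mul_subset_right h)
    rw [laplacian_eq_zero_of_notMem_tsupport h1, laplacian_eq_zero_of_notMem_tsupport hx,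
      gdot_comm, gdot_eq_zero_of_notMem_tsupport hx, image_eq_zero_of_notMem_tsupport hx]
    ring

theorem isTestFunction_remainderOne (hn : 2 ≤ n) (hv : IsPoleFreeTest a v) :
    IsTestFunction (remainderOne a v) := by
  rw [remainderOne_eq hn hv]
  have h1 := (hv.mul_left fun x hx => contDiffAt_phi a hx).1.laplacian
  have h2 := (hv.mul_left fun x hx => (contDiffAt_phi a hx).mul (contDiffAt_phiPot a hx)).1
  exact ⟨h1.1.add h2.1, h1.2.add h2.2⟩

theorem integrable_remainderTwo (hv : IsPoleFreeTest a v) :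
    Integrable fun x => phi a x ^ 2 * phiPot a x * gdot v v x := by
  refine integrable_mul_of_tsupport (contDiff_gdot hv.1.1 hv.1.1).continuous
    (hv.1.2.mono' fun x hx => ?_) fun x hx => ?_
  · by_contra h; exact hx (gdot_eq_zero_of_notMem_tsupport h)
  · have hs : tsupport (gdot v v) ⊆ tsupport v :=
      closure_minimal (fun y hy => by
        by_contra h; exact hy (gdot_eq_zero_of_notMem_tsupport h)) (isClosed_tsupport v)
    have hx := hv.2 (hs hx)
    exact (((contDiffAt_phi a (m := 0) hx).pow 2).mul (contDiffAt_phiPot a hx)).continuousAt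

theorem integrable_potential_mul_sq_of_poleFree (hN : 5 ≤ N) (hv : IsPoleFreeTest a v) :
    Integrable fun x => multipolarPotential a x * v x ^ 2 := by
  refine integrable_mul_of_tsupport (hv.1.1.continuous.pow 2)
    (hv.1.2.comp_left (g := fun t : ℝ => t ^ 2) (by simp)) fun x hx => ?_
  refine continuousAt_potential a hN (hv.2 ?_)
  exact closure_mono (fun y hy => by
    simpa using hy) hx

/-- The Rellich identity for `w = φ v`, with `v` supported away from the poles. -/
theorem rellich_identity (hN : 5 ≤ N) (hn : 2 ≤ n) (hv : IsPoleFreeTest a v) :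
    ∫ x, (Δ (fun y => phi a y * v y) x) ^ 2 =
      rellichConstant N n * (∫ x, multipolarPotential a x * (phi a x * v x) ^ 2) +
      (∫ x, remainderOne a v x ^ 2) + 2 * ∫ x, phi a x ^ 2 * phiPot a x * gdot v v x := by
  set ψ : Eucl N → ℝ := fun x => phi a x * (v x * v x) with hψ
  have hφ : ∀ x ∈ poleFree a, ContDiffAt ℝ ∞ (phi a) x := fun x hx => contDiffAt_phi a hx
  have hvv : IsPoleFreeTest a fun x => v x * v x := hv.mul_left fun x _ => hv.1.1.contDiffAt
  have hψt : IsPoleFreeTest a ψ := hvv.mul_left hφ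
  have hw : IsPoleFreeTest a fun x => phi a x * v x := hv.mul_left hφ
  have hF : ∀ x ∈ poleFree a, ContDiffAt ℝ 2 (fun y => phi a y * phiPot a y) x := fun x hx =>
    (contDiffAt_phi a hx).mul (contDiffAt_phiPot a hx)
  -- Green's identity moves the Laplacian from `ψ = φ v²` to `φ W`, where `Δ(φW) = -C V φ` produces
  -- the potential term.
  have hgreen := integral_mul_laplacian (hψt.1.1.of_le two_le_infty) hψt.1.2
    fun x hx => hF x (hψt.2 hx)
  have hlap : (fun x => Δ (fun y => phi a y * phiPot a y) x * ψ x) = fun x =>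
      -(rellichConstant N n * (multipolarPotential a x * (phi a x * v x) ^ 2)) := by
    funext x
    by_cases hx : x ∈ tsupport ψ
    · rw [laplacian_phi_mul_phiPot a hN hn (hψt.2 hx)]; simp only [hψ]; ring
    · have h0 := image_eq_zero_of_notMem_tsupport hx
      have hv0 : v x = 0 := by
        simpa [hψ, (phi_pos a x).ne'] using h0
      simp [h0, hv0]
  rw [hlap, integral_neg, integral_const_mul] at hgreen
  -- With `R` the first remainder, `Δ(φv) = R - φWv` and `Δψ = 2vR + 2φ|∇v|² - φWv²`. Multiplying
  -- the latter by `φW` removes the mixed and zeroth-order terms of the square `(R - φWv)²`.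
  have hpt : (fun x => (Δ (fun y => phi a y * v y) x) ^ 2) = fun x =>
      (remainderOne a v x ^ 2 + 2 * (phi a x ^ 2 * phiPot a x * gdot v v x)) -
        phi a x * phiPot a x * Δ ψ x := by
    funext x
    by_cases hx : x ∈ tsupport v
    · have hxU := hv.2 hx
      have hv2 : ContDiffAt ℝ 2 v x := hv.1.1.contDiffAt.of_le two_le_infty
      have hφ2 : ContDiffAt ℝ 2 (phi a) x := contDiffAt_phi a hxU
      rw [hψ, laplacian_fun_mul hφ2 (hv2.mul hv2), laplacian_fun_mul hv2 hv2,
        laplacian_fun_mul hφ2 hv2,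
        gdot_mul_right hv2.differentiableAt_two hv2.differentiableAt_two, laplacian_phi a hn hxU]
      unfold remainderOne
      ring
    · have h1 : x ∉ tsupport fun y => phi a y * v y := fun h => hx (tsupport_mul_subset_right h)
      have h2 : x ∉ tsupport ψ := fun h =>
        hx (tsupport_mul_subset_right (tsupport_mul_subset_right h))
      rw [laplacian_eq_zero_of_notMem_tsupport h1, laplacian_eq_zero_of_notMem_tsupport h2]
      unfold remainderOne
      rw [laplacian_eq_zero_of_notMem_tsupport hx, gdot_eq_zero_of_notMem_tsupport hx,
        gdot_comm, gdot_eq_zero_of_notMem_tsupport hx]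
      ring
  have i1 := (isTestFunction_remainderOne hn hv).integrable_sq
  have i2 := (integrable_remainderTwo hv).const_mul 2
  have i3 : Integrable fun x => phi a x * phiPot a x * Δ ψ x := by
    refine integrable_mul_of_tsupport hψt.1.laplacian.1.continuous hψt.1.laplacian.2 fun x hx => ?_
    refine (hF x (hψt.2 ?_)).continuousAt
    exact closure_minimal (fun y hy => by
        by_contra h; exact hy (laplacian_eq_zero_of_notMem_tsupport h)) (isClosed_tsupport ψ) hx
  have i12 : Integrable fun x => remainderOne a v x ^ 2 +
      2 * (phi a x ^ 2 * phiPot a x * gdot v v x) := i1.add i2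
  rw [hpt, integral_sub i12 i3, integral_add i1 i2, hgreen, integral_const_mul]
  ring

end Identity

end

noncomputable section

theorem tendsto_eLpNorm_zero_of_dominated {α : Type*} [MeasurableSpace α] {μ : Measure α}
    {p : ℝ≥0∞} (hp0 : p ≠ 0) (hp : p ≠ ⊤) {F : ℕ → α → ℝ} {G : α → ℝ}
    (hF : ∀ k, AEStronglyMeasurable (F k) μ) (hG : MemLp G p μ)
    (hle : ∀ k, ∀ᵐ x ∂μ, |F k x| ≤ G x)
    (hlim : ∀ᵐ x ∂μ, Tendsto (fun k => F k x) atTop (𝓝 0)) :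
    Tendsto (fun k => eLpNorm (F k) p μ) atTop (𝓝 0) := by
  have hp' : 0 < p.toReal := ENNReal.toReal_pos hp0 hp
  simp only [eLpNorm_eq_lintegral_rpow_enorm_toReal hp0 hp]
  have h1 : Tendsto (fun k => ∫⁻ x, ‖F k x‖ₑ ^ p.toReal ∂μ) atTop (𝓝 (∫⁻ _, 0 ∂μ)) := by
    refine tendsto_lintegral_of_dominated_convergence' (fun x => ‖G x‖ₑ ^ p.toReal)
      (fun k => (hF k).enorm.pow_const _) (fun k => ?_) ?_ ?_
    · filter_upwards [hle k] with x hx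
      refine ENNReal.rpow_le_rpow ?_ hp'.le
      rw [enorm_le_iff_norm_le, Real.norm_eq_abs, Real.norm_eq_abs]
      exact hx.trans (le_abs_self _)
    · exact (lintegral_rpow_enorm_lt_top_of_eLpNorm_lt_top hp0 hp hG.2).ne
    · filter_upwards [hlim] with x hx
      have := (hx.enorm).ennrpow_const p.toReal
      simpa [hp'] using this
  rw [lintegral_zero] at h1
  have := h1.ennrpow_const (1 / p.toReal)
  simpa [hp'] using this

/-! ### Slowly varying profiles on the line -/

section Profile

/-- A smooth bump function on the line, equal to `1` on `[-1, 1]` and to `0` off `[-2, 2]`. -/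
def lineBump : ContDiffBump (0 : ℝ) := ⟨1, 2, one_pos, one_lt_two⟩

/-- The bump function at scale `k + 1`. -/
def profile (k : ℕ) (s : ℝ) : ℝ := lineBump (((k : ℝ) + 1)⁻¹ * s)

theorem contDiff_profile (k : ℕ) : ContDiff ℝ ∞ (profile k) :=
  lineBump.contDiff.comp (contDiff_const.mul contDiff_id)

theorem profile_nonneg (k : ℕ) (s : ℝ) : 0 ≤ profile k s := lineBump.nonneg

theorem profile_le_one (k : ℕ) (s : ℝ) : profile k s ≤ 1 := lineBump.le_one

theorem profile_eq_one {k : ℕ} {s : ℝ} (h : |s| ≤ k + 1) : profile k s = 1 := by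
  refine lineBump.one_of_mem_closedBall ?_
  have hk : (0 : ℝ) < k + 1 := by positivity
  rw [mem_closedBall_zero_iff, Real.norm_eq_abs, abs_mul, abs_inv, abs_of_pos hk,
    ← div_eq_inv_mul]
  exact (div_le_one hk).2 h

theorem profile_eq_zero {k : ℕ} {s : ℝ} (h : 2 * ((k : ℝ) + 1) ≤ |s|) : profile k s = 0 := by
  refine lineBump.zero_of_le_dist ?_
  have hk : (0 : ℝ) < k + 1 := by positivity
  rw [dist_zero_right, Real.norm_eq_abs, abs_mul, abs_inv, abs_of_pos hk, ← div_eq_inv_mul,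
    le_div_iff₀ hk]
  exact h

theorem hasCompactSupport_profile (k : ℕ) : HasCompactSupport (profile k) := by
  refine HasCompactSupport.intro (isCompact_closedBall 0 (2 * ((k : ℝ) + 1))) fun s hs => ?_
  rw [mem_closedBall_zero_iff, Real.norm_eq_abs, not_le] at hs
  exact profile_eq_zero hs.le

theorem deriv_profile (k : ℕ) :
    deriv (profile k) = fun s => ((k : ℝ) + 1)⁻¹ * deriv lineBump (((k : ℝ) + 1)⁻¹ * s) := by
  funext s
  have := deriv_comp_mul_left (((k : ℝ) + 1)⁻¹) (lineBump : ℝ → ℝ) s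
  exact this

theorem deriv_deriv_profile (k : ℕ) : deriv (deriv (profile k)) = fun s =>
    (((k : ℝ) + 1)⁻¹) ^ 2 * deriv (deriv lineBump) (((k : ℝ) + 1)⁻¹ * s) := by
  funext s
  rw [deriv_profile, deriv_const_mul_field]
  have := deriv_comp_mul_left (((k : ℝ) + 1)⁻¹) (deriv lineBump : ℝ → ℝ) s
  rw [this, smul_eq_mul]; ring

/-- Scaling gains one factor `1/(k+1)` per derivative; for the second derivative the extra factor is
discarded to have a common bound. -/
theorem exists_deriv_profile_bound : ∃ B : ℝ, 0 < B ∧ ∀ (k : ℕ) (s : ℝ),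
    |deriv (profile k) s| ≤ B / (k + 1) ∧ |deriv (deriv (profile k)) s| ≤ B / (k + 1) := by
  have h0 : HasCompactSupport (lineBump : ℝ → ℝ) := lineBump.hasCompactSupport
  have hc1 : ContDiff ℝ 1 (deriv (lineBump : ℝ → ℝ)) :=
    ((contDiff_succ_iff_deriv (n := 1)).1 (lineBump.contDiff (n := 1 + 1))).2.2
  have hc2 : Continuous (deriv (deriv (lineBump : ℝ → ℝ))) := hc1.continuous_deriv le_rfl
  obtain ⟨B1, h1⟩ := h0.deriv.exists_bound_of_continuous hc1.continuous
  obtain ⟨B2, h2⟩ := h0.deriv.deriv.exists_bound_of_continuous hc2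
  simp only [Real.norm_eq_abs] at h1 h2
  refine ⟨max B1 B2 + 1, ?_, fun k s => ?_⟩
  · have := (abs_nonneg _).trans (h1 0)
    have := le_max_left B1 B2
    linarith
  have hk : (0 : ℝ) < ((k : ℝ) + 1)⁻¹ := by positivity
  have hk1 : ((k : ℝ) + 1)⁻¹ ≤ 1 := inv_le_one_of_one_le₀ (by linarith [k.cast_nonneg (α := ℝ)])
  rw [deriv_deriv_profile, deriv_profile, div_eq_inv_mul]
  simp only [abs_mul, abs_pow, abs_of_pos hk]
  constructor
  · gcongr
    linarith [h1 (((k : ℝ) + 1)⁻¹ * s), le_max_left B1 B2]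
  · have : ((k : ℝ) + 1)⁻¹ ^ 2 ≤ ((k : ℝ) + 1)⁻¹ := by
      rw [pow_two]; exact mul_le_of_le_one_left hk.le hk1
    gcongr
    linarith [h2 (((k : ℝ) + 1)⁻¹ * s), le_max_right B1 B2]

theorem deriv_profile_eq_zero {k : ℕ} {s : ℝ} (h : 2 * ((k : ℝ) + 1) < |s|) :
    deriv (profile k) s = 0 ∧ deriv (deriv (profile k)) s = 0 := by
  have h0 : profile k =ᶠ[𝓝 s] fun _ => 0 := by
    filter_upwards [continuous_abs.isOpen_preimage _ isOpen_Ioi |>.mem_nhds h] with t ht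
    exact profile_eq_zero (le_of_lt ht)
  have h1 : deriv (profile k) =ᶠ[𝓝 s] fun _ => 0 := by
    simpa using h0.deriv
  exact ⟨h1.eq_of_nhds, by simpa using h1.deriv.eq_of_nhds⟩

end Profile

/-! ### Logarithmic cut-offs near the poles and at infinity -/

section Cutoff

variable {N n : ℕ} (a : Fin n → Eucl N) {x : Eucl N}

/-- The function `∑ log |x - a k| ^ 2`. -/
abbrev logSum : Eucl N → ℝ := logDist a fun _ => 1

/-- The composition of `f` with `∑ log |x - a k| ^ 2`, extended by zero to the poles. -/
def cutoff (f : ℝ → ℝ) : Eucl N → ℝ := (poleFree a).indicator fun x => f (logSum a x)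

variable {a}

theorem cutoff_eq (f : ℝ → ℝ) (hx : x ∈ poleFree a) : cutoff a f x = f (logSum a x) :=
  Set.indicator_of_mem hx _

theorem cutoff_eventuallyEq (f : ℝ → ℝ) (hx : x ∈ poleFree a) :
    cutoff a f =ᶠ[𝓝 x] fun y => f (logSum a y) := by
  filter_upwards [isOpen_poleFree.mem_nhds hx] with y hy using cutoff_eq f hy

theorem logSum_eq_log_prod (hx : x ∈ poleFree a) :
    logSum a x = Real.log (∏ k, ‖x - a k‖ ^ 2) := by
  rw [Real.log_prod fun k _ => normSq_sub_ne_zero hx k]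
  simp [logSum, logDist]

/-- On the support `∏ |x - a k|²` lies between two positive constants. The lower one excludes the
poles; the upper one forces `x` to stay near some pole, hence in a bounded set. -/
theorem exists_isCompact_support_cutoff (hn : 2 ≤ n) {f : ℝ → ℝ} (hc : HasCompactSupport f) :
    ∃ K : Set (Eucl N), IsCompact K ∧ K ⊆ poleFree a ∧ Function.support (cutoff a f) ⊆ K := by
  obtain ⟨R, hR⟩ := hc.isCompact.isBounded.subset_closedBall 0
  set M : Eucl N → ℝ := fun x => ∏ k, ‖x - a k‖ ^ 2
  have hM : Continuous M := by fun_prop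
  -- The absolute value in `exp |R|` ensures that this bound is at least `1`: if every distance
  -- exceeds it, so does the product of their squares.
  refine ⟨{x | Real.exp (-R) ≤ M x ∧ M x ≤ Real.exp |R|}, ?_, ?_, ?_⟩
  · refine Metric.isCompact_of_isClosed_isBounded ?_ ?_
    · exact (isClosed_le continuous_const hM).inter (isClosed_le hM continuous_const)
    · have hb : Bornology.IsBounded (⋃ k, Metric.closedBall (a k) (Real.exp |R|)) :=
        Bornology.isBounded_iUnion.2 fun k => Metric.isBounded_closedBall
      refine hb.subset fun x hx => ?_
      by_contra hnot
      simp only [Set.mem_iUnion, Metric.mem_closedBall, not_exists, not_le, dist_eq_norm] at hnot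
      have h1 : (1 : ℝ) ≤ Real.exp |R| := Real.one_le_exp (abs_nonneg R)
      let k₀ : Fin n := ⟨0, by omega⟩
      have h2 : Real.exp |R| < M x := by
        have h3 : ∀ k, (1 : ℝ) ≤ ‖x - a k‖ ^ 2 := fun k =>
          one_le_pow₀ (h1.trans (hnot k).le)
        calc Real.exp |R| < ‖x - a k₀‖ := hnot k₀
          _ ≤ ‖x - a k₀‖ ^ 2 := le_self_pow₀ (h1.trans (hnot k₀).le) (by norm_num)
          _ ≤ M x := by
            rw [show M x = ∏ k, ‖x - a k‖ ^ 2 from rfl,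
              ← Finset.mul_prod_erase _ _ (Finset.mem_univ k₀)]
            exact le_mul_of_one_le_right (by positivity)
              (Finset.one_le_prod fun k _ => h3 k)
      exact absurd hx.2 (not_le.2 h2)
  · intro x hx k hk
    have : M x = 0 := Finset.prod_eq_zero (Finset.mem_univ k) (by simp [hk])
    have h1 : Real.exp (-R) ≤ 0 := this ▸ hx.1
    exact absurd (Real.exp_pos (-R)) (not_lt.2 h1)
  · intro x hx
    have hxU : x ∈ poleFree a := by
      by_contra h; exact hx (Set.indicator_of_notMem h _)
    rw [Function.mem_support, cutoff_eq f hxU] at hx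
    have h1 := hR (subset_tsupport f hx)
    rw [mem_closedBall_zero_iff, Real.norm_eq_abs, abs_le, logSum_eq_log_prod hxU] at h1
    have hpos : 0 < M x := Finset.prod_pos fun k _ => pow_pos (norm_sub_pos hxU k) 2
    exact ⟨(Real.le_log_iff_exp_le hpos).1 h1.1,
      (Real.log_le_iff_le_exp hpos).1 (h1.2.trans (le_abs_self R))⟩

theorem isPoleFreeTest_cutoff (hn : 2 ≤ n) {f : ℝ → ℝ} (hf : ContDiff ℝ ∞ f)
    (hc : HasCompactSupport f) : IsPoleFreeTest a (cutoff a f) := by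
  obtain ⟨K, hK, hKU, hs⟩ := exists_isCompact_support_cutoff (a := a) hn hc
  have ht : tsupport (cutoff a f) ⊆ K := closure_minimal hs hK.isClosed
  refine ⟨⟨contDiff_iff_contDiffAt.2 fun x => ?_, hK.of_isClosed_subset (isClosed_tsupport _) ht⟩,
    ht.trans hKU⟩
  by_cases hx : x ∈ poleFree a
  · exact (hf.contDiffAt.comp x (contDiffAt_logDist a _ hx)).congr_of_eventuallyEq
      (cutoff_eventuallyEq f hx)
  · refine (contDiffAt_const (c := (0 : ℝ))).congr_of_eventuallyEq ?_
    exact notMem_tsupport_iff_eventuallyEq.1 fun h => hx (hKU (ht h))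

theorem gdot_cutoff {f : ℝ → ℝ} (hf : ContDiff ℝ ∞ f) (g : Eucl N → ℝ) (hx : x ∈ poleFree a) :
    gdot g (cutoff a f) x = deriv f (logSum a x) * gdot g (logSum a) x := by
  rw [gdot_congr EventuallyEq.rfl (cutoff_eventuallyEq f hx)]
  exact gdot_comp_right (hf.differentiable (by simp)).differentiableAt
    (contDiffAt_logDist a (m := 2) _ hx).differentiableAt_two

theorem gdot_cutoff_self {f : ℝ → ℝ} (hf : ContDiff ℝ ∞ f) (hx : x ∈ poleFree a) :
    gdot (cutoff a f) (cutoff a f) x =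
      deriv f (logSum a x) ^ 2 * gdot (logSum a) (logSum a) x := by
  rw [gdot_cutoff hf _ hx, gdot_comm, gdot_cutoff hf _ hx]; ring

theorem laplacian_cutoff {f : ℝ → ℝ} (hf : ContDiff ℝ ∞ f) (hx : x ∈ poleFree a) :
    Δ (cutoff a f) x = deriv (deriv f) (logSum a x) * gdot (logSum a) (logSum a) x +
      deriv f (logSum a x) * (2 * ((N : ℝ) - 2) * invSqSum a x) := by
  rw [(InnerProductSpace.laplacian_congr_nhds (cutoff_eventuallyEq f hx)).eq_of_nhds,
    laplacian_fun_comp (hf.contDiffAt.of_le two_le_infty) (contDiffAt_logDist a _ hx),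
    laplacian_logDist_one a hx]

theorem sqrt_gdot_cutoff_le {f : ℝ → ℝ} (hf : ContDiff ℝ ∞ f) (hx : x ∈ poleFree a) :
    √(gdot (cutoff a f) (cutoff a f) x) ≤
      |deriv f (logSum a x)| * (√(4 * n) * √(invSqSum a x)) := by
  rw [gdot_cutoff_self hf hx, Real.sqrt_mul (sq_nonneg _), Real.sqrt_sq_eq_abs,
    ← Real.sqrt_mul (by positivity)]
  gcongr
  exact gdot_logDist_one_le a hx

theorem abs_laplacian_cutoff_le (hN : 5 ≤ N) {f : ℝ → ℝ} (hf : ContDiff ℝ ∞ f)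
    (hx : x ∈ poleFree a) : |Δ (cutoff a f) x| ≤
      (|deriv f (logSum a x)| + |deriv (deriv f) (logSum a x)|) *
        ((4 * n + 2 * N) * invSqSum a x) := by
  have hT := invSqSum_nonneg (a := a) (x := x)
  have hN' : (5 : ℝ) ≤ N := by exact_mod_cast hN
  have h1 := gdot_logDist_one_le a hx
  have h0 : 0 ≤ gdot (logSum a) (logSum a) x := gdot_self_nonneg
  rw [laplacian_cutoff hf hx, add_mul, add_comm]
  refine (abs_add_le _ _).trans (add_le_add ?_ ?_)
  · rw [abs_mul]
    gcongr
    rw [abs_of_nonneg (mul_nonneg (by linarith) hT)]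
    gcongr
    have : (0 : ℝ) ≤ n := n.cast_nonneg
    linarith
  · rw [abs_mul, abs_of_nonneg h0]
    gcongr
    refine h1.trans ?_
    gcongr
    have : (0 : ℝ) ≤ N := N.cast_nonneg
    linarith

/-- Cutting off near the poles and at infinity on a logarithmic scale converges in the norms
of `u` and `Δ u`. -/
theorem tendsto_cutoff_profile (hN : 5 ≤ N) (hn : 2 ≤ n) {p : ℝ≥0∞} (hp0 : p ≠ 0) (hp : p ≠ ⊤)
    {u D : Eucl N → ℝ} (hu : ∀ x ∈ poleFree a, ContDiffAt ℝ ∞ u x) (hup : MemLp u p)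
    (hΔ : AEStronglyMeasurable (Δ u)) (hD : MemLp D 2)
    (hDu : ∀ x ∈ poleFree a, |Δ u x| ≤ D x ∧ √(gdot u u x) * √(invSqSum a x) ≤ D x ∧
      |u x| * invSqSum a x ≤ D x) :
    (∀ k, IsPoleFreeTest a fun x => u x * cutoff a (profile k) x) ∧
    Tendsto (fun k => eLpNorm (fun x => u x * cutoff a (profile k) x - u x) p volume)
      atTop (𝓝 0) ∧
    Tendsto (fun k => eLpNorm (fun x => Δ (fun y => u y * cutoff a (profile k) y) x - Δ u x) 2
      volume) atTop (𝓝 0) := by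
  obtain ⟨B, hB, hder⟩ := exists_deriv_profile_bound
  have hχ : ∀ k, IsPoleFreeTest a (cutoff a (profile k)) := fun k =>
    isPoleFreeTest_cutoff hn (contDiff_profile k) (hasCompactSupport_profile k)
  have hw : ∀ k, IsPoleFreeTest a fun x => u x * cutoff a (profile k) x := fun k =>
    (hχ k).mul_left hu
  have hU := ae_mem_poleFree a hN
  have hev : ∀ x ∈ poleFree a, ∀ᶠ k : ℕ in atTop, cutoff a (profile k) x = 1 := by
    intro x hx
    obtain ⟨m, hm⟩ := exists_nat_ge |logSum a x|
    filter_upwards [eventually_ge_atTop m] with k hk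
    rw [cutoff_eq _ hx]
    refine profile_eq_one (hm.trans ?_)
    have : (m : ℝ) ≤ k := by exact_mod_cast hk
    linarith
  have habs : ∀ x ∈ poleFree a, ∀ k, |cutoff a (profile k) x - 1| ≤ 1 := by
    intro x hx k
    rw [cutoff_eq _ hx, abs_le]
    have h1 := profile_nonneg k (logSum a x)
    have h2 := profile_le_one k (logSum a x)
    constructor <;> linarith
  refine ⟨hw, ?_, ?_⟩
  · refine tendsto_eLpNorm_zero_of_dominated hp0 hp (G := fun x => |u x|)
      (fun k => (hw k).1.1.continuous.aestronglyMeasurable.sub hup.1) hup.norm (fun k => ?_) ?_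
    · filter_upwards [hU] with x hx
      rw [show u x * cutoff a (profile k) x - u x = u x * (cutoff a (profile k) x - 1) by ring,
        abs_mul]
      exact mul_le_of_le_one_right (abs_nonneg _) (habs x hx k)
    · filter_upwards [hU] with x hx
      refine tendsto_const_nhds.congr' ?_
      filter_upwards [hev x hx] with k hk
      rw [hk]; ring
  · set K : ℝ := 2 * B * √(4 * n) + 2 * B * (4 * n + 2 * N) with hK
    have hK0 : 0 ≤ K := by positivity
    -- By the product rule the error is `(χ - 1) Δu + 2 ∇u·∇χ + u Δχ`. Here `|∇χ|` is `O(√T /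
    -- (k+1))` and `|Δχ|` is `O(T / (k+1))`, which the three bounds by `D` are designed to absorb.
    have hest : ∀ x ∈ poleFree a, ∀ k : ℕ,
        |Δ (fun y => u y * cutoff a (profile k) y) x - Δ u x| ≤
          (|cutoff a (profile k) x - 1| + K / (k + 1)) * D x := by
      intro x hx k
      obtain ⟨h1, h2, h3⟩ := hDu x hx
      have hT := invSqSum_nonneg (a := a) (x := x)
      rw [laplacian_fun_mul ((hu x hx).of_le two_le_infty)
        ((hχ k).1.1.contDiffAt.of_le two_le_infty)]
      obtain ⟨d1, d2⟩ := hder k (logSum a x)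
      have e2 : |gdot u (cutoff a (profile k)) x| ≤ B / (k + 1) * √(4 * n) * D x := by
        calc _ ≤ √(gdot u u x) * √(gdot (cutoff a (profile k)) (cutoff a (profile k)) x) :=
              abs_gdot_le
          _ ≤ √(gdot u u x) * (B / (k + 1) * (√(4 * n) * √(invSqSum a x))) := by
              gcongr
              refine (sqrt_gdot_cutoff_le (contDiff_profile k) hx).trans ?_
              gcongr
          _ = B / (k + 1) * √(4 * n) * (√(gdot u u x) * √(invSqSum a x)) := by ring
          _ ≤ _ := by gcongr
      have e3 : |u x * Δ (cutoff a (profile k)) x| ≤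
          2 * (B / (k + 1)) * (4 * n + 2 * N) * D x := by
        rw [abs_mul]
        calc _ ≤ |u x| * ((B / (k + 1) + B / (k + 1)) * ((4 * n + 2 * N) * invSqSum a x)) := by
              gcongr
              refine (abs_laplacian_cutoff_le hN (contDiff_profile k) hx).trans ?_
              gcongr
          _ = 2 * (B / (k + 1)) * (4 * n + 2 * N) * (|u x| * invSqSum a x) := by ring
          _ ≤ _ := by gcongr
      have e1 : |(cutoff a (profile k) x - 1) * Δ u x| ≤ |cutoff a (profile k) x - 1| * D x := by
        rw [abs_mul]; gcongr
      calc _ = |(cutoff a (profile k) x - 1) * Δ u x + 2 * gdot u (cutoff a (profile k)) x +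
            u x * Δ (cutoff a (profile k)) x| := by congr 1; ring
        _ ≤ |(cutoff a (profile k) x - 1) * Δ u x| + |2 * gdot u (cutoff a (profile k)) x| +
            |u x * Δ (cutoff a (profile k)) x| := abs_add_three _ _ _
        _ ≤ |cutoff a (profile k) x - 1| * D x + 2 * (B / (k + 1) * √(4 * n) * D x) +
            2 * (B / (k + 1)) * (4 * n + 2 * N) * D x := by
              rw [abs_mul 2, abs_two]; gcongr
        _ = _ := by rw [hK]; ring
    refine tendsto_eLpNorm_zero_of_dominated two_ne_zero ENNReal.ofNat_ne_top
      (G := fun x => (1 + K) * D x)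
      (fun k => (hw k).1.laplacian.1.continuous.aestronglyMeasurable.sub hΔ)
      (hD.const_mul _) (fun k => ?_) ?_
    · filter_upwards [hU] with x hx
      refine (hest x hx k).trans ?_
      have hD0 : 0 ≤ D x := (abs_nonneg _).trans (hDu x hx).1
      gcongr
      · exact habs x hx k
      · exact div_le_self hK0 (by linarith [k.cast_nonneg (α := ℝ)])
    · filter_upwards [hU] with x hx
      have ht : Tendsto (fun k : ℕ => K / ((k : ℝ) + 1) * D x) atTop (𝓝 0) := by
        have := (tendsto_one_div_add_atTop_nhds_zero_nat (𝕜 := ℝ)).const_mul (K * D x)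
        simp only [mul_zero] at this
        exact this.congr fun k => by ring
      refine squeeze_zero_norm' ?_ ht
      filter_upwards [hev x hx] with k hk
      have := hest x hx k
      rwa [hk, sub_self, abs_zero, zero_add] at this

theorem gdot_phi_left (g : Eucl N → ℝ) (hx : x ∈ poleFree a) :
    gdot g (phi a) x = -(poleExp N n / 2) * phi a x * gdot g (logSum a) x := by
  have h : phi a = fun y => Real.exp (-(poleExp N n / 2) * logSum a y) := by
    funext y
    simp only [phi, poleProd, logSum, logDist, Finset.mul_sum, one_mul]
  have hd : ∀ t, HasDerivAt (fun t => Real.exp (-(poleExp N n / 2) * t))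
      (Real.exp (-(poleExp N n / 2) * t) * (-(poleExp N n / 2) * 1)) t := fun t =>
    ((hasDerivAt_id t).const_mul _).exp
  rw [h, gdot_comp_right (k := fun t => Real.exp (-(poleExp N n / 2) * t))
    (hd _).differentiableAt (contDiffAt_logDist a (m := 2) _ hx).differentiableAt_two,
    (hd _).deriv]
  ring

theorem sqrt_gdot_phi_le (hN : 5 ≤ N) (hn : 2 ≤ n) (hx : x ∈ poleFree a) :
    √(gdot (phi a) (phi a) x) ≤
      (poleExp N n / 2) * √(4 * n) * (phi a x * √(invSqSum a x)) := by
  have hb := poleExp_pos hN hn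
  have hp := phi_pos a x
  rw [gdot_phi_left _ hx, gdot_comm, gdot_phi_left _ hx,
    show -(poleExp N n / 2) * phi a x * (-(poleExp N n / 2) * phi a x *
      gdot (logDist a fun _ => 1) (logSum a) x) = (poleExp N n / 2 * phi a x) ^ 2 *
        gdot (logDist a fun _ => 1) (logSum a) x by ring,
    Real.sqrt_mul (sq_nonneg _), Real.sqrt_sq (by positivity)]
  calc _ ≤ poleExp N n / 2 * phi a x * √(4 * n * invSqSum a x) := by
        gcongr
        exact gdot_logDist_one_le a hx
    _ = _ := by rw [Real.sqrt_mul (by positivity)]; ring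

/-- For `v` a function of `L = ∑ log |x - a k|²` the remainders contain only derivatives of `f`,
never `f` itself. Each gradient costs a factor `√T`, as do `|∇φ| / φ` and `√W`, so everything is of
size `(φT)²`. Slow variation of `f` therefore makes the deficit small. -/
theorem exists_remainder_bound (hN : 5 ≤ N) (hn : 2 ≤ n) : ∃ K : ℝ, 0 < K ∧
    ∀ (f : ℝ → ℝ), ContDiff ℝ ∞ f → ∀ x ∈ poleFree a,
      remainderOne a (cutoff a f) x ^ 2 +
        2 * (phi a x ^ 2 * phiPot a x * gdot (cutoff a f) (cutoff a f) x) ≤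
      K * ((|deriv f (logSum a x)| + |deriv (deriv f) (logSum a x)|) ^ 2 *
        (phi a x * invSqSum a x) ^ 2) := by
  have hb := poleExp_pos hN hn
  set β := poleExp N n with hβ
  refine ⟨((4 * n + 2 * N) + 2 * (β / 2 * (4 * n))) ^ 2 +
    2 * ((2 * β + β ^ 2 * n) * (4 * n)), ?_, fun f hf x hx => ?_⟩
  · have : (0 : ℝ) < n := by positivity
    positivity
  have hT := invSqSum_nonneg (a := a) (x := x)
  have hp := phi_pos a x
  have hg0 : 0 ≤ gdot (logSum a) (logSum a) x := gdot_self_nonneg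
  have hg := gdot_logDist_one_le a hx
  set T := invSqSum a x
  set d1 := deriv f (logSum a x)
  set d2 := deriv (deriv f) (logSum a x)
  set m := |d1| + |d2| with hm
  have hd1 : |d1| ≤ m := le_add_of_nonneg_right (abs_nonneg _)
  have hm0 : 0 ≤ m := by positivity
  have hA : |remainderOne a (cutoff a f) x| ≤
      ((4 * n + 2 * N) + 2 * (β / 2 * (4 * n))) * (m * (phi a x * T)) := by
    unfold remainderOne
    calc _ ≤ |phi a x * Δ (cutoff a f) x| + |2 * gdot (phi a) (cutoff a f) x| := abs_add_le _ _
      _ ≤ phi a x * (m * ((4 * n + 2 * N) * T)) +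
          2 * (m * (β / 2 * phi a x * (4 * n * T))) := by
        rw [abs_mul, abs_of_pos hp, abs_mul, abs_two]
        gcongr
        · exact abs_laplacian_cutoff_le hN hf hx
        · rw [gdot_cutoff hf _ hx, gdot_comm, gdot_phi_left _ hx, abs_mul, abs_mul, abs_mul,
            abs_neg, abs_of_pos hp, abs_of_nonneg hg0, abs_of_pos (half_pos hb)]
          gcongr
      _ = _ := by ring
  have hA2 := pow_le_pow_left₀ (abs_nonneg _) hA 2
  rw [sq_abs] at hA2
  have hB : phi a x ^ 2 * phiPot a x * gdot (cutoff a f) (cutoff a f) x ≤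
      phi a x ^ 2 * ((2 * β + β ^ 2 * n) * T) * (m ^ 2 * (4 * n * T)) := by
    rw [gdot_cutoff_self hf hx]
    have hd : d1 ^ 2 ≤ m ^ 2 := by
      rw [← sq_abs d1]; exact pow_le_pow_left₀ (abs_nonneg _) hd1 2
    have := (phiPot_pos a hN hn hx).le
    gcongr
    exact phiPot_le a hx
  calc _ ≤ (((4 * n + 2 * N) + 2 * (β / 2 * (4 * n))) * (m * (phi a x * T))) ^ 2 +
        2 * (phi a x ^ 2 * ((2 * β + β ^ 2 * n) * T) * (m ^ 2 * (4 * n * T))) := by gcongr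
    _ = _ := by ring

end Cutoff

end

noncomputable section

/-! ### Convergence of integrals under `L^p` limits -/

section Integrals

variable {N : ℕ}

theorem eLpNorm_two_sq {α : Type*} [MeasurableSpace α] {μ : Measure α} {f : α → ℝ}
    (hf : MemLp f 2 μ) : (eLpNorm f 2 μ).toReal ^ 2 = ∫ x, f x ^ 2 ∂μ := by
  have h0 : 0 ≤ ∫ x, f x ^ 2 ∂μ := integral_nonneg fun x => sq_nonneg _
  rw [hf.eLpNorm_eq_integral_rpow_norm two_ne_zero ENNReal.ofNat_ne_top]
  simp only [ENNReal.toReal_ofNat, Real.rpow_ofNat, Real.norm_eq_abs, sq_abs]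
  rw [ENNReal.toReal_ofReal (by positivity), ← Real.rpow_natCast, ← Real.rpow_mul h0]
  norm_num

theorem eLpNorm_two_le {α : Type*} [MeasurableSpace α] {μ : Measure α} {f g : α → ℝ}
    (hf : MemLp f 2 μ) (hg : MemLp g 2 μ) (h : ∫ x, f x ^ 2 ∂μ ≤ ∫ x, g x ^ 2 ∂μ) :
    eLpNorm f 2 μ ≤ eLpNorm g 2 μ := by
  rw [← eLpNorm_two_sq hf, ← eLpNorm_two_sq hg] at h
  exact (ENNReal.toReal_le_toReal hf.2.ne hg.2.ne).1
    ((pow_le_pow_iff_left₀ ENNReal.toReal_nonneg ENNReal.toReal_nonneg two_ne_zero).1 h)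

theorem tendsto_integral_sq {α : Type*} [MeasurableSpace α] {μ : Measure α} {f : ℕ → α → ℝ}
    {g : α → ℝ} (hf : ∀ k, MemLp (f k) 2 μ) (hg : MemLp g 2 μ)
    (h : Tendsto (fun k => eLpNorm (fun x => f k x - g x) 2 μ) atTop (𝓝 0)) :
    Tendsto (fun k => ∫ x, f k x ^ 2 ∂μ) atTop (𝓝 (∫ x, g x ^ 2 ∂μ)) := by
  simp only [← eLpNorm_two_sq hg, ← fun k => eLpNorm_two_sq (hf k)]
  have h1 := (Lp.tendsto_Lp_iff_tendsto_eLpNorm'' f hf g hg).2 h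
  have h2 := (h1.norm).pow 2
  simpa only [Lp.norm_toLp] using h2

theorem tendsto_integral_mul {p : ℝ≥0∞} (hp : 1 ≤ p) {f : ℕ → Eucl N → ℝ} {g η : Eucl N → ℝ}
    (hf : ∀ k, MemLp (f k) p) (hg : MemLp g p)
    (h : Tendsto (fun k => eLpNorm (fun x => f k x - g x) p volume) atTop (𝓝 0))
    (hη : Continuous η) (hc : HasCompactSupport η) :
    Tendsto (fun k => ∫ x, f k x * η x) atTop (𝓝 (∫ x, g x * η x)) := by
  have : p.HolderConjugate (ENNReal.conjExponent p) := ENNReal.HolderConjugate.conjExponent hp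
  have hηq : MemLp η (ENNReal.conjExponent p) := hη.memLp_of_hasCompactSupport hc
  have hint : ∀ {w : Eucl N → ℝ}, MemLp w p → Integrable fun x => w x * η x := fun hw =>
    memLp_one_iff_integrable.1 (MemLp.smul hηq hw)
  refine tendsto_integral_of_L1' _ (hint hg).1 (Eventually.of_forall fun k => hint (hf k)) ?_
  have hb : Tendsto (fun k => eLpNorm (fun x => f k x - g x) p volume *
      eLpNorm η (ENNReal.conjExponent p) volume) atTop (𝓝 0) := by
    have := ENNReal.Tendsto.mul_const h (Or.inr hηq.2.ne)
      (b := eLpNorm η (ENNReal.conjExponent p) volume)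
    simpa using this
  refine tendsto_of_tendsto_of_tendsto_of_le_of_le tendsto_const_nhds hb (fun _ => zero_le)
    fun k => ?_
  have := eLpNorm_smul_le_mul_eLpNorm (p := p) (q := ENNReal.conjExponent p) (r := 1) hηq.1
    ((hf k).sub hg).1
  refine le_trans (le_of_eq ?_) this
  congr 1
  funext x
  simp only [Pi.sub_apply, Pi.smul_apply', smul_eq_mul]
  ring

end Integrals

/-! ### Elements of `D^{2,2}` as limits of test functions -/

section Limits

variable {N n : ℕ} {a : Fin n → Eucl N}

/-- The exponent `2 N / (N - 4)`. -/
def sobolevExp (N : ℕ) : ℝ≥0∞ := ENNReal.ofReal (2 * N / ((N : ℝ) - 4))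

theorem one_le_sobolevExp (hN : 5 ≤ N) : 1 ≤ sobolevExp N := by
  have : (5 : ℝ) ≤ N := by exact_mod_cast hN
  unfold sobolevExp
  rw [ENNReal.one_le_ofReal, le_div_iff₀ (by linarith)]
  linarith

theorem sobolevExp_ne_zero (hN : 5 ≤ N) : sobolevExp N ≠ 0 :=
  (zero_lt_one.trans_le (one_le_sobolevExp hN)).ne'

theorem sobolevExp_ne_top : sobolevExp N ≠ ⊤ := ENNReal.ofReal_ne_top

theorem IsTestFunction.memLp {u : Eucl N → ℝ} (hu : IsTestFunction u) (p : ℝ≥0∞) :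
    MemLp u p := hu.1.continuous.memLp_of_hasCompactSupport hu.2

theorem IsTestFunction.sub {u v : Eucl N → ℝ} (hu : IsTestFunction u) (hv : IsTestFunction v) :
    IsTestFunction fun x => u x - v x := ⟨hu.1.sub hv.1, hu.2.sub hv.2⟩

theorem IsTestFunction.contDiffAt_two {u : Eucl N → ℝ} (hu : IsTestFunction u) (x : Eucl N) :
    ContDiffAt ℝ 2 u x := hu.1.contDiffAt.of_le two_le_infty

theorem IsTestFunction.laplacian_sub {u v : Eucl N → ℝ} (hu : IsTestFunction u)
    (hv : IsTestFunction v) : Δ (fun x => u x - v x) = fun x => Δ u x - Δ v x :=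
  funext fun x => (hu.contDiffAt_two x).laplacian_sub (hv.contDiffAt_two x)

/-- The test functions `w k` converge to `u` in `L^{2N/(N-4)}` and their Laplacians converge to
`g` in `L²`. -/
structure TestLimit (w : ℕ → Eucl N → ℝ) (u g : Eucl N → ℝ) : Prop where
  test : ∀ k, IsTestFunction (w k)
  memLp : MemLp u (sobolevExp N)
  memLp_two : MemLp g 2
  tendsto_laplacian : Tendsto (fun k => eLpNorm (fun x => Δ (w k) x - g x) 2 volume) atTop (𝓝 0)
  tendsto : Tendsto (fun k => eLpNorm (fun x => w k x - u x) (sobolevExp N) volume) atTop (𝓝 0)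

variable {w : ℕ → Eucl N → ℝ} {u g : Eucl N → ℝ}

theorem TestLimit.hasWeakLaplacian (hN : 5 ≤ N) (h : TestLimit w u g) : HasWeakLaplacian u g := by
  refine ⟨h.memLp.locallyIntegrable (one_le_sobolevExp hN),
    h.memLp_two.locallyIntegrable one_le_two, fun η hη => ?_⟩
  have h1 := tendsto_integral_mul (one_le_sobolevExp hN) (fun k => (h.test k).memLp _) h.memLp
    h.tendsto hη.laplacian.1.continuous hη.laplacian.2
  have h2 := tendsto_integral_mul one_le_two (fun k => (h.test k).laplacian.memLp _) h.memLp_two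
    h.tendsto_laplacian hη.1.continuous hη.2
  refine tendsto_nhds_unique h1 (h2.congr fun k => ?_)
  exact (integral_mul_laplacian (hη.1.of_le two_le_infty) hη.2
    fun x _ => (h.test k).contDiffAt_two x).symm

theorem TestLimit.memD22 (hN : 5 ≤ N) (h : TestLimit w u g) : MemD22 u :=
  ⟨h.memLp, g, h.hasWeakLaplacian hN, h.memLp_two, w, h.test, h.tendsto_laplacian, h.tendsto⟩

theorem HasWeakLaplacian.ae_eq {g' : Eucl N → ℝ} (h : HasWeakLaplacian u g)
    (h' : HasWeakLaplacian u g') : g =ᵐ[volume] g' := by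
  refine ae_eq_of_integral_contDiff_smul_eq h.2.1 h'.2.1 fun η hη hc => ?_
  have h1 := (h.2.2 η ⟨hη, hc⟩).symm.trans (h'.2.2 η ⟨hη, hc⟩)
  simpa only [smul_eq_mul, mul_comm] using h1

/-- The weak Laplacian is unique almost everywhere, so the one provided by membership may be
replaced by any given one. -/
theorem MemD22.exists_testLimit (hu : MemD22 u) (hg : HasWeakLaplacian u g) :
    ∃ w, TestLimit w u g := by
  obtain ⟨hp, g', hg', hg2, w, hw, hw1, hw2⟩ := hu
  have hae := hg'.ae_eq hg
  refine ⟨w, hw, hp, (memLp_congr_ae hae).1 hg2, hw1.congr fun k => ?_, hw2⟩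
  exact eLpNorm_congr_ae (by filter_upwards [hae] with x hx; rw [hx])

theorem TestLimit.congr {u' g' : Eucl N → ℝ} (h : TestLimit w u g) (hu : u =ᵐ[volume] u')
    (hg : g =ᵐ[volume] g') : TestLimit w u' g' :=
  ⟨h.test, (memLp_congr_ae hu).1 h.memLp, (memLp_congr_ae hg).1 h.memLp_two,
    h.tendsto_laplacian.congr fun _ => eLpNorm_congr_ae (by
      filter_upwards [hg] with x hx; rw [hx]),
    h.tendsto.congr fun _ => eLpNorm_congr_ae (by filter_upwards [hu] with x hx; rw [hx])⟩

theorem IsTestFunction.testLimit (hu : IsTestFunction u) : TestLimit (fun _ => u) u (Δ u) :=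
  ⟨fun _ => hu, hu.memLp _, hu.laplacian.memLp _, by simp, by simp⟩

theorem TestLimit.sub_const (h : TestLimit w u g) {v : Eucl N → ℝ} (hv : IsTestFunction v) :
    TestLimit (fun k x => w k x - v x) (fun x => u x - v x) (fun x => g x - Δ v x) := by
  refine ⟨fun k => (h.test k).sub hv, h.memLp.sub (hv.memLp _),
    h.memLp_two.sub (hv.laplacian.memLp _), ?_, ?_⟩
  · refine h.tendsto_laplacian.congr fun k => ?_
    rw [(h.test k).laplacian_sub hv]
    simp only [sub_sub_sub_cancel_right]
  · simpa only [sub_sub_sub_cancel_right] using h.tendsto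

end Limits

/-! ### Local square integrability of `|x - a k|⁻²` -/

section LocalIntegrability

variable {N n : ℕ} (a : Fin n → Eucl N)

/-- In polar coordinates the square `r⁻⁴` meets the density `r ^ (N - 1)`; the product `r ^ (N - 5)`
has a nonnegative exponent. -/
theorem memLp_indicator_invSq (hN : 5 ≤ N) {K : Set (Eucl N)} (hK : IsCompact K) (k : Fin n) :
    MemLp (K.indicator (invSq a k)) 2 := by
  have : Nonempty (Fin N) := ⟨⟨0, by omega⟩⟩
  obtain ⟨R, hR⟩ := hK.isBounded.subset_ball (a k)
  have h1 : IntegrableOn (fun x : Eucl N => (fun y : ℝ => ((y ^ 2)⁻¹) ^ 2) ‖x‖)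
      (Metric.ball 0 R) := by
    refine (integrableOn_fun_norm_addHaar (volume : Measure (Eucl N))
      (f := fun y : ℝ => ((y ^ 2)⁻¹) ^ 2)).2 ?_
    have hc : IntegrableOn (fun y : ℝ => y ^ (N - 5)) (Set.Ioo 0 R) :=
      (continuous_pow _).integrableOn_Icc.mono_set Set.Ioo_subset_Icc_self
    refine hc.congr_fun (fun y hy => ?_) measurableSet_Ioo
    have hy0 : y ≠ 0 := hy.1.ne'
    obtain ⟨m, rfl⟩ := Nat.exists_eq_add_of_le hN
    simp only [finrank_euclideanSpace, Fintype.card_fin, smul_eq_mul]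
    rw [show 5 + m - 5 = m by omega, show 5 + m - 1 = m + 4 by omega]
    field_simp
    ring
  rw [← integrable_indicator_iff Metric.isOpen_ball.measurableSet] at h1
  have h2 := h1.comp_sub_right (a k)
  have hm : AEStronglyMeasurable (K.indicator (invSq a k)) :=
    ((measurable_invSq a k).indicator hK.measurableSet).aestronglyMeasurable
  rw [memLp_two_iff_integrable_sq hm]
  refine h2.mono (hm.pow 2) (Eventually.of_forall fun x => ?_)
  by_cases hx : x ∈ K
  · have hb : x - a k ∈ Metric.ball (0 : Eucl N) R := by
      simpa [dist_eq_norm] using hR hx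
    simp only [Set.indicator_of_mem hx, Set.indicator_of_mem hb, invSq]
    exact le_rfl
  · simp only [Set.indicator_of_notMem hx, ne_eq, OfNat.ofNat_ne_zero, not_false_eq_true,
      zero_pow, norm_zero]
    exact norm_nonneg _

theorem memLp_indicator_invSqSum (hN : 5 ≤ N) {K : Set (Eucl N)} (hK : IsCompact K) :
    MemLp (K.indicator fun x => 1 + invSqSum a x) 2 := by
  have h1 : MemLp (K.indicator fun _ : Eucl N => (1 : ℝ)) 2 :=
    memLp_indicator_const _ hK.measurableSet _ (Or.inr hK.measure_lt_top.ne)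
  have h2 : MemLp (fun x => ∑ k, K.indicator (invSq a k) x) 2 :=
    memLp_finsetSum _ fun k _ => memLp_indicator_invSq a hN hK k
  refine (memLp_congr_ae (Eventually.of_forall fun x => ?_)).1 (h1.add h2)
  by_cases hx : x ∈ K <;> simp [hx, invSqSum]

end LocalIntegrability

/-! ### Density of functions supported away from poles; the inequality on `D^{2,2}` -/

section Density

variable {N n : ℕ} {a : Fin n → Eucl N} {w : ℕ → Eucl N → ℝ} {u g : Eucl N → ℝ}

/-- As `u`, `∇u` and `Δu` are bounded, a multiple of `1 + T` restricted to the support of `u` serves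
as majorant, using `√T ≤ 1 + T`. -/
theorem IsTestFunction.tendsto_cutoff (hN : 5 ≤ N) (hn : 2 ≤ n) (hu : IsTestFunction u) :
    (∀ k, IsPoleFreeTest a fun x => u x * cutoff a (profile k) x) ∧
    Tendsto (fun k => eLpNorm (fun x => u x * cutoff a (profile k) x - u x) (sobolevExp N) volume)
      atTop (𝓝 0) ∧
    Tendsto (fun k => eLpNorm (fun x => Δ (fun y => u y * cutoff a (profile k) y) x - Δ u x) 2
      volume) atTop (𝓝 0) := by
  have hg : Continuous (gdot u u) := (contDiff_gdot hu.1 hu.1).continuous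
  have hgc : HasCompactSupport (gdot u u) := hu.2.mono' fun x hx => by
    by_contra h; exact hx (gdot_eq_zero_of_notMem_tsupport h)
  obtain ⟨B0, h0⟩ := hu.2.exists_bound_of_continuous hu.1.continuous
  obtain ⟨B1, h1⟩ := hgc.exists_bound_of_continuous hg
  obtain ⟨B2, h2⟩ := hu.laplacian.2.exists_bound_of_continuous hu.laplacian.1.continuous
  simp only [Real.norm_eq_abs] at h0 h1 h2
  have b0 := (abs_nonneg _).trans (h0 0)
  have b2 := (abs_nonneg _).trans (h2 0)
  set B := B0 + √B1 + B2
  have hB0 : B0 ≤ B := by linarith [Real.sqrt_nonneg B1]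
  have hB1 : √B1 ≤ B := by linarith
  have hB2 : B2 ≤ B := by linarith [Real.sqrt_nonneg B1]
  refine tendsto_cutoff_profile hN hn (sobolevExp_ne_zero hN) sobolevExp_ne_top
    (D := fun x => B * (tsupport u).indicator (fun x => 1 + invSqSum a x) x)
    (fun x _ => hu.1.contDiffAt) (hu.memLp _) hu.laplacian.1.continuous.aestronglyMeasurable
    ((memLp_indicator_invSqSum a hN hu.2.isCompact).const_mul _) fun x _ => ?_
  have hT := invSqSum_nonneg (a := a) (x := x)
  by_cases hx : x ∈ tsupport u
  · simp only [Set.indicator_of_mem hx]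
    have hB : 0 ≤ B := b0.trans hB0
    refine ⟨?_, ?_, ?_⟩
    · calc |Δ u x| ≤ B := (h2 x).trans hB2
        _ ≤ B * (1 + invSqSum a x) := le_mul_of_one_le_right hB (by linarith)
    · have hs : √(gdot u u x) ≤ B :=
        (Real.sqrt_le_sqrt ((le_abs_self _).trans (h1 x))).trans hB1
      have ht : √(invSqSum a x) ≤ 1 + invSqSum a x := by
        rw [Real.sqrt_le_left (by linarith)]
        nlinarith
      gcongr
    · have := (h0 x).trans hB0
      gcongr
      linarith
  · simp only [Set.indicator_of_notMem hx, image_eq_zero_of_notMem_tsupport hx,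
      laplacian_eq_zero_of_notMem_tsupport hx, gdot_eq_zero_of_notMem_tsupport hx]
    simp

/-- Test functions supported away from the poles are dense. -/
theorem TestLimit.exists_poleFree (hN : 5 ≤ N) (hn : 2 ≤ n) (a : Fin n → Eucl N)
    (h : TestLimit w u g) : ∃ w', TestLimit w' u g ∧ ∀ k, IsPoleFreeTest a (w' k) := by
  -- Diagonal choice: each `w k` is replaced by one of its own cut-offs, close to within `1/(k+1)`
  -- in both norms.
  have key : ∀ k : ℕ, ∃ v, IsPoleFreeTest a v ∧
      eLpNorm (fun x => v x - w k x) (sobolevExp N) volume ≤ ENNReal.ofReal (1 / ((k : ℝ) + 1)) ∧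
      eLpNorm (fun x => Δ v x - Δ (w k) x) 2 volume ≤ ENNReal.ofReal (1 / ((k : ℝ) + 1)) := by
    intro k
    obtain ⟨h1, h2, h3⟩ := (h.test k).tendsto_cutoff (a := a) hN hn
    have hpos : (0 : ℝ≥0∞) < ENNReal.ofReal (1 / ((k : ℝ) + 1)) :=
      ENNReal.ofReal_pos.2 (by positivity)
    obtain ⟨j, hj1, hj2⟩ := ((h2.eventually (ge_mem_nhds hpos)).and
      (h3.eventually (ge_mem_nhds hpos))).exists
    exact ⟨_, h1 j, hj1, hj2⟩
  choose v hv hv1 hv2 using key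
  have hz : Tendsto (fun k : ℕ => ENNReal.ofReal (1 / ((k : ℝ) + 1))) atTop (𝓝 0) := by
    have := ENNReal.tendsto_ofReal (tendsto_one_div_add_atTop_nhds_zero_nat (𝕜 := ℝ))
    simpa using this
  refine ⟨v, ⟨fun k => (hv k).1, h.memLp, h.memLp_two, ?_, ?_⟩, hv⟩
  · have hs := hz.add h.tendsto_laplacian
    rw [add_zero] at hs
    refine tendsto_of_tendsto_of_tendsto_of_le_of_le tendsto_const_nhds hs (fun _ => zero_le)
      fun k => ?_
    have m1 := ((hv k).1.laplacian.memLp 2).sub ((h.test k).laplacian.memLp 2)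
    have m2 := ((h.test k).laplacian.memLp 2).sub h.memLp_two
    have := eLpNorm_add_le m1.1 m2.1 one_le_two
    refine le_trans (le_of_eq ?_) (this.trans (add_le_add (hv2 k) le_rfl))
    congr 1; funext x; simp
  · have hs := hz.add h.tendsto
    rw [add_zero] at hs
    refine tendsto_of_tendsto_of_tendsto_of_le_of_le tendsto_const_nhds hs (fun _ => zero_le)
      fun k => ?_
    have m1 := ((hv k).1.memLp (sobolevExp N)).sub ((h.test k).memLp _)
    have m2 := ((h.test k).memLp (sobolevExp N)).sub h.memLp
    have := eLpNorm_add_le m1.1 m2.1 (one_le_sobolevExp hN)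
    refine le_trans (le_of_eq ?_) (this.trans (add_le_add (hv1 k) le_rfl))
    congr 1; funext x; simp

/-- The square root of `C V`. -/
def hardyWeight (a : Fin n → Eucl N) (x : Eucl N) : ℝ :=
  √(rellichConstant N n * multipolarPotential a x)

theorem measurable_hardyWeight (a : Fin n → Eucl N) : Measurable (hardyWeight a) :=
  ((measurable_potential a).const_mul _).sqrt

theorem hardyWeight_mul_sq (hN : 5 ≤ N) (hn : 2 ≤ n) (t : ℝ) (x : Eucl N) :
    (hardyWeight a x * t) ^ 2 = rellichConstant N n * (multipolarPotential a x * t ^ 2) := by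
  unfold hardyWeight
  rw [mul_pow, Real.sq_sqrt (mul_nonneg (rellichConstant_pos hN hn).le (potential_nonneg a hN)),
    mul_assoc]

theorem IsPoleFreeTest.div_phi {v : Eucl N → ℝ} (hv : IsPoleFreeTest a v) :
    IsPoleFreeTest a fun x => (phi a x)⁻¹ * v x :=
  hv.mul_left fun x hx => (contDiffAt_phi a hx).inv (phi_pos a x).ne'

theorem rellich_identity_div {v : Eucl N → ℝ} (hN : 5 ≤ N) (hn : 2 ≤ n) (hv : IsPoleFreeTest a v) :
    ∫ x, (Δ v x) ^ 2 = rellichConstant N n * (∫ x, multipolarPotential a x * v x ^ 2) +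
      (∫ x, remainderOne a (fun y => (phi a y)⁻¹ * v y) x ^ 2) +
      2 * ∫ x, phi a x ^ 2 * phiPot a x *
        gdot (fun y => (phi a y)⁻¹ * v y) (fun y => (phi a y)⁻¹ * v y) x := by
  have h := rellich_identity hN hn hv.div_phi
  have e : ∀ x, phi a x * ((phi a x)⁻¹ * v x) = v x := fun x =>
    mul_inv_cancel_left₀ (phi_pos a x).ne' _
  simpa only [e] using h

theorem integral_remainderTwo_nonneg {v : Eucl N → ℝ} (hN : 5 ≤ N) (hn : 2 ≤ n) :
    0 ≤ ∫ x, phi a x ^ 2 * phiPot a x * gdot v v x := by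
  refine integral_nonneg_of_ae ?_
  filter_upwards [ae_mem_poleFree a hN] with x hx
  exact mul_nonneg (mul_nonneg (sq_nonneg _) (phiPot_pos a hN hn hx).le) gdot_self_nonneg

theorem rellich_inequality_of_poleFree {v : Eucl N → ℝ} (hN : 5 ≤ N) (hn : 2 ≤ n)
    (hv : IsPoleFreeTest a v) : MemLp (fun x => hardyWeight a x * v x) 2 ∧
      eLpNorm (fun x => hardyWeight a x * v x) 2 volume ≤ eLpNorm (Δ v) 2 volume := by
  have hm : AEStronglyMeasurable fun x => hardyWeight a x * v x :=
    (measurable_hardyWeight a).aestronglyMeasurable.mul hv.1.1.continuous.aestronglyMeasurable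
  have h2 : MemLp (fun x => hardyWeight a x * v x) 2 := by
    rw [memLp_two_iff_integrable_sq hm]
    simp only [hardyWeight_mul_sq hN hn]
    exact (integrable_potential_mul_sq_of_poleFree hN hv).const_mul _
  refine ⟨h2, eLpNorm_two_le h2 (hv.1.laplacian.memLp 2) ?_⟩
  simp only [hardyWeight_mul_sq hN hn]
  rw [integral_const_mul, rellich_identity_div hN hn hv]
  have r1 : 0 ≤ ∫ x, remainderOne a (fun y => (phi a y)⁻¹ * v y) x ^ 2 :=
    integral_nonneg fun x => sq_nonneg _
  have r2 := integral_remainderTwo_nonneg (a := a) (v := fun y => (phi a y)⁻¹ * v y) hN hn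
  linarith

/-- The multipolar Rellich inequality for limits of test functions. -/
theorem TestLimit.rellich_inequality (hN : 5 ≤ N) (hn : 2 ≤ n) (a : Fin n → Eucl N)
    (h : TestLimit w u g) :
    MemLp (fun x => hardyWeight a x * u x) 2 ∧
      eLpNorm (fun x => hardyWeight a x * u x) 2 volume ≤ eLpNorm g 2 volume := by
  obtain ⟨w', h', hw'⟩ := h.exists_poleFree hN hn a
  have hm : AEStronglyMeasurable fun x => hardyWeight a x * u x :=
    (measurable_hardyWeight a).aestronglyMeasurable.mul h.memLp.1
  have hle : eLpNorm (fun x => hardyWeight a x * u x) 2 volume ≤ eLpNorm g 2 volume := by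
    -- A subsequence converges almost everywhere, and the weighted norm is lower semicontinuous
    -- along it (Fatou). The bound for the approximants is `‖g‖ + ε` eventually.
    have hmeas := tendstoInMeasure_of_tendsto_eLpNorm (sobolevExp_ne_zero hN)
      (fun k => ((h'.test k).memLp (sobolevExp N)).1) h.memLp.1 h'.tendsto
    obtain ⟨ns, hns, hae⟩ := hmeas.exists_seq_tendsto_ae
    refine ENNReal.le_of_forall_pos_le_add fun ε hε _ => ?_
    refine Lp.eLpNorm_le_of_ae_tendsto (u := atTop)
      (f := fun i x => hardyWeight a x * w' (ns i) x) ?_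
      (fun i => (rellich_inequality_of_poleFree hN hn (hw' (ns i))).1.1) ?_
    · have hε' : (0 : ℝ≥0∞) < ε := by exact_mod_cast hε
      filter_upwards [(h'.tendsto_laplacian.comp hns.tendsto_atTop).eventually (ge_mem_nhds hε')]
        with i hi
      refine (rellich_inequality_of_poleFree hN hn (hw' (ns i))).2.trans ?_
      have := eLpNorm_add_le h.memLp_two.1
        (((h'.test (ns i)).laplacian.memLp 2).sub h.memLp_two).1 one_le_two
      refine le_trans (le_of_eq ?_) (this.trans (add_le_add le_rfl hi))
      congr 1; funext x; simp
    · filter_upwards [hae] with x hx using hx.const_mul _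
  exact ⟨⟨hm, hle.trans_lt h.memLp_two.2⟩, hle⟩

theorem TestLimit.integrable_potential (hN : 5 ≤ N) (hn : 2 ≤ n) (a : Fin n → Eucl N)
    (h : TestLimit w u g) : Integrable fun x => multipolarPotential a x * u x ^ 2 := by
  have h1 := (h.rellich_inequality hN hn a).1.integrable_sq
  simp only [hardyWeight_mul_sq hN hn] at h1
  exact (integrable_const_mul_iff (isUnit_iff_ne_zero.2 (rellichConstant_pos hN hn).ne') _).1 h1

theorem TestLimit.integral_potential_le (hN : 5 ≤ N) (hn : 2 ≤ n) (a : Fin n → Eucl N)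
    (h : TestLimit w u g) :
    rellichConstant N n * ∫ x, multipolarPotential a x * u x ^ 2 ≤ ∫ x, g x ^ 2 := by
  obtain ⟨h1, h2⟩ := h.rellich_inequality hN hn a
  rw [← integral_const_mul]
  simp only [← hardyWeight_mul_sq hN hn]
  rw [← eLpNorm_two_sq h1, ← eLpNorm_two_sq h.memLp_two]
  exact pow_le_pow_left₀ ENNReal.toReal_nonneg
    ((ENNReal.toReal_le_toReal h1.2.ne h.memLp_two.2.ne).2 h2) 2

theorem TestLimit.tendsto_integral_laplacian (h : TestLimit w u g) :
    Tendsto (fun k => ∫ x, (Δ (w k) x) ^ 2) atTop (𝓝 (∫ x, g x ^ 2)) :=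
  tendsto_integral_sq (fun k => (h.test k).laplacian.memLp 2) h.memLp_two h.tendsto_laplacian

/-- The inequality applied to `u - w k` controls the weighted norm of the error by the `L²` norm of
its Laplacian. -/
theorem TestLimit.tendsto_integral_potential (hN : 5 ≤ N) (hn : 2 ≤ n) (a : Fin n → Eucl N)
    (h : TestLimit w u g) :
    Tendsto (fun k => rellichConstant N n * ∫ x, multipolarPotential a x * w k x ^ 2) atTop
      (𝓝 (rellichConstant N n * ∫ x, multipolarPotential a x * u x ^ 2)) := by
  simp only [← integral_const_mul, ← hardyWeight_mul_sq hN hn]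
  refine tendsto_integral_sq
    (fun k => ((h.test k).testLimit.rellich_inequality hN hn a).1)
    (h.rellich_inequality hN hn a).1 ?_
  refine tendsto_of_tendsto_of_tendsto_of_le_of_le tendsto_const_nhds h.tendsto_laplacian
    (fun _ => zero_le) fun k => ?_
  have := ((h.sub_const (h.test k)).rellich_inequality hN hn a).2
  calc _ = eLpNorm (fun x => -(hardyWeight a x * (u x - w k x))) 2 volume := by
        congr 1; funext x; ring
    _ = eLpNorm (fun x => hardyWeight a x * (u x - w k x)) 2 volume := eLpNorm_neg _ _ _
    _ ≤ eLpNorm (fun x => g x - Δ (w k) x) 2 volume := this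
    _ = eLpNorm (fun x => -(Δ (w k) x - g x)) 2 volume := by congr 1; funext x; ring
    _ = _ := eLpNorm_neg _ _ _

theorem TestLimit.integral_potential_pos (hN : 5 ≤ N) (hn : 2 ≤ n) (ha : Function.Injective a)
    (h : TestLimit w u g) (hu : ¬ u =ᵐ[volume] 0) :
    0 < ∫ x, multipolarPotential a x * u x ^ 2 := by
  have hnn : ∀ x, 0 ≤ multipolarPotential a x * u x ^ 2 := fun x =>
    mul_nonneg (potential_nonneg a hN) (sq_nonneg _)
  refine lt_of_le_of_ne (integral_nonneg hnn) fun h0 => hu ?_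
  have := (integral_eq_zero_iff_of_nonneg hnn (h.integrable_potential hN hn a)).1 h0.symm
  filter_upwards [this, ae_mem_poleFree a hN] with x hx hxU
  simpa [(potential_pos a hN hn ha hxU).ne'] using hx

end Density

end

noncomputable section

/-! ### Vanishing weak gradient implies constancy -/

section Constancy

variable {N : ℕ}

open scoped Convolution in
/-- A locally integrable function whose weak gradient vanishes is constant. -/
theorem exists_ae_eq_const_of_integral_mul_pd_eq_zero {f : Eucl N → ℝ} (hf : LocallyIntegrable f)
    (h : ∀ (i : Fin N) (η : Eucl N → ℝ), IsTestFunction η → ∫ x, f x * pd i η x = 0) :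
    ∃ c : ℝ, f =ᵐ[volume] fun _ => c := by
  -- Mollifiers whose two radii keep the ratio `2`, as almost everywhere convergence of the
  -- convolutions requires a bounded ratio.
  let ρ : ℕ → ContDiffBump (0 : Eucl N) := fun k =>
    ⟨1 / ((k : ℝ) + 1) / 2, 1 / ((k : ℝ) + 1), by positivity, half_lt_self (by positivity)⟩
  have hlim : ∀ᵐ x : Eucl N, Tendsto (fun k =>
      ((ρ k).normed volume ⋆[ContinuousLinearMap.lsmul ℝ ℝ, volume] f) x) atTop (𝓝 (f x)) := by
    refine ContDiffBump.ae_convolution_tendsto_right_of_locallyIntegrable (K := 2) ?_ ?_ hf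
    · exact tendsto_one_div_add_atTop_nhds_zero_nat
    · exact Eventually.of_forall fun k => by simp only [ρ]; linarith
  have hconst : ∀ k x, ((ρ k).normed volume ⋆[ContinuousLinearMap.lsmul ℝ ℝ, volume] f) x =
      ((ρ k).normed volume ⋆[ContinuousLinearMap.lsmul ℝ ℝ, volume] f) 0 := by
    intro k
    have hc : HasCompactSupport ((ρ k).normed volume) := (ρ k).hasCompactSupport_normed
    have hs : ContDiff ℝ ∞ ((ρ k).normed volume) := (ρ k).contDiff_normed
    set r := (ρ k).normed volume
    have hs1 : ContDiff ℝ 1 r := hs.of_le (by simp)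
    have hd := fun x => hc.hasFDerivAt_convolution_left (ContinuousLinearMap.lsmul ℝ ℝ) hs1 hf x
    -- A directional derivative of the mollification at `x` is, up to sign, the integral of `f`
    -- against a partial derivative of the test function `t ↦ r (x - t)`, hence zero.
    have hzero : ∀ x, (fderiv ℝ r ⋆[(ContinuousLinearMap.lsmul ℝ ℝ).precompL (Eucl N), volume] f) x
        = 0 := by
      intro x
      have hex := (hc.fderiv ℝ).convolutionExists_left
        ((ContinuousLinearMap.lsmul ℝ ℝ).precompL (Eucl N)) (hs1.continuous_fderiv one_ne_zero) hf x
      have hex' := hex.integrable_swap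
      refine ContinuousLinearMap.coe_injective
        ((EuclideanSpace.basisFun (Fin N) ℝ).toBasis.ext fun i => ?_)
      rw [convolution_eq_swap]
      simp only [OrthonormalBasis.coe_toBasis, EuclideanSpace.basisFun_apply,
        ContinuousLinearMap.coe_coe, zero_apply]
      rw [ContinuousLinearMap.integral_apply hex']
      simp only [ContinuousLinearMap.precompL_apply, ContinuousLinearMap.lsmul_apply, smul_eq_mul]
      have ht : IsTestFunction fun t => r (x - t) :=
        ⟨hs.comp (contDiff_const.sub contDiff_id), hc.comp_homeomorph (Homeomorph.subLeft x)⟩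
      have hpd : ∀ t, pd i (fun t => r (x - t)) t =
          -(fderiv ℝ r (x - t) (EuclideanSpace.single i 1)) := by
        intro t
        have h1 : HasFDerivAt (fun t : Eucl N => x - t) (-ContinuousLinearMap.id ℝ (Eucl N)) t :=
          (hasFDerivAt_id t).const_sub x
        have h2 := ((hs1.differentiable one_ne_zero) (x - t)).hasFDerivAt.comp t h1
        unfold pd
        rw [show (fun t => r (x - t)) = r ∘ fun t => x - t from rfl, h2.fderiv]
        simp
      have := h i _ ht
      simp only [hpd, mul_neg, integral_neg, neg_eq_zero] at this
      simpa only [mul_comm] using this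
    intro x
    refine is_const_of_fderiv_eq_zero (𝕜 := ℝ) (fun y => (hd y).differentiableAt) (fun y => ?_) x 0
    rw [(hd y).fderiv, hzero y]
  obtain ⟨x₀, hx₀⟩ := hlim.exists
  refine ⟨f x₀, ?_⟩
  filter_upwards [hlim] with x hx
  refine tendsto_nhds_unique hx (hx₀.congr fun k => ?_)
  rw [hconst k x₀, hconst k x]

end Constancy

/-! ### Rigidity in the case of equality -/

section Uniqueness

variable {N n : ℕ} {a : Fin n → Eucl N} {w : ℕ → Eucl N → ℝ} {u g : Eucl N → ℝ}

/-- The continuous function `∏ |x - a k| ^ ((N - 4) / n)`, which is `1 / φ` away from the poles. -/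
def phiInv (a : Fin n → Eucl N) (x : Eucl N) : ℝ := ∏ k, ‖x - a k‖ ^ poleExp N n

theorem continuous_phiInv (hN : 5 ≤ N) (hn : 2 ≤ n) : Continuous (phiInv a) := by
  have hb := poleExp_pos hN hn
  exact continuous_finsetProd _ fun k _ =>
    (continuous_id.sub continuous_const).norm.rpow_const fun x => Or.inr hb.le

theorem phiInv_eq {x : Eucl N} (hx : x ∈ poleFree a) : phiInv a x = (phi a x)⁻¹ := by
  rw [← rellichMinimizer_eq_phi a hx]
  unfold phiInv rellichMinimizer
  rw [← Finset.prod_inv_distrib]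
  refine Finset.prod_congr rfl fun k _ => ?_
  rw [← Real.rpow_neg (norm_nonneg _)]
  congr 1
  unfold poleExp
  ring

theorem phi_mul_phiInv {x : Eucl N} (hx : x ∈ poleFree a) : phi a x * phiInv a x = 1 := by
  rw [phiInv_eq hx, mul_inv_cancel₀ (phi_pos a x).ne']

/-- Keeping one pole in `W ≥ 2βT` bounds `1 / (φ² W)` by `|x - a k₀|² / (2β φ²)`, and `1/φ` extends
continuously across the poles. This provides the local bound for the weighted Cauchy–Schwarz
argument below. -/
theorem exists_continuous_inv_le (hN : 5 ≤ N) (hn : 2 ≤ n) (a : Fin n → Eucl N) :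
    ∃ J : Eucl N → ℝ, Continuous J ∧
      ∀ x ∈ poleFree a, (phi a x ^ 2 * phiPot a x)⁻¹ ≤ J x := by
  let k₀ : Fin n := ⟨0, by omega⟩
  have hb := poleExp_pos hN hn
  refine ⟨fun x => (2 * poleExp N n)⁻¹ * phiInv a x ^ 2 * ‖x - a k₀‖ ^ 2, ?_, fun x hx => ?_⟩
  · exact (continuous_const.mul ((continuous_phiInv hN hn).pow 2)).mul
      ((continuous_id.sub continuous_const).norm.pow 2)
  · have hp := phi_pos a x
    have hq := invSq_pos hx k₀
    have hle : 2 * poleExp N n * invSq a k₀ x ≤ phiPot a x :=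
      (mul_le_mul_of_nonneg_left (invSq_le_invSqSum k₀) (by positivity)).trans (phiPot_ge a)
    have e : (2 * poleExp N n)⁻¹ * phiInv a x ^ 2 * ‖x - a k₀‖ ^ 2 =
        (phi a x ^ 2 * (2 * poleExp N n * invSq a k₀ x))⁻¹ := by
      rw [phiInv_eq hx, invSq]; simp only [mul_inv, inv_inv, inv_pow]; ring
    refine le_trans ?_ e.ge
    exact inv_anti₀ (by positivity) (by gcongr)

/-- Every limit attaining the constant is a multiple of `φ`. -/
theorem TestLimit.exists_eq_mul_phi (hN : 5 ≤ N) (hn : 2 ≤ n) (a : Fin n → Eucl N)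
    (h : TestLimit w u g)
    (heq : ∫ x, g x ^ 2 = rellichConstant N n * ∫ x, multipolarPotential a x * u x ^ 2) :
    ∃ c : ℝ, u =ᵐ[volume] fun x => c * phi a x := by
  obtain ⟨w, h, hw⟩ := h.exists_poleFree hN hn a
  set v : ℕ → Eucl N → ℝ := fun k x => (phi a x)⁻¹ * w k x
  have hv : ∀ k, IsPoleFreeTest a (v k) := fun k => (hw k).div_phi
  set r : ℕ → ℝ := fun k => ∫ x, phi a x ^ 2 * phiPot a x * gdot (v k) (v k) x
  have hr0 : ∀ k, 0 ≤ r k := fun k => integral_remainderTwo_nonneg hN hn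
  -- The deficits of the `w k` converge to that of `u`, which is zero, and by the identity they
  -- dominate `r k`.
  have hr : Tendsto r atTop (𝓝 0) := by
    have ht := h.tendsto_integral_laplacian.sub (h.tendsto_integral_potential hN hn a)
    rw [heq, sub_self] at ht
    refine squeeze_zero hr0 (fun k => ?_) ht
    rw [rellich_identity_div hN hn (hw k)]
    have r1 : 0 ≤ ∫ x, remainderOne a (v k) x ^ 2 := integral_nonneg fun x => sq_nonneg _
    have := hr0 k
    simp only [r, v] at *
    linarith
  have hU := ae_mem_poleFree a hN
  obtain ⟨J, hJ, hJle⟩ := exists_continuous_inv_le hN hn a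
  have hloc : LocallyIntegrable fun x => u x * phiInv a x :=
    (h.memLp.locallyIntegrable (one_le_sobolevExp hN)).mul_continuous (continuous_phiInv hN hn)
  obtain ⟨c, hc⟩ := exists_ae_eq_const_of_integral_mul_pd_eq_zero hloc fun i η hη => by
    set m : ℝ := ∫ x, η x ^ 2 * J x
    have hlim : Tendsto (fun k => ∫ x, w k x * (phiInv a x * pd i η x)) atTop
        (𝓝 (∫ x, u x * (phiInv a x * pd i η x))) := by
      refine tendsto_integral_mul (one_le_sobolevExp hN) (fun k => (h.test k).memLp _) h.memLp
        h.tendsto ((continuous_phiInv hN hn).mul (hη.1.pd_contDiff i).continuous) ?_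
      exact HasCompactSupport.mul_left (hη.2.mono' (support_pd_subset i))
    -- Integrate by parts with `v k = w k / φ` and split `∂ᵢv · η` by the arithmetic-geometric
    -- inequality with weight `φ² W / ε`. Letting `k → ∞` removes `r k`, and then `ε → 0` removes
    -- the rest.
    have hest : ∀ ε : ℝ, 0 < ε → ∀ k,
        |∫ x, w k x * (phiInv a x * pd i η x)| ≤ 1 / 2 * (r k / ε + ε * m) := by
      intro ε hε k
      have e1 : ∫ x, w k x * (phiInv a x * pd i η x) = -∫ x, pd i (v k) x * η x := by
        rw [← integral_mul_pd i (hη.1.of_le (by simp)) hη.2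
          fun x _ => (hv k).1.1.contDiffAt.of_le (by simp)]
        refine integral_congr_ae ?_
        filter_upwards [hU] with x hx
        simp only [v, phiInv_eq hx]; ring
      have i1 : Integrable fun x => phi a x ^ 2 * phiPot a x * gdot (v k) (v k) x :=
        integrable_remainderTwo (hv k)
      have i2 : Integrable fun x => η x ^ 2 * J x := by
        have hcc : HasCompactSupport fun x => η x ^ 2 :=
          HasCompactSupport.comp_left (g := fun t : ℝ => t ^ 2) hη.2 (by simp)
        exact ((hη.1.continuous.pow 2).mul hJ).integrable_of_hasCompactSupport hcc.mul_right
      rw [e1, abs_neg]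
      calc |∫ x, pd i (v k) x * η x| ≤ ∫ x, |pd i (v k) x * η x| := abs_integral_le_integral_abs
        _ ≤ ∫ x, 1 / 2 * (phi a x ^ 2 * phiPot a x * gdot (v k) (v k) x / ε +
              ε * (η x ^ 2 * J x)) := by
            refine integral_mono_of_nonneg (Eventually.of_forall fun x => abs_nonneg _)
              (((i1.div_const ε).add (i2.const_mul ε)).const_mul _) ?_
            filter_upwards [hU] with x hx
            have hs : 0 < phi a x ^ 2 * phiPot a x :=
              mul_pos (pow_pos (phi_pos a x) 2) (phiPot_pos a hN hn hx)
            set s := phi a x ^ 2 * phiPot a x with hs_def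
            have h1 : pd i (v k) x ^ 2 ≤ gdot (v k) (v k) x := by
              have := pow_le_pow_left₀ (abs_nonneg _) (abs_pd_le_sqrt_gdot (f := v k) (x := x) i) 2
              rwa [sq_abs, Real.sq_sqrt gdot_self_nonneg] at this
            have ht : 0 < s / ε := div_pos hs hε
            have h2 := two_mul_le_add_sq (√(s / ε) * |pd i (v k) x|) (|η x| / √(s / ε))
            have hsq : √(s / ε) ≠ 0 := (Real.sqrt_pos.2 ht).ne'
            rw [mul_pow, div_pow, Real.sq_sqrt ht.le, sq_abs, sq_abs] at h2
            have h3 : 2 * (√(s / ε) * |pd i (v k) x|) * (|η x| / √(s / ε)) =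
                2 * |pd i (v k) x * η x| := by
              rw [abs_mul]; field_simp
            rw [h3] at h2
            have h4 : s / ε * pd i (v k) x ^ 2 ≤ s * gdot (v k) (v k) x / ε := by
              rw [div_mul_eq_mul_div]; gcongr
            have h5 : η x ^ 2 / (s / ε) ≤ ε * (η x ^ 2 * J x) := by
              have : η x ^ 2 / (s / ε) = ε * (η x ^ 2 * s⁻¹) := by field_simp
              rw [this]
              have := hJle x hx
              gcongr
            show |pd i (v k) x * η x| ≤ _
            linarith
        _ = 1 / 2 * (r k / ε + ε * m) := by
            rw [integral_const_mul, integral_add (i1.div_const ε) (i2.const_mul ε),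
              integral_div, integral_const_mul]
    have hlim' : ∀ ε : ℝ, 0 < ε → |∫ x, u x * (phiInv a x * pd i η x)| ≤ 1 / 2 * (ε * m) := by
      intro ε hε
      have hR : Tendsto (fun k => 1 / 2 * (r k / ε + ε * m)) atTop (𝓝 (1 / 2 * (0 / ε + ε * m))) :=
        ((hr.div_const ε).add_const _).const_mul _
      have := le_of_tendsto_of_tendsto' hlim.abs hR (hest ε hε)
      simpa using this
    have hz : |∫ x, u x * (phiInv a x * pd i η x)| ≤ 0 := by
      have ht : Tendsto (fun ε : ℝ => 1 / 2 * (ε * m)) (𝓝[>] 0) (𝓝 (1 / 2 * (0 * m))) :=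
        ((tendsto_nhdsWithin_of_tendsto_nhds tendsto_id).mul_const m).const_mul _
      rw [zero_mul, mul_zero] at ht
      refine ge_of_tendsto ht ?_
      filter_upwards [self_mem_nhdsWithin] with ε hε using hlim' ε hε
    simp only [mul_assoc]
    exact abs_nonpos_iff.1 hz
  refine ⟨c, ?_⟩
  filter_upwards [hc, hU] with x hx hxU
  rw [← hx, mul_assoc, mul_comm (phiInv a x), phi_mul_phiInv hxU, mul_one]

end Uniqueness

end

noncomputable section

/-! ### Integrals of radial majorants -/

section Radial

/-- The radial majorant `r ^ (-α) * max 1 r ^ (-γ)`. -/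
def radialBound (α γ r : ℝ) : ℝ := r ^ (-α) * max 1 r ^ (-γ)

theorem radialBound_nonneg {α γ r : ℝ} (hr : 0 ≤ r) : 0 ≤ radialBound α γ r := by
  unfold radialBound; positivity

theorem radialBound_rpow {α γ r : ℝ} (p : ℝ) (hr : 0 ≤ r) :
    radialBound α γ r ^ p = radialBound (p * α) (p * γ) r := by
  unfold radialBound
  rw [Real.mul_rpow (by positivity) (by positivity), ← Real.rpow_mul hr,
    ← Real.rpow_mul (by positivity)]
  ring_nf

variable {N : ℕ}

theorem pow_mul_rpow_neg (hN : 5 ≤ N) {y : ℝ} (hy : 0 < y) (α : ℝ) :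
    y ^ (N - 1) * y ^ (-α) = y ^ ((N : ℝ) - 1 - α) := by
  rw [← Real.rpow_natCast, ← Real.rpow_add hy, Nat.cast_sub (by omega)]
  norm_num [sub_eq_add_neg]

/-- The majorant behaves like `r ^ (-α)` at the origin and like `r ^ (-(α + γ))` at infinity; each
exponent is compared with `N`. -/
theorem integrable_radialBound (hN : 5 ≤ N) {α γ : ℝ} (h1 : α < N) (h2 : N < α + γ) :
    Integrable fun x : Eucl N => radialBound α γ ‖x‖ := by
  have : Nonempty (Fin N) := ⟨⟨0, by omega⟩⟩
  refine (integrable_fun_norm_addHaar (volume : Measure (Eucl N)) (f := radialBound α γ)).2 ?_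
  simp only [finrank_euclideanSpace, Fintype.card_fin, smul_eq_mul]
  rw [← Set.Ioc_union_Ioi_eq_Ioi (zero_le_one (α := ℝ))]
  refine IntegrableOn.union ?_ ?_
  · have h : IntegrableOn (fun y : ℝ => y ^ ((N : ℝ) - 1 - α)) (Set.Ioc 0 1) :=
      (intervalIntegrable_iff_integrableOn_Ioc_of_le zero_le_one).1
        (intervalIntegral.intervalIntegrable_rpow' (by linarith))
    refine h.congr_fun (fun y hy => ?_) measurableSet_Ioc
    simp only [radialBound, max_eq_left hy.2, Real.one_rpow, mul_one]
    exact (pow_mul_rpow_neg hN hy.1 α).symm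
  · have h : IntegrableOn (fun y : ℝ => y ^ ((N : ℝ) - 1 - (α + γ))) (Set.Ioi 1) :=
      integrableOn_Ioi_rpow_of_lt (by linarith) one_pos
    refine h.congr_fun (fun y hy => ?_) measurableSet_Ioi
    have hy0 : 0 < y := one_pos.trans hy
    simp only [radialBound, max_eq_right (le_of_lt (Set.mem_Ioi.1 hy))]
    rw [← Real.rpow_add hy0, ← neg_add]
    exact (pow_mul_rpow_neg hN hy0 _).symm

/-- The borderline majorant, cut off near the origin, has logarithmic growth. -/
theorem integral_radialBound_cut (hN : 5 ≤ N) : ∃ K : ℝ, 0 < K ∧ ∀ ρ : ℝ, 0 < ρ → ρ ≤ 1 →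
    Integrable (fun x : Eucl N => (Set.Ici ρ).indicator (radialBound N (N - 4)) ‖x‖) ∧
    ∫ x : Eucl N, (Set.Ici ρ).indicator (radialBound N (N - 4)) ‖x‖ ≤ K * (1 - Real.log ρ) := by
  have : Nonempty (Fin N) := ⟨⟨0, by omega⟩⟩
  have hN' : (5 : ℝ) ≤ N := by exact_mod_cast hN
  refine ⟨N * ((volume : Measure (Eucl N)).real (Metric.ball 0 1) + 1),
    by positivity, fun ρ hρ hρ1 => ?_⟩
  set f : ℝ → ℝ := (Set.Ici ρ).indicator (radialBound N (N - 4)) with hf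
  -- Against the density `y ^ (N - 1)` the integrand is `y⁻¹` on `[ρ, 1]`, contributing `-log ρ`.
  -- Beyond `1` it is `y ^ (3 - N) ≤ y⁻²`, contributing at most `1`.
  set G : ℝ → ℝ := fun y => (Set.Icc ρ 1).indicator (fun y => y⁻¹) y +
    (Set.Ioi 1).indicator (fun y => y ^ (-2 : ℝ)) y with hG
  have g1 : IntegrableOn (fun y : ℝ => y⁻¹) (Set.Icc ρ 1) := by
    refine ContinuousOn.integrableOn_Icc (continuousOn_inv₀.mono fun y hy => ?_)
    exact (hρ.trans_le hy.1).ne'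
  have g2 : IntegrableOn (fun y : ℝ => y ^ (-2 : ℝ)) (Set.Ioi 1) :=
    integrableOn_Ioi_rpow_of_lt (by norm_num) one_pos
  have g1' := (integrable_indicator_iff measurableSet_Icc).2 g1
  have g2' := (integrable_indicator_iff measurableSet_Ioi).2 g2
  have hGi : Integrable G := g1'.add g2'
  have hGint : ∫ y, G y = 1 - Real.log ρ := by
    rw [hG, integral_add g1' g2', integral_indicator measurableSet_Icc,
      integral_indicator measurableSet_Ioi, integral_Icc_eq_integral_Ioc,
      ← intervalIntegral.integral_of_le hρ1, integral_inv_of_pos hρ one_pos,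
      integral_Ioi_rpow_of_lt (by norm_num) one_pos]
    rw [one_div, Real.log_inv]
    norm_num
    ring
  have hle : ∀ y ∈ Set.Ioi (0 : ℝ), y ^ (N - 1) * f y ≤ G y := by
    intro y hy
    have hy0 : 0 < y := hy
    by_cases h1 : y < ρ
    · have : f y = 0 := Set.indicator_of_notMem (by simpa using h1) _
      rw [this, mul_zero, hG]
      refine add_nonneg (Set.indicator_nonneg (fun z hz => ?_) _)
        (Set.indicator_nonneg (fun z hz => ?_) _)
      · exact inv_nonneg.2 (hρ.le.trans hz.1)
      · exact Real.rpow_nonneg (zero_le_one.trans (le_of_lt hz)) _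
    · have hfy : f y = radialBound N (N - 4) y :=
        Set.indicator_of_mem (show y ∈ Set.Ici ρ from not_lt.1 h1) _
      rw [hfy, radialBound, ← mul_assoc, pow_mul_rpow_neg hN hy0]
      by_cases h2 : y ≤ 1
      · have e1 : y ∈ Set.Icc ρ 1 := ⟨not_lt.1 h1, h2⟩
        have e2 : y ∉ Set.Ioi (1 : ℝ) := not_lt.2 h2
        simp only [hG, Set.indicator_of_mem e1, Set.indicator_of_notMem e2, max_eq_left h2,
          Real.one_rpow, mul_one, add_zero]
        rw [show (N : ℝ) - 1 - N = -1 by ring, Real.rpow_neg_one]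
      · have h2' : 1 < y := not_le.1 h2
        have e1 : y ∉ Set.Icc ρ 1 := fun h => h2 h.2
        simp only [hG, Set.indicator_of_notMem e1, Set.indicator_of_mem (Set.mem_Ioi.2 h2'),
          max_eq_right h2'.le, zero_add]
        rw [← Real.rpow_add hy0]
        exact Real.rpow_le_rpow_of_exponent_le h2'.le (by linarith)
  have hnn : ∀ y ∈ Set.Ioi (0 : ℝ), 0 ≤ y ^ (N - 1) * f y := fun y hy =>
    mul_nonneg (pow_nonneg (le_of_lt hy) _)
      (Set.indicator_nonneg (fun z hz => radialBound_nonneg (hρ.le.trans hz)) _)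
  have hmeas : Measurable f := by
    refine Measurable.indicator ?_ measurableSet_Ici
    unfold radialBound; fun_prop
  have hfi : IntegrableOn (fun y : ℝ => y ^ (N - 1) * f y) (Set.Ioi 0) := by
    refine hGi.integrableOn.mono' (by fun_prop) ?_
    refine (ae_restrict_iff' measurableSet_Ioi).2 (Eventually.of_forall fun y hy => ?_)
    rw [Real.norm_eq_abs, abs_of_nonneg (hnn y hy)]
    exact hle y hy
  constructor
  · refine (integrable_fun_norm_addHaar (volume : Measure (Eucl N)) (f := f)).2 ?_
    simpa only [finrank_euclideanSpace, Fintype.card_fin, smul_eq_mul] using hfi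
  · have h := integral_fun_norm_addHaar (volume : Measure (Eucl N)) f
    simp only [finrank_euclideanSpace, Fintype.card_fin, smul_eq_mul, nsmul_eq_mul] at h
    rw [h]
    have hGnn : 0 ≤ᵐ[volume] G := Eventually.of_forall fun y =>
      add_nonneg (Set.indicator_nonneg (fun z hz => inv_nonneg.2 (hρ.le.trans hz.1)) _)
        (Set.indicator_nonneg (fun z hz => Real.rpow_nonneg (zero_le_one.trans (le_of_lt hz)) _) _)
    have hI : ∫ y in Set.Ioi (0 : ℝ), y ^ (N - 1) * f y ≤ 1 - Real.log ρ := by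
      rw [← hGint]
      exact (setIntegral_mono_on hfi hGi.integrableOn measurableSet_Ioi hle).trans
        (setIntegral_le_integral hGi hGnn)
    have hI0 : 0 ≤ 1 - Real.log ρ := by linarith [Real.log_nonpos hρ.le hρ1]
    have hv : 0 ≤ (volume : Measure (Eucl N)).real (Metric.ball 0 1) := measureReal_nonneg
    rw [mul_assoc]
    refine mul_le_mul_of_nonneg_left ?_ N.cast_nonneg
    exact (mul_le_mul_of_nonneg_left hI hv).trans (mul_le_mul_of_nonneg_right (by linarith) hI0)

end Radial

/-! ### Pointwise majorants and integrability of `φ` and `φT` -/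

section Majorants

variable {N n : ℕ} {a : Fin n → Eucl N}

/-- Take `a i` closest to `x` and let `d` be the least distance between poles. If `|x - a i| ≤ 1`,
the triangle inequality keeps the other poles at distance at least `d/2`; otherwise minimality
suffices. -/
theorem exists_nearest_pole (hn : 2 ≤ n) (ha : Function.Injective a) :
    ∃ δ : ℝ, 0 < δ ∧ ∀ x : Eucl N, ∃ i, (∀ j, ‖x - a i‖ ≤ ‖x - a j‖) ∧
      ∀ j, j ≠ i → δ * max 1 ‖x - a i‖ ≤ ‖x - a j‖ := by
  have : Nonempty {p : Fin n × Fin n // p.1 ≠ p.2} :=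
    ⟨⟨(⟨0, by omega⟩, ⟨1, by omega⟩), by simp⟩⟩
  have : Nonempty (Fin n) := ⟨⟨0, by omega⟩⟩
  obtain ⟨p, hp⟩ := Finite.exists_min fun p : {p : Fin n × Fin n // p.1 ≠ p.2} =>
    ‖a p.1.1 - a p.1.2‖
  set d := ‖a p.1.1 - a p.1.2‖
  have hd : 0 < d := norm_pos_iff.2 (sub_ne_zero.2 fun h => p.2 (ha h))
  refine ⟨min 1 (d / 2), by positivity, fun x => ?_⟩
  obtain ⟨i, hi⟩ := Finite.exists_min fun i => ‖x - a i‖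
  refine ⟨i, hi, fun j hj => ?_⟩
  have h1 : d ≤ ‖a i - a j‖ := hp ⟨(i, j), hj.symm⟩
  have h2 : ‖a i - a j‖ ≤ ‖x - a i‖ + ‖x - a j‖ := by
    rw [norm_sub_rev x (a i)]
    calc ‖a i - a j‖ = ‖(a i - x) + (x - a j)‖ := by congr 1; abel
      _ ≤ _ := norm_add_le _ _
  have h3 := hi j
  rcases le_total 1 ‖x - a i‖ with h | h
  · rw [max_eq_right h]
    calc _ ≤ 1 * ‖x - a i‖ := by gcongr; exact min_le_left _ _
      _ ≤ _ := by rw [one_mul]; exact h3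
  · rw [max_eq_left h, mul_one]
    refine (min_le_right _ _).trans ?_
    linarith

/-- Near the closest pole `a i`, both `φ` and `φ ∑ 1 / |x - a k| ^ 2` have radial majorants. -/
theorem exists_phi_le (hN : 5 ≤ N) (hn : 2 ≤ n) (ha : Function.Injective a) :
    ∃ C : ℝ, 0 < C ∧ ∀ x ∈ poleFree a, ∃ i, (∀ j, ‖x - a i‖ ≤ ‖x - a j‖) ∧
      phi a x ≤ C * radialBound (poleExp N n) ((n - 1) * poleExp N n) ‖x - a i‖ ∧
      phi a x * invSqSum a x ≤
        C * radialBound (poleExp N n + 2) ((n - 1) * poleExp N n) ‖x - a i‖ := by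
  obtain ⟨δ, hδ, hnear⟩ := exists_nearest_pole hn ha
  have hb := poleExp_pos hN hn
  set β := poleExp N n with hβ
  have hn1 : ((n - 1 : ℕ) : ℝ) = (n : ℝ) - 1 := by rw [Nat.cast_sub (by omega)]; simp
  have hn0 : (1 : ℝ) ≤ n := by exact_mod_cast (by omega : 1 ≤ n)
  refine ⟨n * (δ ^ (-β)) ^ (n - 1), by positivity, fun x hx => ?_⟩
  obtain ⟨i, hi, hij⟩ := hnear x
  have hri := norm_sub_pos hx i
  have hphi : phi a x ≤ (δ ^ (-β)) ^ (n - 1) * radialBound β ((n - 1) * β) ‖x - a i‖ := by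
    rw [← rellichMinimizer_eq_phi a hx, rellichMinimizer,
      show (4 - (N : ℝ)) / n = -β by rw [hβ, poleExp]; ring,
      ← Finset.mul_prod_erase _ _ (Finset.mem_univ i), radialBound]
    have hmax : (max 1 ‖x - a i‖ ^ (-β)) ^ (n - 1) = max 1 ‖x - a i‖ ^ (-β * ((n : ℝ) - 1)) := by
      rw [← Real.rpow_mul_natCast (by positivity), hn1]
    have hprod : ∏ j ∈ Finset.univ.erase i, ‖x - a j‖ ^ (-β) ≤
        ∏ _j ∈ Finset.univ.erase i, (δ ^ (-β) * max 1 ‖x - a i‖ ^ (-β)) := by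
      refine Finset.prod_le_prod (fun j _ => by positivity) fun j hj => ?_
      rw [← Real.mul_rpow hδ.le (by positivity)]
      exact Real.rpow_le_rpow_of_nonpos (by positivity) (hij j (Finset.ne_of_mem_erase hj))
        (by linarith)
    rw [Finset.prod_const, Finset.card_erase_of_mem (Finset.mem_univ i), Finset.card_univ,
      Fintype.card_fin, mul_pow, hmax] at hprod
    calc _ ≤ ‖x - a i‖ ^ (-β) * ((δ ^ (-β)) ^ (n - 1) * max 1 ‖x - a i‖ ^ (-β * ((n : ℝ) - 1))) := by
          gcongr
      _ = _ := by rw [show -β * ((n : ℝ) - 1) = -((n - 1) * β) by ring]; ring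
  refine ⟨i, hi, ?_, ?_⟩
  · refine hphi.trans ?_
    have := radialBound_nonneg (α := β) (γ := (n - 1) * β) hri.le
    gcongr
    exact le_mul_of_one_le_left (by positivity) hn0
  · have hT : invSqSum a x ≤ n * ‖x - a i‖ ^ (-2 : ℝ) := by
      have : ∀ k ∈ Finset.univ, invSq a k x ≤ ‖x - a i‖ ^ (-2 : ℝ) := by
        intro k _
        rw [Real.rpow_neg hri.le, Real.rpow_two]
        exact inv_anti₀ (by positivity) (pow_le_pow_left₀ hri.le (hi k) 2)
      simpa [invSqSum] using Finset.sum_le_card_nsmul _ _ _ this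
    have h0 := radialBound_nonneg (α := β) (γ := (n - 1) * β) hri.le
    calc phi a x * invSqSum a x ≤ ((δ ^ (-β)) ^ (n - 1) *
          radialBound β ((n - 1) * β) ‖x - a i‖) * (n * ‖x - a i‖ ^ (-2 : ℝ)) := by
          have := invSqSum_nonneg (a := a) (x := x)
          gcongr
      _ = _ := by
        unfold radialBound
        rw [neg_add, Real.rpow_add hri]; ring

/-- A function bounded by a radial majorant centred at some pole is in `L^p`. -/
theorem memLp_of_le_radialBound (hN : 5 ≤ N) {p : ℝ≥0∞} (hp0 : p ≠ 0) (hp : p ≠ ⊤)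
    {f : Eucl N → ℝ} (hf : AEStronglyMeasurable f) {C α γ : ℝ}
    (h1 : p.toReal * α < N) (h2 : N < p.toReal * (α + γ))
    (hle : ∀ x ∈ poleFree a, ∃ i, |f x| ≤ C * radialBound α γ ‖x - a i‖) (hC : 0 < C) :
    MemLp f p := by
  have hp' : 0 < p.toReal := ENNReal.toReal_pos hp0 hp
  rw [← integrable_norm_rpow_iff hf hp0 hp]
  have hi : Integrable fun x : Eucl N =>
      C ^ p.toReal * ∑ i, radialBound (p.toReal * α) (p.toReal * γ) ‖x - a i‖ :=
    (integrable_finsetSum _ fun i _ =>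
      (integrable_radialBound hN h1 (by linarith)).comp_sub_right (a i)).const_mul _
  refine hi.mono' (hf.norm.aemeasurable.pow_const _).aestronglyMeasurable ?_
  filter_upwards [ae_mem_poleFree a hN] with x hx
  obtain ⟨i, hxi⟩ := hle x hx
  rw [Real.norm_eq_abs, abs_of_nonneg (by positivity), Real.norm_eq_abs]
  calc |f x| ^ p.toReal ≤ (C * radialBound α γ ‖x - a i‖) ^ p.toReal := by gcongr
    _ = C ^ p.toReal * radialBound (p.toReal * α) (p.toReal * γ) ‖x - a i‖ := by
      rw [Real.mul_rpow hC.le (radialBound_nonneg (norm_nonneg _)),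
        radialBound_rpow _ (norm_nonneg _)]
    _ ≤ _ := by
      gcongr
      exact Finset.single_le_sum
        (f := fun i => radialBound (p.toReal * α) (p.toReal * γ) ‖x - a i‖)
        (fun j _ => radialBound_nonneg (norm_nonneg _)) (Finset.mem_univ i)

theorem poleExp_mul (hn : 2 ≤ n) : (n : ℝ) * poleExp N n = N - 4 := by
  have : (n : ℝ) ≠ 0 := by positivity
  unfold poleExp; field_simp

theorem poleExp_lt (hN : 5 ≤ N) (hn : 3 ≤ n) : poleExp N n < (N - 4) / 2 := by
  have hN' : (5 : ℝ) ≤ N := by exact_mod_cast hN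
  have hn' : (3 : ℝ) ≤ n := by exact_mod_cast hn
  unfold poleExp
  exact div_lt_div_of_pos_left (by linarith) two_pos (by linarith)

/-- With `p = 2N/(N-4)`, integrability at a pole means `β < (N-4)/2`, that is `n > 2`. At infinity
`p (N - 4) = 2N > N`. -/
theorem memLp_phi (hN : 5 ≤ N) (hn : 3 ≤ n) (ha : Function.Injective a) :
    MemLp (phi a) (sobolevExp N) := by
  obtain ⟨C, hC, hle⟩ := exists_phi_le hN (by omega) ha
  have hN' : (5 : ℝ) ≤ N := by exact_mod_cast hN
  have hp : (sobolevExp N).toReal = 2 * N / ((N : ℝ) - 4) :=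
    ENNReal.toReal_ofReal (div_nonneg (by positivity) (by linarith))
  have h4 : (N : ℝ) - 4 ≠ 0 := by linarith
  refine memLp_of_le_radialBound (a := a) hN (sobolevExp_ne_zero hN) sobolevExp_ne_top
    (measurable_phi a).aestronglyMeasurable (C := C) (α := poleExp N n)
    (γ := (n - 1) * poleExp N n) ?_ ?_ (fun x hx => ?_) hC
  · rw [hp]
    calc 2 * N / ((N : ℝ) - 4) * poleExp N n < 2 * N / ((N : ℝ) - 4) * ((N - 4) / 2) := by
          have : 0 < 2 * N / ((N : ℝ) - 4) := div_pos (by positivity) (by linarith)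
          gcongr
          exact poleExp_lt hN hn
      _ = N := by field_simp
  · rw [hp, show poleExp N n + (n - 1) * poleExp N n = n * poleExp N n by ring,
      poleExp_mul (by omega), div_mul_cancel₀ _ h4]
    linarith
  · obtain ⟨i, -, hi, -⟩ := hle x hx
    exact ⟨i, by rwa [abs_of_pos (phi_pos a x)]⟩

/-- At a pole `2(β + 2) < N` is again the condition `β < (N-4)/2`; at infinity `2(N - 2) > N`. -/
theorem memLp_phi_mul_invSqSum (hN : 5 ≤ N) (hn : 3 ≤ n) (ha : Function.Injective a) :
    MemLp (fun x => phi a x * invSqSum a x) 2 := by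
  obtain ⟨C, hC, hle⟩ := exists_phi_le hN (by omega) ha
  have hN' : (5 : ℝ) ≤ N := by exact_mod_cast hN
  refine memLp_of_le_radialBound (a := a) hN two_ne_zero ENNReal.ofNat_ne_top
    ((measurable_phi a).mul (measurable_invSqSum a)).aestronglyMeasurable (C := C)
    (α := poleExp N n + 2) (γ := (n - 1) * poleExp N n) ?_ ?_ (fun x hx => ?_) hC
  · have := poleExp_lt hN hn
    rw [ENNReal.toReal_ofNat]; linarith
  · have := poleExp_mul (N := N) (n := n) (by omega)
    rw [ENNReal.toReal_ofNat]; linarith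
  · obtain ⟨i, -, -, hi⟩ := hle x hx
    exact ⟨i, by rwa [abs_of_nonneg (mul_nonneg (phi_pos a x).le invSqSum_nonneg)]⟩

end Majorants

end

noncomputable section

/-! ### The deficit of the cut-off ground state -/

section Remainder

variable {N n : ℕ} {a : Fin n → Eucl N}

/-- The function `φ` cut off near the poles and at infinity. -/
def phiCut (a : Fin n → Eucl N) (k : ℕ) (x : Eucl N) : ℝ := phi a x * cutoff a (profile k) x

theorem isPoleFreeTest_cutoff_profile (hn : 2 ≤ n) (k : ℕ) :
    IsPoleFreeTest a (cutoff a (profile k)) :=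
  isPoleFreeTest_cutoff hn (contDiff_profile k) (hasCompactSupport_profile k)

theorem isPoleFreeTest_phiCut (hn : 2 ≤ n) (k : ℕ) : IsPoleFreeTest a (phiCut a k) :=
  (isPoleFreeTest_cutoff_profile hn k).mul_left fun _ hx => contDiffAt_phi a hx

/-- The deficit is the sum of the two remainders. These vanish where `|L| > 2(k+1)`, so `G` has to
dominate only elsewhere, and there the squared derivatives of the profile give `1/(k+1)²`. -/
theorem exists_deficit_le (hN : 5 ≤ N) (hn : 2 ≤ n) (a : Fin n → Eucl N) :
    ∃ K : ℝ, 0 < K ∧ ∀ (k : ℕ) (G : Eucl N → ℝ), Integrable G → (∀ x, 0 ≤ G x) →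
      (∀ x ∈ poleFree a, |logSum a x| ≤ 2 * ((k : ℝ) + 1) → (phi a x * invSqSum a x) ^ 2 ≤ G x) →
      (∫ x, (Δ (phiCut a k) x) ^ 2) - rellichConstant N n *
        (∫ x, multipolarPotential a x * phiCut a k x ^ 2) ≤ K / ((k : ℝ) + 1) ^ 2 * ∫ x, G x := by
  obtain ⟨B, hB, hder⟩ := exists_deriv_profile_bound
  obtain ⟨K, hK, hrem⟩ := exists_remainder_bound (a := a) hN hn
  refine ⟨K * (2 * B) ^ 2, by positivity, fun k G hG hG0 hle => ?_⟩
  have hχ : IsPoleFreeTest a (cutoff a (profile k)) := isPoleFreeTest_cutoff_profile hn k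
  have hid := rellich_identity hN hn hχ
  have i1 := (isTestFunction_remainderOne hn hχ).integrable_sq
  have i2 := (integrable_remainderTwo hχ).const_mul 2
  have hU := ae_mem_poleFree a hN
  have hk : (0 : ℝ) < k + 1 := by positivity
  calc _ = ∫ x, (remainderOne a (cutoff a (profile k)) x ^ 2 + 2 * (phi a x ^ 2 * phiPot a x *
        gdot (cutoff a (profile k)) (cutoff a (profile k)) x)) := by
        rw [integral_add i1 i2, integral_const_mul]
        unfold phiCut
        rw [hid]; ring
    _ ≤ ∫ x, K * (2 * B) ^ 2 / ((k : ℝ) + 1) ^ 2 * G x := by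
        refine integral_mono_ae (i1.add i2) (hG.const_mul _) ?_
        filter_upwards [hU] with x hx
        refine (hrem _ (contDiff_profile k) x hx).trans ?_
        rcases le_or_gt |logSum a x| (2 * ((k : ℝ) + 1)) with hL | hL
        · obtain ⟨d1, d2⟩ := hder k (logSum a x)
          calc _ ≤ K * ((B / (k + 1) + B / (k + 1)) ^ 2 * G x) := by
                have := hle x hx hL
                gcongr
            _ = _ := by field_simp; ring
        · obtain ⟨d1, d2⟩ := deriv_profile_eq_zero hL
          rw [d1, d2]
          have := hG0 x
          simp only [abs_zero, add_zero, ne_eq, OfNat.ofNat_ne_zero, not_false_eq_true, zero_pow,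
            zero_mul, mul_zero]
          positivity
    _ = _ := integral_const_mul _ _

/-- Linear growth in `k` is affordable against the factor `1/(k+1)²`. For `n ≥ 3` one integrable
majorant works for all `k`; for `n = 2` the borderline singularity `r ^ (-N)`, truncated at a radius
exponentially small in `k`, has an integral of order `k`. -/
theorem exists_integral_majorant (hN : 5 ≤ N) (hn : 2 ≤ n) (ha : Function.Injective a) :
    ∃ M : ℝ, 0 < M ∧ ∀ k : ℕ, ∃ G : Eucl N → ℝ, Integrable G ∧ (∀ x, 0 ≤ G x) ∧
      (∀ x ∈ poleFree a, |logSum a x| ≤ 2 * ((k : ℝ) + 1) → (phi a x * invSqSum a x) ^ 2 ≤ G x) ∧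
      ∫ x, G x ≤ M * (k + 1) := by
  have hN' : (5 : ℝ) ≤ N := by exact_mod_cast hN
  rcases Nat.lt_or_ge 2 n with h3 | h2
  · have hF := (memLp_phi_mul_invSqSum hN h3 ha).integrable_sq
    have h0 : 0 ≤ ∫ x, (phi a x * invSqSum a x) ^ 2 := integral_nonneg fun x => sq_nonneg _
    refine ⟨(∫ x, (phi a x * invSqSum a x) ^ 2) + 1, by linarith, fun k =>
      ⟨_, hF, fun x => sq_nonneg _, fun x _ _ => le_rfl, ?_⟩⟩
    have : (0 : ℝ) ≤ k := k.cast_nonneg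
    nlinarith
  · obtain rfl : n = 2 := le_antisymm h2 hn
    obtain ⟨C, hC, hle⟩ := exists_phi_le hN hn ha
    obtain ⟨K, hK, hcut⟩ := integral_radialBound_cut hN
    set d := ‖a 0 - a 1‖ with hd
    have hd0 : 0 ≤ d := norm_nonneg _
    have hlog : 0 ≤ Real.log (1 + d) := Real.log_nonneg (by linarith)
    refine ⟨C ^ 2 * (2 * (K * (2 + Real.log (1 + d)))), by positivity, fun k => ?_⟩
    -- If the nearest pole is within distance `1`, both distances are at most `1 + d`. The condition
    -- on `logSum` then bounds the logarithm of either distance below by `-(k+1) - log (1 + d)`.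
    set ρ := Real.exp (-((k : ℝ) + 1) - Real.log (1 + d)) with hρ
    have hk0 : (0 : ℝ) ≤ k := k.cast_nonneg
    have hρ0 : 0 < ρ := Real.exp_pos _
    have hρ1 : ρ ≤ 1 := Real.exp_le_one_iff.2 (by linarith)
    obtain ⟨hint, hval⟩ := hcut ρ hρ0 hρ1
    set R : ℝ → ℝ := (Set.Ici ρ).indicator (radialBound N (N - 4)) with hR
    have hR0 : ∀ r, 0 ≤ R r := fun r =>
      Set.indicator_nonneg (fun z hz => radialBound_nonneg (hρ0.le.trans hz)) _
    have hRi : ∀ i : Fin 2, Integrable fun x => R ‖x - a i‖ := fun i => hint.comp_sub_right (a i)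
    refine ⟨fun x => C ^ 2 * ∑ i, R ‖x - a i‖,
      (integrable_finsetSum _ fun i _ => hRi i).const_mul _,
      fun x => mul_nonneg (sq_nonneg _) (Finset.sum_nonneg fun i _ => hR0 _), fun x hx hL => ?_, ?_⟩
    · obtain ⟨i, hi, -, hF⟩ := hle x hx
      have hri := norm_sub_pos hx i
      have hF2 : (phi a x * invSqSum a x) ^ 2 ≤ C ^ 2 * radialBound N (N - 4) ‖x - a i‖ := by
        have h := pow_le_pow_left₀ (mul_nonneg (phi_pos a x).le invSqSum_nonneg) hF 2
        refine h.trans (le_of_eq ?_)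
        rw [mul_pow, ← Real.rpow_two (radialBound _ _ _), radialBound_rpow _ hri.le]
        congr 2 <;> unfold poleExp <;> push_cast <;> ring
      have hmem : ρ ≤ ‖x - a i‖ := by
        rcases lt_or_ge 1 ‖x - a i‖ with h1 | h1
        · exact hρ1.trans h1.le
        have hother : ∀ j, ‖x - a j‖ ≤ 1 + d := by
          have htri : ∀ j, ‖x - a j‖ ≤ ‖x - a i‖ + ‖a i - a j‖ := fun j => by
            calc ‖x - a j‖ = ‖(x - a i) + (a i - a j)‖ := by congr 1; abel
              _ ≤ _ := norm_add_le _ _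
          have hdist : ∀ i j : Fin 2, ‖a i - a j‖ ≤ d := by
            intro i j
            fin_cases i <;> fin_cases j <;> simp [hd, norm_sub_rev]
          intro j
          linarith [htri j, hdist i j]
        have hlogle : ∀ j, Real.log ‖x - a j‖ ≤ Real.log (1 + d) := fun j =>
          Real.log_le_log (norm_sub_pos hx j) (hother j)
        have hsum : -(2 * ((k : ℝ) + 1)) ≤
            2 * Real.log ‖x - a 0‖ + 2 * Real.log ‖x - a 1‖ := by
          have := (abs_le.1 hL).1
          simpa [logSum, logDist, Fin.sum_univ_two, Real.log_pow] using this
        rw [hρ, ← Real.le_log_iff_exp_le hri]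
        have l0 := hlogle 0
        have l1 := hlogle 1
        fin_cases i
        · simp only [Fin.zero_eta]; linarith
        · simp only [Fin.mk_one]; linarith
      refine hF2.trans ?_
      have hRr : R ‖x - a i‖ = radialBound N (N - 4) ‖x - a i‖ :=
        Set.indicator_of_mem (show ‖x - a i‖ ∈ Set.Ici ρ from hmem) _
      rw [← hRr]
      exact mul_le_mul_of_nonneg_left
        (Finset.single_le_sum (f := fun i => R ‖x - a i‖) (fun j _ => hR0 _) (Finset.mem_univ i))
        (sq_nonneg C)
    · rw [integral_const_mul, integral_finsetSum _ fun i _ => hRi i]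
      have htr : ∀ i : Fin 2, ∫ x, R ‖x - a i‖ = ∫ x : Eucl N, R ‖x‖ := fun i =>
        integral_sub_right_eq_self (fun x : Eucl N => R ‖x‖) (a i)
      simp only [htr, Finset.sum_const, Finset.card_univ, Fintype.card_fin, nsmul_eq_mul]
      have hI : ∫ x : Eucl N, R ‖x‖ ≤ K * ((2 + Real.log (1 + d)) * (k + 1)) := by
        rw [hρ, Real.log_exp] at hval
        refine hval.trans (mul_le_mul_of_nonneg_left ?_ hK.le)
        nlinarith
      calc C ^ 2 * (((2 : ℕ) : ℝ) * ∫ x : Eucl N, R ‖x‖)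
          ≤ C ^ 2 * (2 * (K * ((2 + Real.log (1 + d)) * (k + 1)))) := by
            push_cast
            gcongr
        _ = _ := by ring

/-- The deficit of the cut off functions tends to zero. -/
theorem tendsto_deficit (hN : 5 ≤ N) (hn : 2 ≤ n) (ha : Function.Injective a) :
    Tendsto (fun k => (∫ x, (Δ (phiCut a k) x) ^ 2) - rellichConstant N n *
        (∫ x, multipolarPotential a x * phiCut a k x ^ 2)) atTop (𝓝 0) := by
  obtain ⟨K, hK, hdef⟩ := exists_deficit_le hN hn a
  obtain ⟨M, hM, hmaj⟩ := exists_integral_majorant hN hn ha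
  have hz : Tendsto (fun k : ℕ => K * M * (1 / ((k : ℝ) + 1))) atTop (𝓝 0) := by
    simpa using (tendsto_one_div_add_atTop_nhds_zero_nat (𝕜 := ℝ)).const_mul (K * M)
  refine squeeze_zero (fun k => ?_) (fun k => ?_) hz
  · have := (isPoleFreeTest_phiCut (a := a) hn k).1.testLimit.integral_potential_le hN hn a
    linarith
  · obtain ⟨G, hG, hG0, hGle, hGint⟩ := hmaj k
    refine (hdef k G hG hG0 hGle).trans ?_
    calc _ ≤ K / ((k : ℝ) + 1) ^ 2 * (M * (k + 1)) := by gcongr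
      _ = _ := by field_simp

/-- Keeps the denominators of the quotients away from zero: on a fixed nonempty open set of bounded
`logSum` the cut-off eventually equals `1`. -/
theorem exists_pos_le_integral_phiCut (hN : 5 ≤ N) (hn : 2 ≤ n) (ha : Function.Injective a) :
    ∃ c : ℝ, 0 < c ∧ ∀ᶠ k in atTop, c ≤ ∫ x, multipolarPotential a x * phiCut a k x ^ 2 := by
  obtain ⟨x₀, hx₀⟩ := (ae_mem_poleFree a hN).exists
  obtain ⟨m, hm⟩ := exists_nat_gt |logSum a x₀|
  set S : Set (Eucl N) := poleFree a ∩ (fun x => |logSum a x|) ⁻¹' Set.Iio (m : ℝ)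
  have hcont : ContinuousOn (fun x => |logSum a x|) (poleFree a) := fun x hx =>
    (contDiffAt_logDist a (m := 0) _ hx).continuousAt.abs.continuousWithinAt
  have hS : IsOpen S := hcont.isOpen_inter_preimage isOpen_poleFree isOpen_Iio
  have hcut : ∀ k, m ≤ k → ∀ x ∈ S, phiCut a k x = phi a x := by
    intro k hk x hx
    have hk' : (m : ℝ) ≤ k := by exact_mod_cast hk
    have h1 : |logSum a x| < m := hx.2
    unfold phiCut
    rw [cutoff_eq _ hx.1, profile_eq_one (by linarith), mul_one]
  have hint : ∀ k, Integrable fun x => multipolarPotential a x * phiCut a k x ^ 2 := fun k =>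
    integrable_potential_mul_sq_of_poleFree hN (isPoleFreeTest_phiCut hn k)
  have hnn : ∀ k x, 0 ≤ multipolarPotential a x * phiCut a k x ^ 2 := fun k x =>
    mul_nonneg (potential_nonneg a hN) (sq_nonneg _)
  refine ⟨∫ x in S, multipolarPotential a x * phiCut a m x ^ 2, ?_, ?_⟩
  · rw [setIntegral_pos_iff_support_of_nonneg_ae (Eventually.of_forall (hnn m))
      (hint m).integrableOn]
    refine (hS.measure_pos volume ⟨x₀, hx₀, hm⟩).trans_le (measure_mono fun x hx => ⟨?_, hx⟩)
    rw [Function.mem_support, hcut m le_rfl x hx]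
    exact (mul_pos (potential_pos a hN hn ha hx.1) (pow_pos (phi_pos a x) 2)).ne'
  · filter_upwards [eventually_ge_atTop m] with k hk
    calc _ = ∫ x in S, multipolarPotential a x * phiCut a k x ^ 2 :=
          setIntegral_congr_fun hS.measurableSet fun x hx => by
            simp only [hcut m le_rfl x hx, hcut k hk x hx]
      _ ≤ _ := setIntegral_le_integral (hint k) (Eventually.of_forall (hnn k))

end Remainder

/-! ### Sharpness, minimizers for `n ≥ 3`, non-attainment for `n = 2` -/

section Attained

variable {N n : ℕ} {a : Fin n → Eucl N} {w : ℕ → Eucl N → ℝ} {u g : Eucl N → ℝ}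

theorem rellichMinimizer_ae_eq (hN : 5 ≤ N) : rellichMinimizer a =ᵐ[volume] phi a := by
  filter_upwards [ae_mem_poleFree a hN] with x hx using rellichMinimizer_eq_phi a hx

/-- `|Δφ|`, `|∇φ| √T` and `φ T` are all bounded by a multiple of `φT`, which is square integrable
for `n ≥ 3`. So the general cut-off convergence applies to `φ`. -/
theorem testLimit_phiCut (hN : 5 ≤ N) (hn : 3 ≤ n) (ha : Function.Injective a) :
    TestLimit (phiCut a) (phi a) (Δ (phi a)) := by
  have hn2 : 2 ≤ n := by omega
  have hb := poleExp_pos hN hn2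
  have hF := memLp_phi_mul_invSqSum hN hn ha
  have hU := ae_mem_poleFree a hN
  set K := 1 + (2 * poleExp N n + poleExp N n ^ 2 * n) + poleExp N n / 2 * √(4 * n) with hK
  have hK1 : 2 * poleExp N n + poleExp N n ^ 2 * n ≤ K := by
    have : 0 ≤ poleExp N n / 2 * √(4 * n) := by positivity
    linarith
  have hK2 : poleExp N n / 2 * √(4 * n) ≤ K := by
    have : 0 ≤ poleExp N n ^ 2 * n := by positivity
    linarith
  have hK3 : 1 ≤ K := by
    have : 0 ≤ poleExp N n / 2 * √(4 * n) := by positivity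
    have : 0 ≤ poleExp N n ^ 2 * n := by positivity
    linarith
  have hm : AEStronglyMeasurable (Δ (phi a)) := by
    refine ((measurable_phi a).mul (measurable_phiPot a)).neg.aestronglyMeasurable.congr ?_
    filter_upwards [hU] with x hx
    rw [laplacian_phi a hn2 hx]; rfl
  have hD : MemLp (fun x => K * (phi a x * invSqSum a x)) 2 := hF.const_mul K
  have hle : ∀ x ∈ poleFree a, |Δ (phi a) x| ≤ K * (phi a x * invSqSum a x) ∧
      √(gdot (phi a) (phi a) x) * √(invSqSum a x) ≤ K * (phi a x * invSqSum a x) ∧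
      |phi a x| * invSqSum a x ≤ K * (phi a x * invSqSum a x) := by
    intro x hx
    have hp := phi_pos a x
    have hT := invSqSum_nonneg (a := a) (x := x)
    refine ⟨?_, ?_, ?_⟩
    · rw [laplacian_phi a hn2 hx, abs_neg, abs_of_pos (mul_pos hp (phiPot_pos a hN hn2 hx))]
      calc _ ≤ phi a x * ((2 * poleExp N n + poleExp N n ^ 2 * n) * invSqSum a x) := by
            gcongr; exact phiPot_le a hx
        _ = (2 * poleExp N n + poleExp N n ^ 2 * n) * (phi a x * invSqSum a x) := by ring
        _ ≤ _ := by gcongr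
    · calc _ ≤ (poleExp N n / 2) * √(4 * n) * (phi a x * √(invSqSum a x)) * √(invSqSum a x) := by
            gcongr; exact sqrt_gdot_phi_le hN hn2 hx
        _ = poleExp N n / 2 * √(4 * n) * (phi a x * (√(invSqSum a x) * √(invSqSum a x))) := by ring
        _ = poleExp N n / 2 * √(4 * n) * (phi a x * invSqSum a x) := by rw [Real.mul_self_sqrt hT]
        _ ≤ _ := by gcongr
    · rw [abs_of_pos hp]
      exact le_mul_of_one_le_left (by positivity) hK3
  obtain ⟨h1, h2, h3⟩ := tendsto_cutoff_profile hN hn2 (sobolevExp_ne_zero hN) sobolevExp_ne_top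
    (u := phi a) (fun x hx => contDiffAt_phi a hx) (memLp_phi hN hn ha) hm hD hle
  refine ⟨fun k => (h1 k).1, memLp_phi hN hn ha, hD.mono hm ?_, h3, h2⟩
  filter_upwards [hU] with x hx
  exact (hle x hx).1.trans (le_abs_self _)

/-- The deficits of the cut-off functions converge both to the deficit of `φ` and to zero. -/
theorem integral_laplacian_phi (hN : 5 ≤ N) (hn : 3 ≤ n) (ha : Function.Injective a) :
    ∫ x, (Δ (phi a) x) ^ 2 =
      rellichConstant N n * ∫ x, multipolarPotential a x * phi a x ^ 2 := by
  have hn2 : 2 ≤ n := by omega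
  have h := testLimit_phiCut hN hn ha
  have ht := h.tendsto_integral_laplacian.sub (h.tendsto_integral_potential hN hn2 a)
  exact sub_eq_zero.1 (tendsto_nhds_unique ht (tendsto_deficit hN hn2 ha))

theorem TestLimit.const_mul (h : TestLimit w u g) (c : ℝ) :
    TestLimit (fun k x => c * w k x) (fun x => c * u x) (fun x => c * g x) := by
  refine ⟨fun k => ⟨contDiff_const.mul (h.test k).1, (h.test k).2.mul_left⟩, h.memLp.const_mul c,
    h.memLp_two.const_mul c, ?_, ?_⟩
  · have e : ∀ k, eLpNorm (fun x => Δ (fun y => c * w k y) x - c * g x) 2 volume =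
        ‖c‖ₑ * eLpNorm (fun x => Δ (w k) x - g x) 2 volume := by
      intro k
      rw [← eLpNorm_const_smul]
      congr 1; funext x
      rw [laplacian_const_mul c ((h.test k).contDiffAt_two x)]
      simp only [Pi.smul_apply, smul_eq_mul]; ring
    simp only [e]
    simpa using ENNReal.Tendsto.const_mul h.tendsto_laplacian (Or.inr enorm_ne_top)
  · have e : ∀ k, eLpNorm (fun x => c * w k x - c * u x) (sobolevExp N) volume =
        ‖c‖ₑ * eLpNorm (fun x => w k x - u x) (sobolevExp N) volume := by
      intro k
      rw [← eLpNorm_const_smul]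
      congr 1; funext x
      simp only [Pi.smul_apply, smul_eq_mul]; ring
    simp only [e]
    simpa using ENNReal.Tendsto.const_mul h.tendsto (Or.inr enorm_ne_top)

theorem attainsRellich_of_ae_eq (hN : 5 ≤ N) (hn : 3 ≤ n) (ha : Function.Injective a) {c : ℝ}
    (hc : c ≠ 0) (hu : u =ᵐ[volume] fun x => c * phi a x) : AttainsRellich a u := by
  have hn2 : 2 ≤ n := by omega
  have h : TestLimit _ u fun x => c * Δ (phi a) x :=
    ((testLimit_phiCut hN hn ha).const_mul c).congr hu.symm EventuallyEq.rfl
  refine ⟨h.memD22 hN, fun h0 => ?_, _, h.hasWeakLaplacian hN, h.memLp_two.integrable_sq,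
    h.integrable_potential hN hn2 a, ?_⟩
  · obtain ⟨x, hx0, hx⟩ := (h0.and hu).exists
    rw [hx0] at hx
    exact mul_ne_zero hc (phi_pos a x).ne' hx.symm
  · have e : ∫ x, multipolarPotential a x * u x ^ 2 =
        ∫ x, c ^ 2 * (multipolarPotential a x * phi a x ^ 2) := by
      refine integral_congr_ae ?_
      filter_upwards [hu] with x hx
      rw [hx]; ring
    simp only [mul_pow]
    rw [e, integral_const_mul, integral_const_mul, integral_laplacian_phi hN hn ha]
    ring

theorem AttainsRellich.exists_eq_mul_phi (hN : 5 ≤ N) (hn : 2 ≤ n) (h : AttainsRellich a u) :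
    ∃ c : ℝ, c ≠ 0 ∧ u =ᵐ[volume] fun x => c * phi a x := by
  obtain ⟨hD, h0, g, hg, -, -, heq⟩ := h
  obtain ⟨w, hw⟩ := hD.exists_testLimit hg
  obtain ⟨c, hc⟩ := hw.exists_eq_mul_phi hN hn a heq
  refine ⟨c, fun hc0 => h0 ?_, hc⟩
  filter_upwards [hc] with x hx
  simpa [hc0] using hx

theorem not_integrableOn_ball_norm_rpow (hN : 5 ≤ N) :
    ¬ IntegrableOn (fun x : Eucl N => ‖x‖ ^ (-(N : ℝ))) (Metric.ball 0 1) := by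
  have : Nonempty (Fin N) := ⟨⟨0, by omega⟩⟩
  intro h
  have h1 := (integrableOn_fun_norm_addHaar (volume : Measure (Eucl N))
    (f := fun y : ℝ => y ^ (-(N : ℝ)))).1 h
  simp only [finrank_euclideanSpace, Fintype.card_fin, smul_eq_mul] at h1
  have h2 : IntegrableOn (fun y : ℝ => y⁻¹) (Set.Ioo 0 1) := by
    refine h1.congr_fun (fun y hy => ?_) measurableSet_Ioo
    simp only [pow_mul_rpow_neg hN hy.1]
    rw [show (N : ℝ) - 1 - N = -1 by ring, Real.rpow_neg_one]
  have h3 : IntervalIntegrable (fun y : ℝ => y⁻¹) volume 0 1 :=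
    (intervalIntegrable_iff_integrableOn_Ioo_of_le zero_le_one).2 h2
  simp at h3

/-- The relevant power of `φ` is `|x - a 0| ^ (-N) |x - a 1| ^ (-N)`. On the unit ball about `a 0`
the second factor is bounded below, and the first is not integrable. -/
theorem not_memLp_phi (hN : 5 ≤ N) (a : Fin 2 → Eucl N) :
    ¬ MemLp (phi a) (sobolevExp N) := by
  intro h
  have hN' : (5 : ℝ) ≤ N := by exact_mod_cast hN
  have hp : (sobolevExp N).toReal = 2 * N / ((N : ℝ) - 4) :=
    ENNReal.toReal_ofReal (div_nonneg (by positivity) (by linarith))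
  have h4 : (N : ℝ) - 4 ≠ 0 := by linarith
  have hi := (integrable_norm_rpow_iff h.1 (sobolevExp_ne_zero hN) sobolevExp_ne_top).2 h
  set d := ‖a 0 - a 1‖
  have hd : 0 ≤ d := norm_nonneg _
  have hlow : ∀ x ∈ poleFree a, ‖x - a 0‖ < 1 →
      ‖x - a 0‖ ^ (-(N : ℝ)) ≤ (1 + d) ^ (N : ℝ) * ‖phi a x‖ ^ (sobolevExp N).toReal := by
    intro x hx hx1
    have r0 := norm_sub_pos hx 0
    have r1 := norm_sub_pos hx 1
    have h1 : ‖x - a 1‖ ≤ 1 + d := by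
      calc ‖x - a 1‖ = ‖(x - a 0) + (a 0 - a 1)‖ := by congr 1; abel
        _ ≤ ‖x - a 0‖ + d := norm_add_le _ _
        _ ≤ _ := by linarith
    have e : ‖phi a x‖ ^ (sobolevExp N).toReal = ‖x - a 0‖ ^ (-(N : ℝ)) * ‖x - a 1‖ ^ (-(N : ℝ)) := by
      rw [Real.norm_eq_abs, abs_of_pos (phi_pos a x), ← rellichMinimizer_eq_phi a hx,
        rellichMinimizer, Fin.prod_univ_two, Real.mul_rpow (by positivity) (by positivity),
        ← Real.rpow_mul r0.le, ← Real.rpow_mul r1.le, hp]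
      have : (4 - (N : ℝ)) / (2 : ℕ) * (2 * N / ((N : ℝ) - 4)) = -N := by
        push_cast; field_simp; ring
      rw [this]
    rw [e]
    have h2 : 1 ≤ (1 + d) ^ (N : ℝ) * ‖x - a 1‖ ^ (-(N : ℝ)) := by
      rw [Real.rpow_neg r1.le, ← div_eq_mul_inv, one_le_div (by positivity)]
      gcongr
    calc _ = ‖x - a 0‖ ^ (-(N : ℝ)) * 1 := (mul_one _).symm
      _ ≤ ‖x - a 0‖ ^ (-(N : ℝ)) * ((1 + d) ^ (N : ℝ) * ‖x - a 1‖ ^ (-(N : ℝ))) := by gcongr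
      _ = _ := by ring
  refine not_integrableOn_ball_norm_rpow hN ?_
  rw [← integrable_indicator_iff Metric.isOpen_ball.measurableSet]
  have hm : Measurable ((Metric.ball (0 : Eucl N) 1).indicator fun x => ‖x‖ ^ (-(N : ℝ))) :=
    Measurable.indicator (by fun_prop) Metric.isOpen_ball.measurableSet
  have hshift : Integrable fun x => (Metric.ball (0 : Eucl N) 1).indicator
      (fun x => ‖x‖ ^ (-(N : ℝ))) (x - a 0) := by
    refine (hi.const_mul ((1 + d) ^ (N : ℝ))).mono'
      (hm.comp (measurable_id.sub_const (a 0))).aestronglyMeasurable ?_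
    filter_upwards [ae_mem_poleFree a hN] with x hx
    by_cases hb : x - a 0 ∈ Metric.ball (0 : Eucl N) 1
    · rw [Set.indicator_of_mem hb, Real.norm_eq_abs, abs_of_nonneg (by positivity)]
      exact hlow x hx (by simpa using hb)
    · rw [Set.indicator_of_notMem hb, norm_zero]
      positivity
  simpa using hshift.comp_add_right (a 0)

theorem not_attainsRellich_two (hN : 5 ≤ N) (a : Fin 2 → Eucl N) (u : Eucl N → ℝ) :
    ¬ AttainsRellich a u := by
  intro h
  obtain ⟨c, hc, hu⟩ := h.exists_eq_mul_phi hN le_rfl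
  refine not_memLp_phi hN a ?_
  have h1 : MemLp u (sobolevExp N) := h.1.1
  refine (memLp_congr_ae ?_).1 (h1.const_mul c⁻¹)
  filter_upwards [hu] with x hx
  rw [hx, inv_mul_cancel_left₀ hc]

/-- The quotient of `phiCut a k` is `C` plus deficit over potential integral. The deficit tends to
zero while the denominator stays bounded below, so no larger lower bound exists. -/
theorem isGLB_rellichQuotients (hN : 5 ≤ N) (hn : 2 ≤ n) (ha : Function.Injective a) :
    IsGLB (rellichQuotients a) (rellichConstant N n) := by
  constructor
  · rintro q ⟨u, g, hu, h0, hg, rfl⟩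
    obtain ⟨w, hw⟩ := hu.exists_testLimit hg
    rw [le_div_iff₀ (hw.integral_potential_pos hN hn ha h0)]
    exact hw.integral_potential_le hN hn a
  · intro b hb
    obtain ⟨c, hc, hev⟩ := exists_pos_le_integral_phiCut hN hn ha
    have hlim := ((tendsto_deficit hN hn ha).div_const c).const_add (rellichConstant N n)
    rw [zero_div, add_zero] at hlim
    refine ge_of_tendsto hlim ?_
    filter_upwards [hev] with k hk
    have ht := (isPoleFreeTest_phiCut (a := a) hn k).1.testLimit
    have hpos := hc.trans_le hk
    have hne : ¬ phiCut a k =ᵐ[volume] 0 := fun h => by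
      have : ∫ x, multipolarPotential a x * phiCut a k x ^ 2 = 0 :=
        integral_eq_zero_of_ae (by filter_upwards [h] with x hx; simp [hx])
      exact hpos.ne' this
    refine (hb ⟨phiCut a k, _, ht.memD22 hN, hne, ht.hasWeakLaplacian hN, rfl⟩).trans ?_
    have hle := ht.integral_potential_le hN hn a
    set I := ∫ x, multipolarPotential a x * phiCut a k x ^ 2
    set J := ∫ x, (Δ (phiCut a k) x) ^ 2
    calc J / I = rellichConstant N n + (J - rellichConstant N n * I) / I := by
          field_simp
          ring
      _ ≤ rellichConstant N n + (J - rellichConstant N n * I) / c := by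
          gcongr

end Attained

end

/-! ### The main theorem -/

theorem theorem1p3 (N n : ℕ) (hN : 5 ≤ N) (hn : 2 ≤ n)
    (a : Fin n → EuclideanSpace ℝ (Fin N)) (ha : Function.Injective a) :
    -- the inequality
    (∀ u : EuclideanSpace ℝ (Fin N) → ℝ, IsTestFunction u →
      Integrable (fun x => multipolarPotential a x * u x ^ 2) ∧
      rellichConstant N n * ∫ x, multipolarPotential a x * u x ^ 2 ≤ ∫ x, (Δ u x) ^ 2) ∧
    -- the constant is sharp: it is the infimum of the (well-defined) quotients over `D^{2,2}`
    (∀ u : EuclideanSpace ℝ (Fin N) → ℝ, MemD22 u → ¬ u =ᵐ[volume] 0 →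
      Integrable (fun x => multipolarPotential a x * u x ^ 2) ∧
      0 < ∫ x, multipolarPotential a x * u x ^ 2) ∧
    IsGLB (rellichQuotients a) (rellichConstant N n) ∧
    -- for `n ≥ 3` the minimizers are exactly the nonzero multiples of `φ`
    (3 ≤ n → AttainsRellich a (rellichMinimizer a) ∧
      ∀ u : EuclideanSpace ℝ (Fin N) → ℝ, AttainsRellich a u ↔
        ∃ c : ℝ, c ≠ 0 ∧ u =ᵐ[volume] fun x => c * rellichMinimizer a x) ∧
    -- for `n = 2` the constant is not attained
    (n = 2 → ¬ ∃ u : EuclideanSpace ℝ (Fin N) → ℝ, AttainsRellich a u) := by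
  refine ⟨fun u hu => ⟨hu.testLimit.integrable_potential hN hn a,
    hu.testLimit.integral_potential_le hN hn a⟩, fun u hu h0 => ?_,
    isGLB_rellichQuotients hN hn ha, fun h3 => ?_, ?_⟩
  · obtain ⟨w, hw⟩ := hu.exists_testLimit hu.2.choose_spec.1
    exact ⟨hw.integrable_potential hN hn a, hw.integral_potential_pos hN hn ha h0⟩
  · have hφ := rellichMinimizer_ae_eq (a := a) hN
    have hmul : ∀ c : ℝ, (fun x => c * rellichMinimizer a x) =ᵐ[volume] fun x => c * phi a x := by
      intro c
      filter_upwards [hφ] with x hx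
      rw [hx]
    refine ⟨attainsRellich_of_ae_eq hN h3 ha one_ne_zero (by simpa using hφ), fun u =>
      ⟨fun h => ?_, fun ⟨c, hc, hu⟩ => attainsRellich_of_ae_eq hN h3 ha hc (hu.trans (hmul c))⟩⟩
    obtain ⟨c, hc, hu⟩ := h.exists_eq_mul_phi hN hn
    exact ⟨c, hc, hu.trans (hmul c).symm⟩
  · rintro rfl ⟨u, hu⟩
    exact not_attainsRellich_two hN a u hu
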